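/- Let $\mathfrak g_0$ be a compact semisimple real Lie algebra (negative definite Killing form) equipped with an inner product, and let $U$ be a finite dimensional real $\mathfrak g_0$-module with an inner product for which every $j(Z)\colon U\to U$, $j(Z)X=ZX$, is skew symmetric; assume $\{u\in U: Zu=0\ \forall Z\in\mathfrak g_0\}=0$. Let $\mathfrak N=U\oplus\mathfrak g_0$ (orthogonal sum) be the 2-step nilpotent Lie algebra with $\mathfrak g_0$ central and $\langle[X,Y],Z\rangle=\langle ZX,Y\rangle$ for $X,Y\in U$, $Z\in\mathfrak g_0$, and let $N$ be the simply connected Lie group with Lie algebra $\mathfrak N$ and the corresponding left invariant metric. Let $\mathfrak h_0\subseteq\mathfrak g_0$ be a maximal abelian subalgebra, $\mathfrak h=\mathfrak h_0^{\mathbb C}$, $\mathfrak g=\mathfrak g_0^{\mathbb C}$, $V=U^{\mathbb C}$, $\Phi$ the set of roots of $(\mathfrak g,\mathfrak h)$, $\Lambda$ the set of weights of $V$, and $U_\beta=(V_\beta\oplus V_{-\beta})\cap U$. Assume that every $\beta\in\Phi$ is a weight of $V$ with $\dim_{\mathbb C}V_\beta\ge 2$. Let $\{\tau_\alpha\ (\alpha\in\Delta),\,X_\beta\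 (\beta\in\Phi)\}$ be a Chevalley basis of $\mathfrak g$ determined by $\mathfrak h$ for which the elements $i\tau_\alpha$, $A_\beta=X_\beta-X_{-\beta}$, $B_\beta=i(X_\beta+X_{-\beta})$ of the compact Chevalley basis $\mathcal C_0$ lie in $\mathfrak g_0$, and let $\mathcal B$ be a basis of $U$ whose $\mathbb Q$-span is invariant under $\mathcal C_0$. Put $\mathfrak h_{\mathbb Q}=\mathbb Q\text{-span}\{i\tau_\alpha:\alpha\in\Delta\}$. Let $G_0$ be the compact simply connected Lie group with Lie algebra $\mathfrak g_0$, $\rho\colon G_0\to GL(U)$ the representation with differential $j$, $dI_g=(\rho(g),\mathrm{Ad}(g))$ on $\mathfrak N$, $G_{\mathcal B,\mathbb Q}=\{g\in G_0:\rho(g)\text{ leaves }\mathbb Q\text{-span}(\mathcal B)\text{ invariant}\}$ and $\mathfrak g_{\mathbb Q}=\mathrm{Ad}(G_{\mathcal B,\mathbb Q})(\mathfrak h_{\mathbb Q})$. An element $Z\in\mathfrak h_0$ is super regular if $\lambda(Z)\ne0$ for all nonzero $\lambda\in\Lambda$ and $\lambda(Z)^2=\mu(Z)^2$ with $\lambda,\mu\in\Lambda$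 implies $\mu=\pm\lambda$; $Z\in\mathfrak g_0$ is super regular if $\mathrm{Ad}(g)Z$ lies in $\mathfrak h_0$ and is super regular for some $g\in G_0$. For $Z\in\mathfrak g_0$ let $$\mathfrak N_Z=\{X+\alpha Z: X\in U,\ X_0\ne0,\ 0\ne\alpha\in\mathbb R\},\qquad \mathfrak W_Z=\ker j(Z)\oplus\mathfrak g_0,$$ where $X_0$ is the orthogonal projection of $X$ to $\ker j(Z)$. The set $\mathfrak N_Z$ is regarded as a subset of the vector space $U\oplus\mathbb RZ$. For $\xi=X+\alpha Z\in\mathfrak N_Z$ let $\gamma_\xi$ be the geodesic of $N$ with $\gamma_\xi(0)=e$, $\gamma_\xi'(0)=\xi$, and let $F_Z(\xi)=\log\gamma_\xi(\omega)$, where $\omega>0$ is the first positive number with $e^{\omega j(\alpha Z)}=\mathrm{Id}$ (the first hit map). For $Z\in\mathfrak h_{\mathbb Q}$ super regular let $\mathfrak N_Z^*$ be the set of all $X+\alpha Z\in\mathfrak N_Z$ such that, for all $\beta\in\Phi$, $A_\beta(X_0)\neq0$ and $X_\beta\notin\mathrm{span}\{A_\beta(X_0),B_\beta(X_0)\}$,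 where $X_\beta$ is the orthogonal projection of $X$ to $U_\beta$. (1) Let $Z\in\mathfrak h_{\mathbb Q}$ be super regular. Then $F_Z\colon\mathfrak N_Z\to\mathfrak W_Z$ is well defined, $\mathfrak N_Z^*$ is a dense open subset of $\mathfrak N_Z$, and $F_Z$ has maximal rank at every point of $\mathfrak N_Z^*$: it is differentiable there and its differential $U\oplus\mathbb RZ\to\mathfrak W_Z$ is surjective. (2) Let $Z\in\mathfrak g_{\mathbb Q}$ be super regular. Then $F_Z\colon\mathfrak N_Z\to\mathfrak W_Z$ is well defined, there is $g\in G_{\mathcal B,\mathbb Q}$ with $\mathrm{Ad}(g)Z\in\mathfrak h_{\mathbb Q}$, and for every such $g$ the set $\mathfrak N_Z^*=\{\xi\in\mathfrak N_Z: dI_g(\xi)\in\mathfrak N_{\mathrm{Ad}(g)Z}^*\}$ is a dense open subset of $\mathfrak N_Z$ and $F_Z$ has maximal rank (surjective differential onto $\mathfrak W_Z$) at every point of $\mathfrak N_Z^*$. -/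

import Mathlib

open scoped TensorProduct InnerProductSpace

/-- A real Lie algebra which also carries an inner product (no compatibility between the bracket
and the inner product is built in). The class only makes the two structures share the same
underlying vector space. -/
class InnerLieAlgebra (L : Type*) extends
  NormedAddCommGroup L, InnerProductSpace ℝ L, LieRing L, LieAlgebra ℝ L

namespace FirstHit

/-- A real Lie algebra is compact semisimple when its Killing form is negative definite. -/
def IsCompactSemisimple (L : Type*) [LieRing L] [LieAlgebra ℝ L] : Prop :=
  ∀ x : L, x ≠ 0 → killingForm ℝ L x x < 0

/-- The rational span of a subset of a real vector space. -/
def ratSpan {E : Type*} [AddCommGroup E] [Module ℝ E] (S : Set E) : AddSubgroup E :=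
  AddSubgroup.closure {y | ∃ (q : ℚ) (s : E), s ∈ S ∧ y = (q : ℝ) • s}

noncomputable section

/-! ### Weights, roots and compact Chevalley bases -/

section Weights

variable {L : Type*} [LieRing L] [LieAlgebra ℝ L] (h₀ : LieSubalgebra ℝ L)

/-- `h₀` is a maximal abelian subalgebra. -/
def IsMaximalAbelian : Prop :=
  Maximal (fun h : LieSubalgebra ℝ L => IsLieAbelian h) h₀

/-- The complexification `h = h₀ ⊗ ℂ`, as a subspace of `ℂ ⊗ L`. -/
abbrev complexCartan : Submodule ℂ (ℂ ⊗[ℝ] L) :=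
  h₀.toSubmodule.baseChange ℂ

/-- Complex linear functionals on `h`. -/
abbrev CartanDual : Type _ := Module.Dual ℂ (complexCartan h₀)

/-- An element of `h₀` regarded as an element of `h`. -/
def toComplexCartan (Z : h₀) : complexCartan h₀ :=
  ⟨1 ⊗ₜ[ℝ] (Z : L), Submodule.tmul_mem_baseChange_of_mem 1 Z.2⟩

variable (M : Type*) [AddCommGroup M] [Module ℝ M] [LieRingModule L M] [LieModule ℝ L M]

/-- The weight space `{v ∈ ℂ ⊗ M | H v = μ(H) v for all H ∈ h}` in the complexification of the
real module `M`. -/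
def weightSpace (μ : CartanDual h₀) : Submodule ℂ (ℂ ⊗[ℝ] M) :=
  ⨅ H : complexCartan h₀,
    Module.End.eigenspace (LieModule.toEnd ℂ (ℂ ⊗[ℝ] L) (ℂ ⊗[ℝ] M) (H : ℂ ⊗[ℝ] L)) (μ H)

theorem mem_weightSpace (μ : CartanDual h₀) (v : ℂ ⊗[ℝ] M) :
    v ∈ weightSpace h₀ M μ ↔ ∀ H : complexCartan h₀,
      LieModule.toEnd ℂ (ℂ ⊗[ℝ] L) (ℂ ⊗[ℝ] M) (H : ℂ ⊗[ℝ] L) v = μ H • v := by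
  simp only [weightSpace, Submodule.mem_iInf, Module.End.mem_eigenspace_iff]

/-- `μ` is a weight of `ℂ ⊗ M` (the zero functional is allowed). -/
def IsWeight (μ : CartanDual h₀) : Prop := weightSpace h₀ M μ ≠ ⊥

/-- `α` is a (nonzero) root of `ℂ ⊗ L` with respect to `h`. -/
def IsRoot (α : CartanDual h₀) : Prop := α ≠ 0 ∧ weightSpace h₀ L α ≠ ⊥

/-- The real weight space `M_μ = (V_μ ⊕ V_{-μ}) ∩ M`, where `V = ℂ ⊗ M`. -/
def realWeightSpace (μ : CartanDual h₀) : Submodule ℝ M :=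
  ((weightSpace h₀ M μ ⊔ weightSpace h₀ M (-μ)).restrictScalars ℝ).comap
    (TensorProduct.mk ℝ ℂ M 1)

/-- A Chevalley basis `{τ_α, X_β}` of `ℂ ⊗ L` determined by `h` whose associated vectors
`i τ_α`, `A_β = X_β - X_{-β}`, `B_β = i (X_β + X_{-β})` lie in the real form `L`, i.e. a compact
Chevalley basis of `L`. All families are indexed by the dual of `h` and only their values on the
roots are meaningful. -/
structure CompactChevalleyBasis where
  /-- the simple roots -/
  Δ : Set (CartanDual h₀)
  isRoot_of_mem : ∀ α ∈ Δ, IsRoot h₀ α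
  linearIndependent : LinearIndependent ℂ (fun α : Δ => (α : CartanDual h₀))
  pos_or_neg : ∀ β, IsRoot h₀ β →
    β ∈ AddSubmonoid.closure Δ ∨ -β ∈ AddSubmonoid.closure Δ
  /-- the vector of `h` dual to a root with respect to the Killing form -/
  Hvec : CartanDual h₀ → complexCartan h₀
  killing_Hvec : ∀ α, IsRoot h₀ α → ∀ H : complexCartan h₀,
    killingForm ℂ (ℂ ⊗[ℝ] L) H (Hvec α) = α H
  /-- the coroots -/
  τ : CartanDual h₀ → ℂ ⊗[ℝ] L
  τ_eq : ∀ α, IsRoot h₀ α →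
    τ α = (2 / killingForm ℂ (ℂ ⊗[ℝ] L) (Hvec α) (Hvec α)) • (Hvec α : ℂ ⊗[ℝ] L)
  /-- the root vectors -/
  X : CartanDual h₀ → ℂ ⊗[ℝ] L
  X_mem : ∀ β, IsRoot h₀ β → X β ∈ weightSpace h₀ L β
  lie_X_neg : ∀ α, IsRoot h₀ α → LieAlgebra.ad ℂ (ℂ ⊗[ℝ] L) (X α) (X (-α)) = τ α
  lie_X : ∀ α β, IsRoot h₀ α → IsRoot h₀ β → IsRoot h₀ (α + β) →
    ∃ c : ℂ, LieAlgebra.ad ℂ (ℂ ⊗[ℝ] L) (X α) (X β) = c • X (α + β) ∧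
      LieAlgebra.ad ℂ (ℂ ⊗[ℝ] L) (X (-α)) (X (-β)) = (-c) • X (-α + -β)
  /-- the elements `i τ_α` of `h₀` -/
  T : CartanDual h₀ → L
  T_mem : ∀ α, IsRoot h₀ α → T α ∈ h₀
  T_eq : ∀ α, IsRoot h₀ α → (1 : ℂ) ⊗ₜ[ℝ] T α = Complex.I • τ α
  /-- the elements `X_β - X_{-β}` of `L` -/
  A : CartanDual h₀ → L
  A_eq : ∀ β, IsRoot h₀ β → (1 : ℂ) ⊗ₜ[ℝ] A β = X β - X (-β)
  /-- the elements `i (X_β + X_{-β})` of `L` -/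
  B : CartanDual h₀ → L
  B_eq : ∀ β, IsRoot h₀ β → (1 : ℂ) ⊗ₜ[ℝ] B β = Complex.I • (X β + X (-β))

variable {h₀}

/-- The compact Chevalley basis as a subset of `L`. -/
def CompactChevalleyBasis.toSet (C : CompactChevalleyBasis h₀) : Set L :=
  {c | ∃ α ∈ C.Δ, c = C.T α} ∪ {c | ∃ β, IsRoot h₀ β ∧ (c = C.A β ∨ c = C.B β)}

/-- `h_ℚ`, the rational span of `{i τ_α | α simple}`. -/
def CompactChevalleyBasis.hQ (C : CompactChevalleyBasis h₀) : AddSubgroup L :=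
  ratSpan (C.T '' C.Δ)

variable (h₀)

/-- `Z` lies in `h₀` and is super regular for the module `M`: `μ(Z) ≠ 0` for every nonzero weight
`μ`, and `μ(Z)² = ν(Z)²` for weights `μ, ν` forces `ν = ± μ`. -/
def IsSuperRegularIn (Z : L) : Prop :=
  ∃ hZ : Z ∈ h₀,
    (∀ μ, IsWeight h₀ M μ → μ ≠ 0 → μ (toComplexCartan h₀ ⟨Z, hZ⟩) ≠ 0) ∧
    ∀ μ ν, IsWeight h₀ M μ → IsWeight h₀ M ν →
      μ (toComplexCartan h₀ ⟨Z, hZ⟩) ^ 2 = ν (toComplexCartan h₀ ⟨Z, hZ⟩) ^ 2 →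
      ν = μ ∨ ν = -μ

end Weights

/-! ### The metric 2-step nilpotent Lie algebra and its group -/

section Metric

variable {L : Type*} [InnerLieAlgebra L] [FiniteDimensional ℝ L]
variable {U : Type*} [NormedAddCommGroup U] [InnerProductSpace ℝ U] [FiniteDimensional ℝ U]
  [LieRingModule L U] [LieModule ℝ L U]

variable (U) in
/-- The representation `j : L → End U`. -/
def j (Z : L) : U →L[ℝ] U := LinearMap.toContinuousLinearMap (LieModule.toEnd ℝ L U Z)

variable (L) in
/-- The linear map `Z ↦ Z X` from `L` to `U`. -/
def evalAt (X : U) : L →ₗ[ℝ] U where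
  toFun Z := ⁅Z, X⁆
  map_add' Y Z := add_lie Y Z X
  map_smul' c Z := smul_lie c Z X

variable (L) in
/-- The bracket `U × U → L`, determined by `⟪[X, Y], Z⟫ = ⟪Z X, Y⟫` for all `Z`
(see `inner_nilBracket`). -/
def nilBracket (X Y : U) : L := LinearMap.adjoint (evalAt L X) Y

theorem inner_nilBracket (X Y : U) (Z : L) : ⟪nilBracket L X Y, Z⟫_ℝ = ⟪⁅Z, X⁆, Y⟫_ℝ := by
  rw [nilBracket, LinearMap.adjoint_inner_left, real_inner_comm]
  rfl

/-- The multiplication of the simply connected Lie group `N` with Lie algebra `U ⊕ L` in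
exponential coordinates (Baker-Campbell-Hausdorff): `x y = x + y + [x, y] / 2`. The underlying
manifold of `N` is the vector space `U × L`, the maps `exp` and `log` are the identity, the neutral
element is `0` and the inverse of `x` is `-x`. -/
def nilMul (x y : U × L) : U × L :=
  (x.1 + y.1, x.2 + y.2 + (1 / 2 : ℝ) • nilBracket L x.1 y.1)

/-- The inner product on `U ⊕ L` for which the two summands are orthogonal. -/
def nilInner (v w : U × L) : ℝ := ⟪v.1, w.1⟫_ℝ + ⟪v.2, w.2⟫_ℝ

/-- The left invariant Riemannian metric on `N` whose value at the neutral element is `nilInner`: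
tangent vectors at `n` are moved to the neutral element by the differential of left translation by
`n⁻¹ = -n`. -/
def leftMetric (n v w : U × L) : ℝ :=
  nilInner (fderiv ℝ (nilMul (-n)) n v) (fderiv ℝ (nilMul (-n)) n w)

/-- Geodesics of `leftMetric`, through the geodesic equation in the global chart `U × L`, written as
the Euler-Lagrange equation of the energy: for every constant vector field `w`,
`d/dt g_γ(γ', w) = (1/2) (∂_w g)_γ(γ', γ')`. -/
def IsGeodesic (γ : ℝ → U × L) : Prop :=
  ContDiff ℝ 2 γ ∧ ∀ (w : U × L) (t : ℝ),
    HasDerivAt (fun s => leftMetric (γ s) (deriv γ s) w)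
      ((1 / 2 : ℝ) * fderiv ℝ (fun n => leftMetric n (deriv γ t) (deriv γ t)) (γ t) w) t

/-- `γ` is a geodesic with `γ(0) = e` and `γ'(0) = ξ`. -/
def IsGeodesicFrom (ξ : U × L) (γ : ℝ → U × L) : Prop :=
  IsGeodesic γ ∧ γ 0 = 0 ∧ deriv γ 0 = ξ

/-- The geodesic with `γ(0) = e` and `γ'(0) = ξ`. -/
def geodesic (ξ : U × L) : ℝ → U × L := Classical.epsilon (IsGeodesicFrom ξ)

variable (U) in
/-- The positive numbers `ω` with `e^{ω j(Y)} = Id`. -/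
def periods (Y : L) : Set ℝ := {ω | 0 < ω ∧ NormedSpace.exp (ω • j U Y) = 1}

/-- The first hit map `ξ = X + Y ↦ log γ_ξ(ω)`, where `ω` is the first positive number with
`e^{ω j(Y)} = Id`. For `ξ = X + α Z` in `domainSet Z` this is `F_Z(ξ)`. -/
def firstHit (ξ : U × L) : U × L := geodesic ξ (sInf (periods U ξ.2))

variable (U) in
/-- The vector space `U ⊕ ℝ Z`, which contains `domainSet U Z` as an open subset
(when `Z ≠ 0`). -/
def domainSpace (Z : L) : Submodule ℝ (U × L) :=
  Submodule.prod ⊤ (Submodule.span ℝ {Z})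

/-- The component `X₀` of `X` in `ker j(Z)` along the orthogonal complement of `ker j(Z)`. -/
def kerComponent (Z : L) (X : U) : U := (j U Z).ker.starProjection X

variable (U) in
/-- The set `𝔑_Z` of all `X + α Z` with `α ≠ 0` and `X` having nonzero component in
`ker j(Z)`. -/
def domainSet (Z : L) : Set (U × L) :=
  {ξ | kerComponent Z ξ.1 ≠ 0 ∧ ∃ α : ℝ, α ≠ 0 ∧ ξ.2 = α • Z}

variable (U) in
/-- The space `𝔚_Z = ker j(Z) ⊕ L`. -/
def targetSpace (Z : L) : Submodule ℝ (U × L) := Submodule.prod (j U Z).ker ⊤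

/-- `F` is differentiable at `ξ` as a map from the vector space `D` to the vector space `W` and its
differential at `ξ` is surjective, i.e. has the maximal possible rank `dim W`. -/
def HasMaximalRankAt {E : Type*} [NormedAddCommGroup E] [NormedSpace ℝ E] (D W : Submodule ℝ E)
    (F : E → E) (ξ : D) : Prop :=
  ∃ F' : D →L[ℝ] W, HasFDerivAt (fun η : D => F η) (W.subtypeL.comp F') ξ ∧
    Function.Surjective F'

variable (U) in
/-- The first hit map `F_Z : 𝔑_Z → 𝔚_Z` is well defined: for `ξ = X + α Z` in `𝔑_Z` the geodesic
`γ_ξ` exists and is unique, there is a first positive `ω` with `e^{ω j(α Z)} = Id`, and `F_Z(ξ)`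
lies in `𝔚_Z`. -/
def FirstHitWellDefined (Z : L) : Prop :=
  ∀ ξ ∈ domainSet U Z, (∃! γ : ℝ → U × L, IsGeodesicFrom ξ γ) ∧
    (∃ ω, IsLeast (periods U ξ.2) ω) ∧ firstHit ξ ∈ targetSpace U Z

/-- `F_Z : 𝔑_Z → 𝔚_Z` has maximal rank at every point of the subset `S` of `𝔑_Z`. -/
def FirstHitMaximalRankOn (Z : L) (S : Set (U × L)) : Prop :=
  ∀ ξ : domainSpace U Z, (ξ : U × L) ∈ S →
    HasMaximalRankAt (domainSpace U Z) (targetSpace U Z) firstHit ξ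

/-- `S` is a dense open subset of the topological subspace `T`. -/
def IsDenseOpenIn {E : Type*} [TopologicalSpace E] (S T : Set E) : Prop :=
  S ⊆ T ∧ IsOpen ((↑) ⁻¹' S : Set T) ∧ Dense ((↑) ⁻¹' S : Set T)

variable {h₀ : LieSubalgebra ℝ L}

variable (U) in
/-- The set `𝔑_Z^*` for `Z ∈ h_ℚ`: all `X + α Z` in `𝔑_Z` such that, for every root `β`,
`X₀ ∉ ker A_β` and the component `X_β` of `X` in `U_β` is not in the span of `A_β(X₀)` and
`B_β(X₀)`. -/
def starSet (C : CompactChevalleyBasis h₀) (Z : L) : Set (U × L) :=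
  {ξ | ξ ∈ domainSet U Z ∧ ∀ β, IsRoot h₀ β →
    ⁅C.A β, kerComponent Z ξ.1⁆ ≠ 0 ∧
    (realWeightSpace h₀ U β).starProjection ξ.1 ∉
      Submodule.span ℝ {⁅C.A β, kerComponent Z ξ.1⁆, ⁅C.B β, kerComponent Z ξ.1⁆}}

/-! ### The group action -/

variable (L U) in
/-- The set of all pairs `(ρ(g), Ad(g))` with `g` in the compact simply connected Lie group `G₀` with
Lie algebra `L`, where `ρ : G₀ → GL(U)` is the representation with differential `j`. As `G₀` is
connected, it is generated by the image of `exp : L → G₀`, and `ρ(exp Y) = e^{j(Y)}`,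
`Ad(exp Y) = e^{ad Y}`. (The generating set is closed under inverses, so the generated submonoid
is a group.) -/
def groupAction : Submonoid ((U →L[ℝ] U) × (L →L[ℝ] L)) :=
  Submonoid.closure (Set.range fun Y : L =>
    (NormedSpace.exp (j U Y), NormedSpace.exp (j L Y)))

/-- The isomorphism `dI_g = (ρ(g), Ad(g))` of `U ⊕ L`. -/
def dI (g : (U →L[ℝ] U) × (L →L[ℝ] L)) (ξ : U × L) : U × L := (g.1 ξ.1, g.2 ξ.2)

variable (L) in
/-- The elements `g` of `G₀` such that `ρ(g)` leaves the rational span of `ℬ` invariant. -/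
def rationalGroup {ι : Type*} (ℬ : Module.Basis ι ℝ U) : Set ((U →L[ℝ] U) × (L →L[ℝ] L)) :=
  {g | g ∈ groupAction L U ∧
    ∀ v ∈ ratSpan (Set.range ℬ), g.1 v ∈ ratSpan (Set.range ℬ)}

/-- `g_ℚ = Ad(G_{ℬ,ℚ})(h_ℚ)`. -/
def gQ {ι : Type*} (C : CompactChevalleyBasis h₀) (ℬ : Module.Basis ι ℝ U) : Set L :=
  {Z | ∃ g ∈ rationalGroup L ℬ, ∃ H ∈ C.hQ, Z = g.2 H}

variable (h₀ U) in
/-- `Z ∈ L` is super regular: some `Ad(g) Z` lies in `h₀` and is super regular. -/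
def IsSuperRegular (Z : L) : Prop :=
  ∃ g ∈ groupAction L U, IsSuperRegularIn h₀ U (g.2 Z)

/-- The set `𝔑_Z^* = {ξ ∈ 𝔑_Z | dI_g(ξ) ∈ 𝔑_{Ad(g) Z}^*}` attached to an element `g` with
`Ad(g) Z ∈ h_ℚ`. -/
def starSetAt (C : CompactChevalleyBasis h₀) (g : (U →L[ℝ] U) × (L →L[ℝ] L)) (Z : L) :
    Set (U × L) :=
  {ξ | ξ ∈ domainSet U Z ∧ dI g ξ ∈ starSet U C (g.2 Z)}

end Metric

end

end FirstHit

open FirstHit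

set_option linter.unusedSectionVars false

/-! Geodesics can be integrated explicitly. The left invariant metric has the conserved central
momentum `z' - [x, x'] / 2`, which stays equal to `Z`, so `x' = e^{t j(Z)} X` and `z` is a
quadrature. Write `X = X₀ + Z y` with `X₀` in `ker j(Z)` and `y = R X`, where `R` is the
pseudo-inverse of `j(Z)`. At a period all oscillating terms drop out
(`IsGeodesicFrom.apply_period`). The `U`-component of the endpoint is a multiple of `X₀`. The
central component, apart from a multiple of `Z`, is a multiple of a quadratic map of `X`, with
factors depending only on `α` (`firstHit_smul`).

Periods exist by sl₂ theory: each coroot has integral eigenvalues on `ℂ ⊗ U`, so `e^{2π j(iτ_α)} =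
1`, and rational combinations of these commuting elements have a common period. Since `j(Z)` is skew
and nonzero, there is a least one.

For the rank, variations of `X` in `ker j(Z)` already fill the `U`-part of the target, so it
suffices that variations in the image of `j(Z)` fill `L`. An element `Y` orthogonal to what they
reach satisfies `Z (Y X₀ - Y' X) = 0`, where `Y'` is the component of `Y` in the centralizer of `Z`;
`NondegenerateAt` says that this forces `Y = 0`.

For super regular `Z` in `h₀`, `ker j(Z)` is the zero weight space. Split `Y = H + S` into a Cartan
part and a root part, so that `Y' = H` and `H X₀ = 0`. Projecting the equation to `U_β` puts `H X_β`
in the span of `A_β X₀` and `B_β X₀`, a plane stable under `Z`. If `β(H) ≠ 0`, then `X_β` lies there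
too, which the star condition excludes. Hence all roots vanish on `H` and `H = 0`. Then `S X₀ = 0`,
and the independence of `A_β X₀` and `B_β X₀` gives `S = 0` (`nondegenerateAt_of_starAt`).

The star condition at one root is linear independence of three vectors, hence open. It is dense
because the root string through `β` supplies a zero weight vector not killed by `A_β`, and because
`dim_ℝ U_β ≥ 4 > 2`. There are only finitely many roots.

The second part is a conjugation: `dI_g` transports periods, kernel components and nondegeneracy.
Super regularity does not depend on the conjugate chosen in `h₀`, because it can be read off from
the spectrum of `j(Z)²` (`SuperRegularElement.of_groupAction`). -/

namespace FirstHit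

noncomputable section

/-! ### Linear differential equations and the operator exponential -/

section ExpODE

variable {E F : Type*} [NormedAddCommGroup E] [NormedSpace ℝ E] [CompleteSpace E]
  [NormedAddCommGroup F] [NormedSpace ℝ F] [CompleteSpace F]

theorem hasDerivAt_exp_smul_apply (A : E →L[ℝ] E) (x : E) (t : ℝ) :
    HasDerivAt (fun s : ℝ => NormedSpace.exp (s • A) x) (A (NormedSpace.exp (t • A) x)) t := by
  have h := (hasDerivAt_exp_smul_const' (𝕂 := ℝ) A t).clm_apply (hasDerivAt_const t x)
  simpa using h

theorem eq_of_hasDerivAt_zero {f : ℝ → E} (h : ∀ t, HasDerivAt f 0 t) (s t : ℝ) : f s = f t :=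
  is_const_of_deriv_eq_zero (𝕜 := ℝ) (fun t => (h t).differentiableAt) (fun t => (h t).deriv) s t

theorem exp_smul_mul_exp_neg_smul (A : E →L[ℝ] E) (t : ℝ) :
    NormedSpace.exp (t • A) * NormedSpace.exp ((-t) • A) = 1 := by
  let _ : NormedAlgebra ℚ (E →L[ℝ] E) := NormedAlgebra.restrictScalars ℚ ℝ _
  rw [← NormedSpace.exp_add_of_commute, ← add_smul, add_neg_cancel, zero_smul,
    NormedSpace.exp_zero]
  exact ((Commute.refl A).smul_left _).smul_right _

theorem exp_mul_exp_neg (A : E →L[ℝ] E) : NormedSpace.exp A * NormedSpace.exp (-A) = 1 := by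
  simpa using exp_smul_mul_exp_neg_smul A 1

theorem exp_neg_mul_exp (A : E →L[ℝ] E) : NormedSpace.exp (-A) * NormedSpace.exp A = 1 := by
  simpa using exp_mul_exp_neg (-A)

/-- The curve `e^{-tA} y(t)` has zero derivative. This uniqueness statement yields the later
identities for exponentials: exhibit a second solution with the same initial value. -/
theorem eq_exp_smul_apply {A : E →L[ℝ] E} {y : ℝ → E} (h : ∀ t, HasDerivAt y (A (y t)) t)
    (t : ℝ) : y t = NormedSpace.exp (t • A) (y 0) := by
  have hd : ∀ s : ℝ, HasDerivAt (fun s : ℝ => NormedSpace.exp ((-s) • A) (y s)) 0 s := by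
    intro s
    have h1 := (hasDerivAt_exp_smul_const (𝕂 := ℝ) A (-s)).scomp s (hasDerivAt_neg s)
    have h2 := h1.clm_apply (h s)
    refine h2.congr_deriv ?_
    simp
  have h0 := eq_of_hasDerivAt_zero hd t 0
  simp only [neg_zero, zero_smul, NormedSpace.exp_zero, one_apply_eq_self] at h0
  have h1 : NormedSpace.exp (t • A) (NormedSpace.exp ((-t) • A) (y t)) = _ :=
    congrArg (fun z => NormedSpace.exp (t • A) z) h0
  rwa [← mul_apply_eq_comp, exp_smul_mul_exp_neg_smul, one_apply_eq_self] at h1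

theorem map_exp_of_intertwine {A : E →L[ℝ] E} {B : F →L[ℝ] F} (T : E →L[ℝ] F)
    (h : ∀ x, T (A x) = B (T x)) (t : ℝ) (x : E) :
    T (NormedSpace.exp (t • A) x) = NormedSpace.exp (t • B) (T x) := by
  have := eq_exp_smul_apply (A := B) (y := fun s => T (NormedSpace.exp (s • A) x)) (fun s => by
    have h1 := (T.hasFDerivAt (x := NormedSpace.exp (s • A) x)).comp_hasDerivAt s
      (hasDerivAt_exp_smul_apply A x s)
    rw [← h]
    exact h1) t
  simpa using this

theorem exp_apply_of_apply_eq_zero {A : E →L[ℝ] E} {x : E} (h : A x = 0) (t : ℝ) :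
    NormedSpace.exp (t • A) x = x := by
  have := eq_exp_smul_apply (A := A) (y := fun _ => x)
    (fun s => by rw [h]; exact hasDerivAt_const s x) t
  exact this.symm

theorem exp_smul_apply_comm (A : E →L[ℝ] E) (x : E) (t : ℝ) :
    A (NormedSpace.exp (t • A) x) = NormedSpace.exp (t • A) (A x) :=
  map_exp_of_intertwine A (fun _ => rfl) t x

theorem exp_smul_apply_of_sq {A : E →L[ℝ] E} {x : E} {c : ℝ} (hc : c ≠ 0)
    (h : A (A x) = -(c ^ 2) • x) (t : ℝ) :
    NormedSpace.exp (t • A) x = Real.cos (c * t) • x + (Real.sin (c * t) / c) • A x := by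
  have := eq_exp_smul_apply (A := A)
    (y := fun t => Real.cos (c * t) • x + (Real.sin (c * t) / c) • A x) (fun s => by
      have hl : HasDerivAt (fun t : ℝ => c * t) c s := by
        simpa using (hasDerivAt_id s).const_mul c
      have h1 := (hl.cos.smul_const x).add ((hl.sin.div_const c).smul_const (A x))
      refine h1.congr_deriv ?_
      simp only [map_add, map_smul, h, smul_smul]
      rw [add_comm]
      congr 1
      · congr 1
        field_simp
      · congr 1
        field_simp) t
  simpa using this.symm

end ExpODE

/-! ### Skew symmetric endomorphisms -/

section Skew

variable {U : Type*} [NormedAddCommGroup U] [InnerProductSpace ℝ U] [FiniteDimensional ℝ U]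

/-- A skew symmetric endomorphism. -/
def IsSkew (A : U →L[ℝ] U) : Prop := ∀ x y : U, ⟪A x, y⟫_ℝ = -⟪x, A y⟫_ℝ

theorem IsSkew.inner_self {A : U →L[ℝ] U} (h : IsSkew A) (x : U) : ⟪A x, x⟫_ℝ = 0 := by
  have h1 := h x x
  rw [real_inner_comm] at h1
  have h2 := real_inner_comm x (A x)
  linarith

theorem IsSkew.inner_exp {A : U →L[ℝ] U} (h : IsSkew A) (t : ℝ) (x y : U) :
    ⟪NormedSpace.exp (t • A) x, NormedSpace.exp (t • A) y⟫_ℝ = ⟪x, y⟫_ℝ := by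
  have hd : ∀ s : ℝ, HasDerivAt
      (fun s : ℝ => ⟪NormedSpace.exp (s • A) x, NormedSpace.exp (s • A) y⟫_ℝ) 0 s := by
    intro s
    have h1 := (hasDerivAt_exp_smul_apply A x s).inner ℝ (hasDerivAt_exp_smul_apply A y s)
    refine h1.congr_deriv ?_
    rw [h]
    ring
  have := eq_of_hasDerivAt_zero hd t 0
  simpa using this

/-- Orthogonal projection to the kernel. -/
theorem IsSkew.starProjection_apply {A : U →L[ℝ] U} (h : IsSkew A) (x : U) :
    A.ker.starProjection (A x) = 0 := by
  rw [Submodule.starProjection_apply, Submodule.coe_eq_zero,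
    Submodule.orthogonalProjectionOnto_eq_zero_iff, Submodule.mem_orthogonal]
  intro u hu
  have hu' : A u = 0 := hu
  have := h u x
  rw [hu', inner_zero_left] at this
  linarith

theorem apply_starProjection_ker (A : U →L[ℝ] U) (x : U) : A (A.ker.starProjection x) = 0 :=
  LinearMap.mem_ker.1 (Submodule.starProjection_apply_mem _ x)

theorem starProjection_ker_eq_self {A : U →L[ℝ] U} {x : U} (h : A x = 0) :
    A.ker.starProjection x = x :=
  Submodule.starProjection_eq_self_iff.2 h

/-- A skew map commuting with an orthogonal projection, given invariance of the subspace. -/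
theorem IsSkew.starProjection_comm {T : U →L[ℝ] U} (h : IsSkew T) (K : Submodule ℝ U)
    (hK : ∀ x ∈ K, T x ∈ K) (x : U) : K.starProjection (T x) = T (K.starProjection x) := by
  refine Submodule.eq_starProjection_of_mem_of_inner_eq_zero
    (hK _ (Submodule.starProjection_apply_mem K x)) ?_
  intro w hw
  rw [← map_sub, h]
  have := Submodule.starProjection_inner_eq_zero (K := K) x (T w) (hK w hw)
  rw [this, neg_zero]

/-- The pseudo-inverse of a skew symmetric endomorphism. -/
theorem IsSkew.exists_pseudoInverse {J : U →L[ℝ] U} (hJ : IsSkew J) :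
    ∃ R : U →L[ℝ] U, IsSkew R ∧ (∀ x, R (J x) = x - J.ker.starProjection x) ∧
      (∀ x, J (R x) = x - J.ker.starProjection x) ∧ (∀ x, J.ker.starProjection (R x) = 0) ∧
      ∀ x, J x = 0 → R x = 0 := by
  set p : U →L[ℝ] U := J.ker.starProjection with hp
  have hpJ : ∀ x, p (J x) = 0 := hJ.starProjection_apply
  have hJp : ∀ x, J (p x) = 0 := apply_starProjection_ker J
  have hpp : ∀ x, p (p x) = p x := fun x => starProjection_ker_eq_self (hJp x)
  have hps : ∀ x y, ⟪p x, y⟫_ℝ = ⟪x, p y⟫_ℝ := fun x y =>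
    Submodule.inner_starProjection_left_eq_right _ x y
  -- The image of `J` is orthogonal to its kernel, so `J + p` is invertible. With `S` its inverse,
  -- the pseudo-inverse is `S - p`: it inverts `J` on the complement of the kernel and vanishes on
  -- the kernel.
  have hinj : Function.Injective (J + p : U →L[ℝ] U).toLinearMap := by
    rw [← LinearMap.ker_eq_bot, LinearMap.ker_eq_bot']
    intro x hx
    have hx : J x + p x = 0 := hx
    have h1 : p x = 0 := by
      have := congrArg p hx
      simpa [hpJ, hpp] using this
    have h2 : J x = 0 := by simpa [h1] using hx
    rw [← h1]
    exact (starProjection_ker_eq_self h2).symm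
  let e := LinearEquiv.ofInjectiveEndo _ hinj
  let S : U →L[ℝ] U := LinearMap.toContinuousLinearMap e.symm.toLinearMap
  have hS1 : ∀ x, S (J x + p x) = x := fun x => e.symm_apply_apply x
  have hS2 : ∀ x, J (S x) + p (S x) = x := fun x => e.apply_symm_apply x
  have hpS : ∀ x, p (S x) = p x := by
    intro x
    have := congrArg p (hS2 x)
    simpa [hpJ, hpp] using this
  have hSp : ∀ x, S (p x) = p x := by
    intro x
    have := hS1 (p x)
    simpa [hJp, hpp] using this
  have hJR : ∀ x, J (S x - p x) = x - p x := by
    intro x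
    rw [map_sub, hJp, sub_zero, ← hpS x]
    exact eq_sub_of_add_eq (hS2 x)
  refine ⟨S - p, ?_, ?_, ?_, ?_, ?_⟩
  · intro x y
    have e1 : ∀ x y, ⟪S x - p x, y⟫_ℝ = ⟪S x - p x, J (S y - p y)⟫_ℝ := by
      intro x y
      rw [hJR, inner_sub_right, ← hps]
      simp [hpS, hpp]
    calc ⟪(S - p) x, y⟫_ℝ = ⟪S x - p x, J (S y - p y)⟫_ℝ := e1 x y
      _ = - ⟪J (S x - p x), S y - p y⟫_ℝ := by rw [hJ]; ring
      _ = - ⟪S y - p y, J (S x - p x)⟫_ℝ := by rw [real_inner_comm]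
      _ = - ⟪S y - p y, x⟫_ℝ := by rw [e1 y x]
      _ = - ⟪x, (S - p) y⟫_ℝ := by rw [real_inner_comm]; rfl
  · intro x
    have := hS1 x
    rw [map_add, hSp] at this
    change S (J x) - p (J x) = x - p x
    rw [hpJ, sub_zero]
    exact eq_sub_of_add_eq this
  · exact hJR
  · intro x
    change p (S x - p x) = 0
    rw [map_sub, hpS, hpp, sub_self]
  · intro x hx
    change S x - p x = 0
    have h1 : p x = x := starProjection_ker_eq_self hx
    have := hSp x
    rw [h1] at this ⊢
    rw [this, sub_self]

end Skew

/-! ### Integration of the geodesic equation -/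

section Geodesics

variable {L : Type*} [InnerLieAlgebra L] [FiniteDimensional ℝ L]
variable {U : Type*} [NormedAddCommGroup U] [InnerProductSpace ℝ U] [FiniteDimensional ℝ U]
  [LieRingModule L U] [LieModule ℝ L U]

theorem j_apply (Z : L) (x : U) : j U Z x = ⁅Z, x⁆ := rfl

theorem j_add (Y Z : L) : j U (Y + Z) = j U Y + j U Z := by
  ext x; simp [j_apply]

theorem j_smul (c : ℝ) (Z : L) : j U (c • Z) = c • j U Z := by
  ext x; simp [j_apply]

variable (L U) in
/-- The bracket of the 2-step nilpotent Lie algebra as a continuous bilinear map. -/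
def nilBracketL : U →L[ℝ] U →L[ℝ] L :=
  LinearMap.toContinuousBilinearMap
    (LinearMap.mk₂ ℝ (nilBracket L)
      (fun X X' Y => ext_inner_right ℝ fun Z => by
        simp [inner_nilBracket, inner_add_left])
      (fun c X Y => ext_inner_right ℝ fun Z => by
        simp [inner_nilBracket, inner_smul_left])
      (fun X Y Y' => by simp [nilBracket])
      (fun c X Y => by simp [nilBracket]) : U →ₗ[ℝ] U →ₗ[ℝ] L)

theorem inner_nilBracketL (X Y : U) (Z : L) :
    ⟪nilBracketL L U X Y, Z⟫_ℝ = ⟪⁅Z, X⁆, Y⟫_ℝ := inner_nilBracket X Y Z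

/-- Left translation by `-n` is affine in the global chart, so its differential only subtracts half
the bracket with `n.1` from the central component. -/
theorem leftMetric_eq (n v w : U × L) : leftMetric n v w = ⟪v.1, w.1⟫_ℝ +
    ⟪v.2 - (1 / 2 : ℝ) • nilBracketL L U n.1 v.1, w.2 - (1 / 2 : ℝ) • nilBracketL L U n.1 w.1⟫_ℝ := by
  have hf : ∀ y : U × L, nilMul (-n) y =
      (-n.1 + y.1, -n.2 + y.2 + (1 / 2 : ℝ) • nilBracketL L U (-n.1) y.1) := fun y => rfl
  have hd : ∀ v : U × L, fderiv ℝ (nilMul (-n)) n v =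
      (v.1, v.2 - (1 / 2 : ℝ) • nilBracketL L U n.1 v.1) := by
    intro v
    have h1 : HasFDerivAt (nilMul (-n))
        ((ContinuousLinearMap.fst ℝ U L).prod (ContinuousLinearMap.snd ℝ U L +
          (1 / 2 : ℝ) • (nilBracketL L U (-n.1)).comp (ContinuousLinearMap.fst ℝ U L))) n := by
      have h2 := ((hasFDerivAt_fst (𝕜 := ℝ) (p := n)).const_add (-n.1)).prodMk
        (((hasFDerivAt_snd (𝕜 := ℝ) (p := n)).const_add (-n.2)).add
          ((((nilBracketL L U (-n.1)).hasFDerivAt (x := n.1)).comp n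
            (hasFDerivAt_fst (𝕜 := ℝ) (p := n))).const_smul (1 / 2 : ℝ)))
      exact h2
    rw [h1.fderiv]
    simp [sub_eq_add_neg]
  rw [leftMetric, hd, hd]
  rfl

/-- The momentum in the central direction. -/
def centralMomentum (γ : ℝ → U × L) (t : ℝ) : L :=
  (deriv γ t).2 - (1 / 2 : ℝ) • nilBracketL L U (γ t).1 (deriv γ t).1

theorem inner_nilBracketL_swap (hUinv : ∀ (Z : L) (x y : U), ⟪⁅Z, x⁆, y⟫_ℝ = -⟪x, ⁅Z, y⁆⟫_ℝ)
    (x y : U) (Z : L) : ⟪nilBracketL L U x y, Z⟫_ℝ = -⟪nilBracketL L U y x, Z⟫_ℝ := by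
  rw [inner_nilBracketL, inner_nilBracketL, hUinv, real_inner_comm]

theorem fderiv_leftMetric (n v w : U × L) :
    (1 / 2 : ℝ) * fderiv ℝ (fun n => leftMetric n v v) n w =
      -(1 / 2) * ⟪v.2 - (1 / 2 : ℝ) • nilBracketL L U n.1 v.1, nilBracketL L U w.1 v.1⟫_ℝ := by
  have h0 : (fun n : U × L => leftMetric n v v) = fun n => ⟪v.1, v.1⟫_ℝ +
    ⟪v.2 - (1 / 2 : ℝ) • nilBracketL L U n.1 v.1,
      v.2 - (1 / 2 : ℝ) • nilBracketL L U n.1 v.1⟫_ℝ := by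
    funext n; rw [leftMetric_eq]
  have h1 : HasFDerivAt (fun n : U × L => v.2 - (1 / 2 : ℝ) • nilBracketL L U n.1 v.1)
      (-((1 / 2 : ℝ) • ((nilBracketL L U).flip v.1).comp (ContinuousLinearMap.fst ℝ U L))) n :=
    (((((nilBracketL L U).flip v.1).hasFDerivAt (x := n.1)).comp n
      (hasFDerivAt_fst (𝕜 := ℝ) (p := n))).const_smul (1 / 2 : ℝ)).const_sub v.2
  have h2 := (h1.inner ℝ h1).const_add ⟪v.1, v.1⟫_ℝ
  rw [h0, h2.fderiv]
  simp only [ContinuousLinearMap.comp_apply, ContinuousLinearMap.prod_apply, fderivInnerCLM_apply,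
    neg_apply, smul_apply, ContinuousLinearMap.flip_apply,
    ContinuousLinearMap.coe_fst', inner_neg_left, inner_neg_right, inner_smul_left,
    inner_smul_right]
  rw [real_inner_comm (v.2 - (1 / 2 : ℝ) • nilBracketL L U n.1 v.1) (nilBracketL L U w.1 v.1)]
  simp
  ring

/-- Testing the Euler-Lagrange equation on central vectors gives conservation of the central
momentum. Once that is known, testing on vectors of `U` gives the equation for the `U`-velocity: the
explicit dependence of the metric on position and the derivative of the bracket term contribute half
of the force each. -/
theorem isGeodesic_iff (hUinv : ∀ (Z : L) (x y : U), ⟪⁅Z, x⁆, y⟫_ℝ = -⟪x, ⁅Z, y⁆⟫_ℝ)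
    {γ : ℝ → U × L} (hγ : ContDiff ℝ 2 γ) :
    IsGeodesic γ ↔ ∀ t, HasDerivAt (centralMomentum γ) 0 t ∧
      HasDerivAt (fun s => (deriv γ s).1) ⁅centralMomentum γ t, (deriv γ t).1⁆ t := by
  have hd1 : ∀ t, HasDerivAt γ (deriv γ t) t := fun t =>
    ((hγ.differentiable (by norm_num)) t).hasDerivAt
  have hd2 : ∀ t, HasDerivAt (deriv γ) (deriv (deriv γ) t) t := fun t =>
    (hγ.differentiable_deriv_two t).hasDerivAt
  have hx : ∀ t, HasDerivAt (fun s => (γ s).1) (deriv γ t).1 t := fun t =>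
    (hd1 t).fst
  have hx' : ∀ t, HasDerivAt (fun s => (deriv γ s).1) (deriv (deriv γ) t).1 t := fun t =>
    (hd2 t).fst
  have hz' : ∀ t, HasDerivAt (fun s => (deriv γ s).2) (deriv (deriv γ) t).2 t := fun t =>
    (hd2 t).snd
  have hb : ∀ t (w : U), HasDerivAt (fun s => nilBracketL L U (γ s).1 w)
      (nilBracketL L U (deriv γ t).1 w) t := fun t w =>
    ((nilBracketL L U).flip w).hasFDerivAt.comp_hasDerivAt t (hx t)
  obtain ⟨p', hp⟩ : ∃ p' : ℝ → L, ∀ t, HasDerivAt (centralMomentum γ) (p' t) t :=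
    ⟨_, fun t => (hz' t).sub (((nilBracketL L U).hasFDerivAt_of_bilinear
      (hx t).hasFDerivAt (hx' t).hasFDerivAt).hasDerivAt.const_smul (1 / 2 : ℝ))⟩
  have hE : ∀ (w : U × L) t, HasDerivAt (fun s => leftMetric (γ s) (deriv γ s) w)
      (⟪(deriv (deriv γ) t).1, w.1⟫_ℝ +
        (⟪centralMomentum γ t, -((1 / 2 : ℝ) • nilBracketL L U (deriv γ t).1 w.1)⟫_ℝ +
          ⟪p' t, w.2 - (1 / 2 : ℝ) • nilBracketL L U (γ t).1 w.1⟫_ℝ)) t := by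
    intro w t
    simp only [leftMetric_eq]
    have h1 := ((hx' t).inner ℝ (hasDerivAt_const t w.1)).add
      ((hp t).inner ℝ (((hb t w.1).const_smul (1 / 2 : ℝ)).const_sub w.2))
    refine h1.congr_deriv ?_
    simp
  have key : ∀ (w : U × L) t, (1 / 2 : ℝ) *
      fderiv ℝ (fun n => leftMetric n (deriv γ t) (deriv γ t)) (γ t) w =
      (1 / 2) * ⟪⁅centralMomentum γ t, (deriv γ t).1⁆, w.1⟫_ℝ := by
    intro w t
    rw [fderiv_leftMetric, real_inner_comm, inner_nilBracketL_swap hUinv, inner_nilBracketL]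
    change _ * -⟪⁅centralMomentum γ t, (deriv γ t).1⁆, w.1⟫_ℝ = _
    ring
  have key2 : ∀ (w : U) t, ⟪centralMomentum γ t, -((1 / 2 : ℝ) •
      nilBracketL L U (deriv γ t).1 w)⟫_ℝ =
      -(1 / 2) * ⟪⁅centralMomentum γ t, (deriv γ t).1⁆, w⟫_ℝ := by
    intro w t
    rw [inner_neg_right, inner_smul_right, real_inner_comm, inner_nilBracketL]
    ring
  constructor
  · rintro ⟨-, h⟩ t
    have h0 : ∀ w : U × L, _ := fun w => (hE w t).unique (h w t)
    have hp0 : p' t = 0 := by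
      refine ext_inner_right ℝ fun w => ?_
      have := h0 (0, w)
      rw [key] at this
      simpa using this
    have hx0 : (deriv (deriv γ) t).1 = ⁅centralMomentum γ t, (deriv γ t).1⁆ := by
      refine ext_inner_right ℝ fun w => ?_
      have := h0 (w, 0)
      rw [key, hp0] at this
      simp only [key2, inner_zero_left] at this
      linarith
    exact ⟨hp0 ▸ hp t, hx0 ▸ hx' t⟩
  · intro h
    refine ⟨hγ, fun w t => (hE w t).congr_deriv ?_⟩
    rw [key, key2, (hp t).unique (h t).1, (hx' t).unique (h t).2, inner_zero_left]
    ring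

/-- The momentum is constant and equals `ξ.2` at time zero, so the `U`-velocity solves a linear
equation with constant coefficients. -/
theorem IsGeodesicFrom.hasDerivAt
    (hUinv : ∀ (Z : L) (x y : U), ⟪⁅Z, x⁆, y⟫_ℝ = -⟪x, ⁅Z, y⁆⟫_ℝ)
    {ξ : U × L} {γ : ℝ → U × L} (hγ : IsGeodesicFrom ξ γ) (t : ℝ) :
    HasDerivAt (fun s => (γ s).1) (NormedSpace.exp (t • j U ξ.2) ξ.1) t ∧
      HasDerivAt (fun s => (γ s).2) (ξ.2 + (1 / 2 : ℝ) •
        nilBracketL L U (γ t).1 (NormedSpace.exp (t • j U ξ.2) ξ.1)) t := by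
  obtain ⟨hg, h0, h1⟩ := hγ
  have hd1 : ∀ t, HasDerivAt γ (deriv γ t) t := fun t =>
    ((hg.1.differentiable (by norm_num)) t).hasDerivAt
  have h2 := (isGeodesic_iff hUinv hg.1).1 hg
  have hm : ∀ t, centralMomentum γ t = ξ.2 := by
    intro t
    rw [eq_of_hasDerivAt_zero (fun t => (h2 t).1) t 0, centralMomentum, h0, h1]
    simp
  have hx : ∀ t, (deriv γ t).1 = NormedSpace.exp (t • j U ξ.2) ξ.1 := by
    intro t
    rw [eq_exp_smul_apply (A := j U ξ.2) (y := fun s => (deriv γ s).1)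
      (fun s => by have := (h2 s).2; rw [hm] at this; exact this) t, h1]
  refine ⟨?_, ?_⟩
  · rw [← hx]
    exact (hd1 t).fst
  · rw [← hx, ← hm t, centralMomentum, sub_add_cancel]
    exact (hd1 t).snd

theorem eq_of_hasDerivAt_eq {E : Type*} [NormedAddCommGroup E] [NormedSpace ℝ E] [CompleteSpace E]
    {f g f' : ℝ → E}
    (hf : ∀ t, HasDerivAt f (f' t) t) (hg : ∀ t, HasDerivAt g (f' t) t) (h0 : f 0 = g 0) :
    f = g := by
  funext t
  have := eq_of_hasDerivAt_zero (f := f - g) (fun t => by simpa using (hf t).sub (hg t)) t 0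
  simpa [h0, sub_eq_zero] using this

theorem IsGeodesicFrom.unique
    (hUinv : ∀ (Z : L) (x y : U), ⟪⁅Z, x⁆, y⟫_ℝ = -⟪x, ⁅Z, y⁆⟫_ℝ)
    {ξ : U × L} {γ γ' : ℝ → U × L} (h : IsGeodesicFrom ξ γ) (h' : IsGeodesicFrom ξ γ') :
    γ = γ' := by
  have h1 := eq_of_hasDerivAt_eq (fun t => (h.hasDerivAt hUinv t).1)
    (fun t => (h'.hasDerivAt hUinv t).1) (by rw [h.2.1, h'.2.1])
  have h2 := eq_of_hasDerivAt_eq (fun t => (h.hasDerivAt hUinv t).2)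
    (fun t => by
      have e := (h'.hasDerivAt hUinv t).2
      rw [← congrFun h1 t] at e
      exact e) (by rw [h.2.1, h'.2.1])
  funext t
  exact Prod.ext (congrFun h1 t) (congrFun h2 t)

theorem contDiff_succ_of_hasDerivAt {E : Type*} [NormedAddCommGroup E] [NormedSpace ℝ E]
    {f f' : ℝ → E} {n : ℕ} (h : ∀ t, HasDerivAt f (f' t) t) (h' : ContDiff ℝ n f') :
    ContDiff ℝ ((n + 1 : ℕ) : WithTop ℕ∞) f := by
  push_cast
  rw [contDiff_succ_iff_deriv]
  refine ⟨fun t => (h t).differentiableAt, by simp, ?_⟩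
  rwa [funext fun t => (h t).deriv]

theorem contDiff_exp_smul_apply {E : Type*} [NormedAddCommGroup E] [NormedSpace ℝ E]
    [CompleteSpace E] (A : E →L[ℝ] E) (x : E) (n : ℕ) :
    ContDiff ℝ n (fun t : ℝ => NormedSpace.exp (t • A) x) := by
  induction n with
  | zero =>
    exact contDiff_zero.2 (continuous_iff_continuousAt.2
      fun t => (hasDerivAt_exp_smul_apply A x t).continuousAt)
  | succ n ih =>
    exact contDiff_succ_of_hasDerivAt (hasDerivAt_exp_smul_apply A x) (A.contDiff.comp ih)

/-- The first order form of the equation is solved by two successive integrations, first for the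
`U`-component and then for the central one. -/
theorem exists_isGeodesicFrom
    (hUinv : ∀ (Z : L) (x y : U), ⟪⁅Z, x⁆, y⟫_ℝ = -⟪x, ⁅Z, y⁆⟫_ℝ) (ξ : U × L) :
    ∃ γ : ℝ → U × L, IsGeodesicFrom ξ γ := by
  set f : ℝ → U := fun t => NormedSpace.exp (t • j U ξ.2) ξ.1 with hf
  have hfc : ContDiff ℝ (1 : ℕ) f := contDiff_exp_smul_apply _ _ 1
  set x : ℝ → U := fun t => ∫ s in (0 : ℝ)..t, f s with hx
  have hxd : ∀ t, HasDerivAt x (f t) t := fun t =>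
    (hfc.continuous.integral_hasStrictDerivAt 0 t).hasDerivAt
  have hxc : ContDiff ℝ (2 : ℕ) x := contDiff_succ_of_hasDerivAt hxd hfc
  set g : ℝ → L := fun t => ξ.2 + (1 / 2 : ℝ) • nilBracketL L U (x t) (f t) with hg
  have hgc : ContDiff ℝ (1 : ℕ) g := by
    refine contDiff_const.add (ContDiff.const_smul _ ?_)
    exact ((nilBracketL L U).contDiff.comp (hxc.of_le (by norm_num))).clm_apply hfc
  set z : ℝ → L := fun t => ∫ s in (0 : ℝ)..t, g s with hz
  have hzd : ∀ t, HasDerivAt z (g t) t := fun t =>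
    (hgc.continuous.integral_hasStrictDerivAt 0 t).hasDerivAt
  have hzc : ContDiff ℝ (2 : ℕ) z := contDiff_succ_of_hasDerivAt hzd hgc
  have hd : deriv (fun t => (x t, z t)) = fun t => (f t, g t) :=
    funext fun t => ((hxd t).prodMk (hzd t)).deriv
  have hcd : ContDiff ℝ 2 (fun t => (x t, z t)) := hxc.prodMk hzc
  have hm : ∀ t, centralMomentum (fun t => (x t, z t)) t = ξ.2 := by
    intro t
    rw [centralMomentum, hd]
    simp [hg]
  refine ⟨fun t => (x t, z t), (isGeodesic_iff hUinv hcd).2 fun t => ⟨?_, ?_⟩, ?_, ?_⟩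
  · rw [funext hm]
    exact hasDerivAt_const t _
  · rw [hm, hd]
    exact hasDerivAt_exp_smul_apply _ _ t
  · simp [hx, hz]
  · rw [hd]
    simp [hf, hg, hx]

theorem existsUnique_isGeodesicFrom
    (hUinv : ∀ (Z : L) (x y : U), ⟪⁅Z, x⁆, y⟫_ℝ = -⟪x, ⁅Z, y⁆⟫_ℝ) (ξ : U × L) :
    ∃! γ : ℝ → U × L, IsGeodesicFrom ξ γ := by
  obtain ⟨γ, h⟩ := exists_isGeodesicFrom hUinv ξ
  exact ⟨γ, h, fun γ' h' => h'.unique hUinv h⟩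

theorem isGeodesicFrom_geodesic
    (hUinv : ∀ (Z : L) (x y : U), ⟪⁅Z, x⁆, y⟫_ℝ = -⟪x, ⁅Z, y⁆⟫_ℝ) (ξ : U × L) :
    IsGeodesicFrom ξ (geodesic ξ) :=
  Classical.epsilon_spec (exists_isGeodesicFrom hUinv ξ)

/-- The value of a geodesic at a period of `j Z`. -/
theorem IsGeodesicFrom.apply_period
    (hUinv : ∀ (Z : L) (x y : U), ⟪⁅Z, x⁆, y⟫_ℝ = -⟪x, ⁅Z, y⁆⟫_ℝ)
    {Z : L} {X₀ y y₂ : U} {γ : ℝ → U × L} (hγ : IsGeodesicFrom (X₀ + ⁅Z, y⁆, Z) γ)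
    (hX₀ : ⁅Z, X₀⁆ = 0) (hy : y = ⁅Z, y₂⁆)
    {ω : ℝ} (hω : NormedSpace.exp (ω • j U Z) = 1) :
    (γ ω).1 = ω • X₀ ∧ ∀ Y₀ W : L, ⁅Z, Y₀⁆ = 0 →
      ⟪(γ ω).2, Y₀ + ⁅Z, W⁆⟫_ℝ = ω * ⟪Z, Y₀ + ⁅Z, W⁆⟫_ℝ + ω * ⟪⁅Y₀ + ⁅Z, W⁆, X₀⁆, y⟫_ℝ +
        ω / 2 * ⟪⁅Y₀, y⁆, ⁅Z, y⁆⟫_ℝ := by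
  set u : ℝ → U := fun t => NormedSpace.exp (t • j U Z) y with hu
  set v : ℝ → U := fun t => NormedSpace.exp (t • j U Z) y₂ with hv
  have hud : ∀ t, HasDerivAt u ⁅Z, u t⁆ t := fun t => hasDerivAt_exp_smul_apply (j U Z) y t
  have hvd : ∀ t, HasDerivAt v (u t) t := fun t => by
    refine (hasDerivAt_exp_smul_apply (j U Z) y₂ t).congr_deriv ?_
    rw [exp_smul_apply_comm, j_apply, ← hy]
  have hjd : ∀ (Y : L) (f : ℝ → U) (f' : U) t, HasDerivAt f f' t →
      HasDerivAt (fun s => ⁅Y, f s⁆) ⁅Y, f'⁆ t := fun Y f f' t h =>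
    (j U Y).hasFDerivAt.comp_hasDerivAt t h
  have hx' : ∀ t, NormedSpace.exp (t • j U Z) (X₀ + ⁅Z, y⁆) = X₀ + ⁅Z, u t⁆ := by
    intro t
    rw [map_add, exp_apply_of_apply_eq_zero hX₀]
    congr 1
    exact (exp_smul_apply_comm (j U Z) y t).symm
  have hx : ∀ t, (γ t).1 = t • X₀ + (u t - y) := by
    intro t
    refine congrFun (eq_of_hasDerivAt_eq (g := fun t => t • X₀ + (u t - y))
      (fun t => (hγ.hasDerivAt hUinv t).1) (fun t => ?_) ?_) t
    · have := ((hasDerivAt_id t).smul_const X₀).add ((hud t).sub_const y)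
      refine this.congr_deriv ?_
      rw [one_smul, hx']
    · rw [hγ.2.1]
      simp [hu]
  -- `u` and its primitive `v` both have period `ω`. The existence of a periodic primitive of `u` is
  -- what the assumption `y = Z y₂` is for.
  have huω : u ω = y := by simp [hu, hω]
  have hvω : v ω = v 0 := by simp [hv, hω]
  have hu0 : u 0 = y := by simp [hu]
  refine ⟨by rw [hx, huω, sub_self, add_zero], fun Y₀ W hY₀ => ?_⟩
  set Y := Y₀ + ⁅Z, W⁆ with hY
  have hcomm : ∀ x : U, ⁅Y₀, ⁅Z, x⁆⁆ = ⁅Z, ⁅Y₀, x⁆⁆ := by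
    intro x
    rw [leibniz_lie Z, hY₀, zero_lie, zero_add]
  have hself : ∀ (A : L) (x : U), ⟪⁅A, x⁆, x⟫_ℝ = 0 := fun A x =>
    IsSkew.inner_self (A := j U A) (hUinv A) x
  -- As `Y₀` commutes with `Z`, this quadratic expression does not change along the flow of `j(Z)`.
  -- It is the quadratic term that survives integration over a period.
  have hconst : ∀ t, ⟪⁅Y₀, u t⁆, ⁅Z, u t⁆⟫_ℝ = ⟪⁅Y₀, y⁆, ⁅Z, y⁆⟫_ℝ := by
    intro t
    rw [← hu0]
    refine eq_of_hasDerivAt_zero (f := fun t => ⟪⁅Y₀, u t⁆, ⁅Z, u t⁆⟫_ℝ) (fun t => ?_) t 0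
    refine ((hjd Y₀ _ _ t (hud t)).inner ℝ (hjd Z _ _ t (hud t))).congr_deriv ?_
    rw [hself, add_zero, real_inner_comm, hUinv, ← hcomm, real_inner_comm, hself, neg_zero]
  -- An explicit primitive of `⟪z', Y⟫`, found by expanding `⟪Y x, x'⟫` with `x = t X₀ + u - y` and
  -- `x' = X₀ + Z u`. The term linear in `t` is integrated by parts, which together with `⟪Y u, X₀⟫`
  -- produces the coefficient 2 of `v`.
  have hd : ∀ t, HasDerivAt (fun t => ⟪(γ t).2, Y⟫_ℝ - (t * ⟪Z, Y⟫_ℝ + (1 / 2 : ℝ) *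
      (t * ⟪⁅Y, X₀⁆, u t⟫_ℝ - 2 * ⟪⁅Y, X₀⁆, v t⟫_ℝ + t * ⟪⁅Y, X₀⁆, y⟫_ℝ - ⟪⁅Y, y⁆, u t⟫_ℝ
        + t * ⟪⁅Y₀, y⁆, ⁅Z, y⁆⟫_ℝ - ⟪⁅W, u t⁆, ⁅Z, u t⁆⟫_ℝ))) 0 t := by
    intro t
    have hi := fun (c : U) (f : ℝ → U) (f' : U) (h : HasDerivAt f f' t) =>
      (hasDerivAt_const t c).inner ℝ h
    have h1 := ((hγ.hasDerivAt hUinv t).2.inner ℝ (hasDerivAt_const t Y)).sub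
      (((hasDerivAt_id t).mul_const ⟪Z, Y⟫_ℝ).add (((((((hasDerivAt_id t).mul
        (hi ⁅Y, X₀⁆ u _ (hud t))).sub ((hi ⁅Y, X₀⁆ v _ (hvd t)).const_mul 2)).add
        ((hasDerivAt_id t).mul_const ⟪⁅Y, X₀⁆, y⟫_ℝ)).sub (hi ⁅Y, y⁆ u _ (hud t))).add
        ((hasDerivAt_id t).mul_const ⟪⁅Y₀, y⁆, ⁅Z, y⁆⟫_ℝ)).sub
        ((hjd W _ _ t (hud t)).inner ℝ (hjd Z _ _ t (hud t)))|>.const_mul (1 / 2 : ℝ)))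
    refine h1.congr_deriv ?_
    rw [hx', hx]
    simp only [inner_zero_right, zero_add, add_zero, inner_add_left, inner_smul_left,
      inner_nilBracketL, lie_add, lie_sub, lie_smul, inner_add_right, inner_sub_left, id, one_mul,
      inner_zero_left, conj_trivial, hself, mul_zero]
    have e1 : ⟪⁅Y, u t⁆, X₀⟫_ℝ = -⟪⁅Y, X₀⁆, u t⟫_ℝ := by rw [hUinv, real_inner_comm]
    have e2 : ⟪⁅Y, y⁆, X₀⟫_ℝ = -⟪⁅Y, X₀⁆, y⟫_ℝ := by rw [hUinv, real_inner_comm]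
    -- The part `[Z, W]` of `Y` contributes only the derivative of the periodic function `-⟪W u, Z
    -- u⟫`.
    have e3 : ⟪⁅Y, u t⁆, ⁅Z, u t⁆⟫_ℝ = ⟪⁅Y₀, y⁆, ⁅Z, y⁆⟫_ℝ - ⟪⁅W, u t⁆, ⁅Z, ⁅Z, u t⁆⁆⟫_ℝ := by
      rw [hY, add_lie, inner_add_left, hconst, lie_lie, inner_sub_left, hself, hUinv Z]
      ring
    rw [e1, e2, e3]
    ring
  have h0 := eq_of_hasDerivAt_zero hd ω 0
  simp only [huω, hvω, hu0, hγ.2.1, Prod.snd_zero, inner_zero_left] at h0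
  linarith

end Geodesics

/-! ### The definite Killing form -/

section Killing

variable {L : Type*} [LieRing L] [LieAlgebra ℝ L]

theorem killingForm_lie_left (X Y Z : L) :
    killingForm ℝ L ⁅Z, X⁆ Y = -killingForm ℝ L X ⁅Z, Y⁆ := by
  have h : killingForm ℝ L ⁅X, Z⁆ Y = killingForm ℝ L X ⁅Z, Y⁆ :=
    LieModule.traceForm_apply_lie_apply ℝ L L X Z Y
  rw [← lie_skew, map_neg, LinearMap.neg_apply, h]

theorem IsCompactSemisimple.eq_zero (hL : IsCompactSemisimple L) {x : L}
    (h : killingForm ℝ L x x = 0) : x = 0 := by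
  by_contra hx
  exact (hL x hx).ne h

theorem IsCompactSemisimple.eq_zero_of_lie_lie (hL : IsCompactSemisimple L) {Z W : L}
    (h : ⁅Z, ⁅Z, W⁆⁆ = 0) : ⁅Z, W⁆ = 0 := by
  refine hL.eq_zero ?_
  rw [killingForm_lie_left, h, map_zero, neg_zero]

/-- The projection onto the centralizer of `Z` along the image of `ad Z`. -/
theorem IsCompactSemisimple.exists_projection [FiniteDimensional ℝ L]
    (hL : IsCompactSemisimple L) (Z : L) :
    ∃ P : L →ₗ[ℝ] L, ∀ Y, ⁅Z, P Y⁆ = 0 ∧ ∃ W, Y = P Y + ⁅Z, W⁆ := by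
  set f : L →ₗ[ℝ] L := (LieAlgebra.ad ℝ L Z : L →ₗ[ℝ] L) with hf
  -- `ad Z` is skew for the definite Killing form, so its kernel and image meet trivially. They are
  -- then complementary by dimension.
  have hd : Disjoint f.ker f.range := by
    rw [Submodule.disjoint_def]
    rintro x hx ⟨w, rfl⟩
    exact hL.eq_zero_of_lie_lie hx
  have hc : IsCompl f.ker f.range := by
    refine ⟨hd, codisjoint_iff.2 (Submodule.eq_top_of_disjoint _ _ ?_ hd)⟩
    rw [add_comm, f.finrank_range_add_finrank_ker]
  refine ⟨f.ker.projection f.range hc, fun Y => ⟨?_, ?_⟩⟩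
  · exact Submodule.projection_apply_mem hc Y
  · obtain ⟨W, hW⟩ := Submodule.sub_projection_mem hc Y
    refine ⟨W, ?_⟩
    have hW : ⁅Z, W⁆ = Y - f.ker.projection f.range hc Y := hW
    rw [hW, add_sub_cancel]

end Killing

/-! ### The first hit map and its differential -/

section FirstHitMap

variable {L : Type*} [InnerLieAlgebra L] [FiniteDimensional ℝ L]
variable {U : Type*} [NormedAddCommGroup U] [InnerProductSpace ℝ U] [FiniteDimensional ℝ U]
  [LieRingModule L U] [LieModule ℝ L U]

theorem exp_neg_eq_one_iff {A : U →L[ℝ] U} : NormedSpace.exp (-A) = 1 ↔ NormedSpace.exp A = 1 := by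
  have h1 := exp_mul_exp_neg A
  have h2 := exp_neg_mul_exp A
  constructor <;> intro h
  · rwa [h, mul_one] at h1
  · rwa [h, mul_one] at h2

/-- The sign of `α` is immaterial, because `e^{-A}` and `e^A` are inverse to each other. -/
theorem mem_periods_smul {Z : L} {α : ℝ} (hα : α ≠ 0) (ω : ℝ) :
    ω ∈ periods U (α • Z) ↔ |α| * ω ∈ periods U Z := by
  have hp : 0 < |α| := abs_pos.2 hα
  simp only [periods, Set.mem_ofPred_eq, mul_pos_iff_of_pos_left hp, j_smul, smul_smul]
  rcases abs_choice α with h | h <;> rw [h]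
  · rw [mul_comm]
  · rw [neg_mul, neg_smul, exp_neg_eq_one_iff, mul_comm]

theorem isLeast_periods_smul {Z : L} {α : ℝ} (hα : α ≠ 0) {ω : ℝ}
    (h : IsLeast (periods U Z) ω) : IsLeast (periods U (α • Z)) (ω / |α|) := by
  have hp : 0 < |α| := abs_pos.2 hα
  constructor
  · rw [mem_periods_smul hα, mul_div_cancel₀ _ hp.ne']
    exact h.1
  · intro x hx
    rw [mem_periods_smul hα] at hx
    rw [div_le_iff₀' hp]
    exact h.2 hx

/-- Condition under which the first hit map has maximal rank at `X + α Z`. -/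
def NondegenerateAt (Z : L) (X : U) : Prop :=
  ∀ Y Y' W : L, ⁅Z, Y'⁆ = 0 → Y = Y' + ⁅Z, W⁆ →
    ⁅Z, ⁅Y, kerComponent Z X⁆ - ⁅Y', X⁆⁆ = 0 → Y = 0

theorem lie_kerComponent (Z : L) (X : U) : ⁅Z, kerComponent Z X⁆ = 0 :=
  apply_starProjection_ker (j U Z) X

/-- The first hit map in terms of the pseudo-inverse `R` of `j Z`. -/
theorem firstHit_smul
    (hUinv : ∀ (Z : L) (x y : U), ⟪⁅Z, x⁆, y⟫_ℝ = -⟪x, ⁅Z, y⁆⟫_ℝ) {Z : L} {ω : ℝ}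
    (hω : IsLeast (periods U Z) ω) {R : U →L[ℝ] U}
    (hR : ∀ x, ⁅Z, R x⁆ = x - kerComponent Z x) (hR0 : ∀ x, kerComponent Z (R x) = 0)
    {α : ℝ} (hα : α ≠ 0) (X : U) :
    (firstHit (X, α • Z)).1 = (ω / |α|) • kerComponent Z X ∧
    ∀ Y Y' W : L, ⁅Z, Y'⁆ = 0 → Y = Y' + ⁅Z, W⁆ →
      ⟪(firstHit (X, α • Z)).2, Y⟫_ℝ = ω / |α| * α * ⟪Z, Y⟫_ℝ +
        ω / (|α| * α) * (⟪⁅Y, kerComponent Z X⁆, R X⟫_ℝ + 1 / 2 * ⟪⁅Y', R X⁆, ⁅Z, R X⁆⟫_ℝ) := by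
  have hl := isLeast_periods_smul hα hω
  have e : X = kerComponent Z X + ⁅α • Z, α⁻¹ • R X⁆ := by
    rw [smul_lie, lie_smul, smul_smul, mul_inv_cancel₀ hα, one_smul, hR, add_sub_cancel]
  have hg : IsGeodesicFrom (kerComponent Z X + ⁅α • Z, α⁻¹ • R X⁆, α • Z)
      (geodesic (X, α • Z)) := by
    rw [← e]
    exact isGeodesicFrom_geodesic hUinv _
  -- `R X` has no component in `ker j(Z)`, so it is again in the image of `j(Z)`, as `apply_period`
  -- requires.
  have h2 : α⁻¹ • R X = ⁅α • Z, (α⁻¹ * α⁻¹) • R (R X)⁆ := by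
    rw [smul_lie, lie_smul, smul_smul, hR, hR0, sub_zero]
    congr 1
    field_simp
  have h := hg.apply_period hUinv (by rw [smul_lie, lie_kerComponent, smul_zero]) h2
    (ω := ω / |α|) hl.1.2
  rw [firstHit, hl.csInf_eq]
  refine ⟨h.1, fun Y Y' W hY' hY => ?_⟩
  -- The splitting of `Y` relative to `Z`, rescaled to one relative to `α Z`.
  have h3 := h.2 Y' (α⁻¹ • W) (by rw [smul_lie, hY', smul_zero])
  have h4 : Y = Y' + ⁅α • Z, α⁻¹ • W⁆ := by
    rw [smul_lie, lie_smul, smul_smul, mul_inv_cancel₀ hα, one_smul, hY]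
  rw [← h4] at h3
  rw [h3]
  simp only [lie_smul, smul_lie, inner_smul_left, inner_smul_right, conj_trivial]
  have : |α| ≠ 0 := abs_ne_zero.2 hα
  field_simp
  ring

theorem exists_pseudoInverse_lie
    (hUinv : ∀ (Z : L) (x y : U), ⟪⁅Z, x⁆, y⟫_ℝ = -⟪x, ⁅Z, y⁆⟫_ℝ) (Z : L) :
    ∃ R : U →L[ℝ] U, (∀ x, ⁅Z, R x⁆ = x - kerComponent Z x) ∧
      (∀ x, R ⁅Z, x⁆ = x - kerComponent Z x) ∧ ∀ x, kerComponent Z (R x) = 0 := by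
  obtain ⟨R, -, h1, h2, h3, -⟩ := IsSkew.exists_pseudoInverse (J := j U Z) (hUinv Z)
  exact ⟨R, h2, h1, h3⟩

theorem firstHitWellDefined
    (hUinv : ∀ (Z : L) (x y : U), ⟪⁅Z, x⁆, y⟫_ℝ = -⟪x, ⁅Z, y⁆⟫_ℝ) {Z : L} {ω : ℝ}
    (hω : IsLeast (periods U Z) ω) : FirstHitWellDefined U Z := by
  rintro ⟨X, Y⟩ ⟨-, α, hα, rfl : Y = α • Z⟩
  obtain ⟨R, hR, -, hR0⟩ := exists_pseudoInverse_lie hUinv Z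
  refine ⟨existsUnique_isGeodesicFrom hUinv _, ⟨_, isLeast_periods_smul hα hω⟩, ?_, trivial⟩
  rw [(firstHit_smul hUinv hω hR hR0 hα X).1]
  exact Submodule.smul_mem _ _ (lie_kerComponent Z X)

theorem inner_sub_kerComponent (Z : L) (x w : U) :
    ⟪x - kerComponent Z x, w⟫_ℝ = ⟪x, w - kerComponent Z w⟫_ℝ := by
  rw [inner_sub_left, inner_sub_right]
  congr 1
  exact Submodule.inner_starProjection_left_eq_right _ x w

theorem kerComponent_eq_self {Z : L} {x : U} (h : ⁅Z, x⁆ = 0) : kerComponent Z x = x :=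
  starProjection_ker_eq_self (A := j U Z) h

theorem kerComponent_lie (hUinv : ∀ (Z : L) (x y : U), ⟪⁅Z, x⁆, y⟫_ℝ = -⟪x, ⁅Z, y⁆⟫_ℝ) (Z : L)
    (x : U) : kerComponent Z ⁅Z, x⁆ = 0 :=
  IsSkew.starProjection_apply (A := j U Z) (hUinv Z) x

theorem lie_eq_zero_of_inner_sub_kerComponent {Z : L} {v : U}
    (h : ∀ x : U, ⟪x - kerComponent Z x, v⟫_ℝ = 0) : ⁅Z, v⁆ = 0 := by
  have h1 : ⟪v - kerComponent Z v, kerComponent Z v⟫_ℝ = 0 := by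
    rw [inner_sub_kerComponent, kerComponent_eq_self (lie_kerComponent Z v), sub_self,
      inner_zero_right]
  have h2 : v - kerComponent Z v = 0 := by
    refine inner_self_eq_zero (𝕜 := ℝ).1 ?_
    rw [inner_sub_right, h, h1, sub_zero]
  rw [sub_eq_zero.1 h2]
  exact lie_kerComponent Z v

/-- The quadratic part of the central component of the first hit map. -/
def hitQuad (Z : L) (R : U →L[ℝ] U) (P' : L →L[ℝ] L) (X : U) : L :=
  nilBracketL L U (kerComponent Z X) (R X) +
    (1 / 2 : ℝ) • P' (nilBracketL L U (R X) ⁅Z, R X⁆)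

/-- The derivative of `hitQuad`. -/
def hitQuadDeriv (Z : L) (R : U →L[ℝ] U) (P' : L →L[ℝ] L) (X : U) : U →L[ℝ] L :=
  ((nilBracketL L U (kerComponent Z X)).comp R +
    ((nilBracketL L U).flip (R X)).comp (j U Z).ker.starProjection) +
    (1 / 2 : ℝ) • P'.comp ((nilBracketL L U (R X)).comp ((j U Z).comp R) +
      ((nilBracketL L U).flip ⁅Z, R X⁆).comp R)

theorem hitQuadDeriv_apply (Z : L) (R : U →L[ℝ] U) (P' : L →L[ℝ] L) (X H : U) :
    hitQuadDeriv Z R P' X H = nilBracketL L U (kerComponent Z X) (R H) +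
      nilBracketL L U (kerComponent Z H) (R X) + (1 / 2 : ℝ) •
        P' (nilBracketL L U (R X) ⁅Z, R H⁆ + nilBracketL L U (R H) ⁅Z, R X⁆) := rfl

theorem hasFDerivAt_hitQuad (Z : L) (R : U →L[ℝ] U) (P' : L →L[ℝ] L) (X : U) :
    HasFDerivAt (hitQuad Z R P') (hitQuadDeriv Z R P' X) X := by
  have h1 := (nilBracketL L U).hasFDerivAt_of_bilinear
    ((j U Z).ker.starProjection.hasFDerivAt (x := X)) (R.hasFDerivAt (x := X))
  have h2 := (nilBracketL L U).hasFDerivAt_of_bilinear (R.hasFDerivAt (x := X))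
    (((j U Z).comp R).hasFDerivAt (x := X))
  exact h1.add ((P'.hasFDerivAt.comp X h2).const_smul (1 / 2 : ℝ))

/-- By duality: pairing the differential in the direction `Z x` with `Y` gives `⟪Y X₀ - P Y X, h⟫`,
where `h` is the component of `x` orthogonal to `ker j(Z)`. If this vanishes for every `x`, then `Y
X₀ - P Y X` lies in `ker j(Z)`, and nondegeneracy gives `Y = 0`. -/
theorem exists_hitQuadDeriv_eq
    (hUinv : ∀ (Z : L) (x y : U), ⟪⁅Z, x⁆, y⟫_ℝ = -⟪x, ⁅Z, y⁆⟫_ℝ) {Z : L} {R : U →L[ℝ] U}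
    (hR : ∀ x, ⁅Z, R x⁆ = x - kerComponent Z x) (hR' : ∀ x, R ⁅Z, x⁆ = x - kerComponent Z x)
    {P : L →ₗ[ℝ] L} (hP : ∀ Y, ⁅Z, P Y⁆ = 0 ∧ ∃ W, Y = P Y + ⁅Z, W⁆) {P' : L →L[ℝ] L}
    (hP' : ∀ x Y, ⟪P' x, Y⟫_ℝ = ⟪x, P Y⟫_ℝ) {X : U} (hN : NondegenerateAt Z X) (y : L) :
    ∃ x : U, hitQuadDeriv Z R P' X ⁅Z, x⁆ = y := by
  have hs : Function.Surjective ((hitQuadDeriv Z R P' X).toLinearMap ∘ₗ (j U Z).toLinearMap) := by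
    rw [← LinearMap.range_eq_top, ← Submodule.orthogonal_eq_bot_iff, Submodule.eq_bot_iff]
    intro Y hY
    obtain ⟨V, hV⟩ := (hP Y).2
    refine hN Y (P Y) V (hP Y).1 hV (lie_eq_zero_of_inner_sub_kerComponent fun x => ?_)
    have hcomm : ∀ x : U, ⁅P Y, ⁅Z, x⁆⁆ = ⁅Z, ⁅P Y, x⁆⁆ := by
      intro x
      rw [leibniz_lie Z, (hP Y).1, zero_lie, zero_add]
    have h1 : ⟪hitQuadDeriv Z R P' X ⁅Z, x⁆, Y⟫_ℝ = 0 :=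
      (Submodule.mem_orthogonal _ _).1 hY _ ⟨x, rfl⟩
    rw [hitQuadDeriv_apply, kerComponent_lie hUinv, hR'] at h1
    set h := x - kerComponent Z x with hh
    simp only [map_zero, zero_apply, add_zero, inner_add_left,
      inner_smul_left, map_add, hP', inner_nilBracketL, conj_trivial] at h1
    -- `P Y` commutes with `Z`, so it preserves `ker j(Z)` and `P Y X₀` is orthogonal to `h`. The
    -- two terms under the factor `1/2` turn out to be equal.
    have e1 : ⟪⁅P Y, R X⁆, ⁅Z, h⁆⟫_ℝ = -⟪h, ⁅P Y, X⁆⟫_ℝ := by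
      have e2 : ⁅P Y, X⁆ = ⁅P Y, kerComponent Z X⁆ + ⁅Z, ⁅P Y, R X⁆⁆ := by
        rw [← hcomm, hR, lie_sub, add_sub_cancel]
      have e3 : ⟪h, ⁅P Y, kerComponent Z X⁆⟫_ℝ = 0 := by
        have : kerComponent Z ⁅P Y, kerComponent Z X⁆ = ⁅P Y, kerComponent Z X⁆ :=
          kerComponent_eq_self (by rw [← hcomm, lie_kerComponent, lie_zero])
        rw [hh, inner_sub_kerComponent, this, sub_self, inner_zero_right]
      rw [e2, inner_add_right, e3, zero_add, real_inner_comm, hUinv]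
    have e4 : ⟪⁅P Y, h⁆, ⁅Z, R X⁆⟫_ℝ = -⟪h, ⁅P Y, X⁆⟫_ℝ := by
      rw [← e1, hUinv, hcomm, real_inner_comm, hUinv, neg_neg]
    rw [e1, e4] at h1
    rw [inner_sub_right, real_inner_comm]
    linarith
  exact hs y

/-- Along directions in the kernel of `a` the scalar factors are frozen, so the differential there
is just a combination of `A` and `B ∘ Q'`. These directions are assumed to suffice, and the
derivative with respect to `a` need never be computed. -/
theorem exists_surjective_hasFDerivAt {V W' : Type*} [NormedAddCommGroup V] [NormedSpace ℝ V]
    [NormedAddCommGroup W'] [NormedSpace ℝ W'] (a : V →L[ℝ] ℝ) (b : V →L[ℝ] U) (A : U →L[ℝ] W')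
    (B : L →L[ℝ] W') {Q : U → L} {Q' : U →L[ℝ] L} {ξ : V} (hQ : HasFDerivAt Q Q' (b ξ)) (k : ℝ)
    (w : W') (ha : a ξ ≠ 0) (hb : ∀ H, ∃ h, a h = 0 ∧ b h = H)
    (hs : ∀ y, ∃ H, (k * (a ξ)⁻¹) • A H + (k * ((a ξ)⁻¹ * (a ξ)⁻¹)) • B (Q' H) = y) :
    ∃ F' : V →L[ℝ] W', HasFDerivAt (fun η : V => (k * (a η)⁻¹) • A (b η) +
      (w + (k * ((a η)⁻¹ * (a η)⁻¹)) • B (Q (b η)))) F' ξ ∧ Function.Surjective F' := by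
  set G : V → W' := fun η : V => (k * (a η)⁻¹) • A (b η) +
      (w + (k * ((a η)⁻¹ * (a η)⁻¹)) • B (Q (b η))) with hG
  have hd : DifferentiableAt ℝ (fun η : V => (a η)⁻¹) ξ := (a.differentiableAt).inv ha
  have hGd : DifferentiableAt ℝ G ξ := by
    have hq : DifferentiableAt ℝ (fun η : V => B (Q (b η))) ξ :=
      B.differentiableAt.comp ξ (hQ.differentiableAt.comp ξ b.differentiableAt)
    exact ((hd.const_mul _).smul ((A.comp b).differentiableAt)).add
      (((hd.mul hd).const_mul _).smul hq |>.const_add _)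
  refine ⟨fderiv ℝ G ξ, hGd.hasFDerivAt, fun y => ?_⟩
  obtain ⟨H, hH⟩ := hs y
  obtain ⟨h, hah, hbh⟩ := hb H
  refine ⟨h, ?_⟩
  rw [← hH]
  have hline : HasDerivAt (fun t : ℝ => ξ + t • h) h 0 := by
    simpa using ((hasDerivAt_id (0 : ℝ)).smul_const h).const_add ξ
  have hG0 : HasFDerivAt G (fderiv ℝ G ξ) (ξ + (0 : ℝ) • h) := by
    simpa using hGd.hasFDerivAt
  have h1 : HasDerivAt (fun t : ℝ => G (ξ + t • h)) (fderiv ℝ G ξ h) 0 :=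
    HasFDerivAt.comp_hasDerivAt (f := fun t : ℝ => ξ + t • h) (0 : ℝ) hG0 hline
  have hfun : (fun t : ℝ => G (ξ + t • h)) = fun t : ℝ => (k * (a ξ)⁻¹) • A (b ξ + t • H) +
      (w + (k * ((a ξ)⁻¹ * (a ξ)⁻¹)) • B (Q (b ξ + t • H))) := by
    funext t
    have e1 : a (ξ + t • h) = a ξ := by rw [map_add, map_smul, hah, smul_zero, add_zero]
    have e2 : b (ξ + t • h) = b ξ + t • H := by rw [map_add, map_smul, hbh]
    simp only [hG, e1, e2]
  have hlineU : HasDerivAt (fun t : ℝ => b ξ + t • H) H 0 := by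
    simpa using ((hasDerivAt_id (0 : ℝ)).smul_const H).const_add (b ξ)
  have hQ0 : HasFDerivAt Q Q' (b ξ + (0 : ℝ) • H) := by simpa using hQ
  rw [hfun] at h1
  exact h1.unique (((A.hasFDerivAt.comp_hasDerivAt (0 : ℝ) hlineU).const_smul _).add
    (((B.hasFDerivAt.comp_hasDerivAt (0 : ℝ)
      (hQ0.comp_hasDerivAt (0 : ℝ) hlineU)).const_smul _).const_add _))

theorem firstHit_hasMaximalRankAt (hL : IsCompactSemisimple L)
    (hUinv : ∀ (Z : L) (x y : U), ⟪⁅Z, x⁆, y⟫_ℝ = -⟪x, ⁅Z, y⁆⟫_ℝ) {Z : L} (hZ : Z ≠ 0) {ω : ℝ}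
    (hω : IsLeast (periods U Z) ω) (ξ : domainSpace U Z) (hξ : (ξ : U × L).2 ≠ 0)
    (hN : NondegenerateAt Z (ξ : U × L).1) :
    HasMaximalRankAt (domainSpace U Z) (targetSpace U Z) firstHit ξ := by
  obtain ⟨R, hR, hR', hR0⟩ := exists_pseudoInverse_lie hUinv Z
  obtain ⟨P, hP⟩ := hL.exists_projection Z
  obtain ⟨P', hP'⟩ : ∃ P' : L →L[ℝ] L, ∀ x Y, ⟪P' x, Y⟫_ℝ = ⟪x, P Y⟫_ℝ :=
    ⟨LinearMap.toContinuousLinearMap (LinearMap.adjoint P),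
      fun x Y => LinearMap.adjoint_inner_left _ _ _⟩
  have hZZ : ⟪Z, Z⟫_ℝ ≠ 0 := inner_self_ne_zero.2 hZ
  have hω0 : ω ≠ 0 := hω.1.1.ne'
  obtain ⟨a, ha⟩ : ∃ a : domainSpace U Z →L[ℝ] ℝ, ∀ η : domainSpace U Z,
      (η : U × L).2 = a η • Z := by
    refine ⟨(⟪Z, Z⟫_ℝ)⁻¹ • ((innerSL ℝ Z).comp
      ((ContinuousLinearMap.snd ℝ U L).comp (domainSpace U Z).subtypeL)), fun η => ?_⟩
    obtain ⟨c, hc⟩ := Submodule.mem_span_singleton.1 (Submodule.mem_prod.1 η.2).2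
    have : (⟪Z, Z⟫_ℝ)⁻¹ * ⟪Z, (η : U × L).2⟫_ℝ = c := by
      rw [← hc, inner_smul_right]
      field_simp
    rw [← hc]
    congr 1
    exact this.symm
  obtain ⟨b, hb⟩ : ∃ b : domainSpace U Z →L[ℝ] U, ∀ η : domainSpace U Z,
      (η : U × L).1 = b η :=
    ⟨(ContinuousLinearMap.fst ℝ U L).comp (domainSpace U Z).subtypeL, fun η => rfl⟩
  have haξ : a ξ ≠ 0 := by
    intro h
    rw [ha, h, zero_smul] at hξ
    exact hξ rfl
  rw [hb] at hN
  -- `σ` is the sign of `α`. It is constant near `ξ`, where `|α| = σ α` makes the map rational in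
  -- `α`.
  obtain ⟨σ, hσ, hσ0⟩ : ∃ σ : ℝ, σ * σ = 1 ∧ 0 < σ * a ξ := by
    rcases lt_or_gt_of_ne haξ with h | h
    · exact ⟨-1, by norm_num, by linarith⟩
    · exact ⟨1, by norm_num, by linarith⟩
  have hσ1 : |σ| = 1 := by
    rcases mul_self_eq_one_iff.1 hσ with h | h <;> simp [h]
  have hσne : σ ≠ 0 := fun h0 => by simp [h0] at hσ
  obtain ⟨A, hA⟩ : ∃ A : U →L[ℝ] targetSpace U Z,
      ∀ x, (A x : U × L) = (kerComponent Z x, 0) :=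
    ⟨((ContinuousLinearMap.inl ℝ U L).comp (j U Z).ker.starProjection).codRestrict _
      (fun x => ⟨lie_kerComponent Z x, trivial⟩), fun x => rfl⟩
  obtain ⟨B, hB⟩ : ∃ B : L →L[ℝ] targetSpace U Z, ∀ x, (B x : U × L) = (0, x) :=
    ⟨(ContinuousLinearMap.inr ℝ U L).codRestrict _ (fun x => ⟨Submodule.zero_mem _, trivial⟩),
      fun x => rfl⟩
  have hfirst : ∀ η : domainSpace U Z, 0 < σ * a η → firstHit (η : U × L) =
      ((ω * σ * (a η)⁻¹) • A (b η) + ((ω * σ) • B Z +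
        (ω * σ * ((a η)⁻¹ * (a η)⁻¹)) • B (hitQuad Z R P' (b η))) : targetSpace U Z) := by
    intro η h
    have hη0 : a η ≠ 0 := fun h0 => by simp [h0] at h
    have habs : |a η| = σ * a η := by
      rw [← abs_of_pos h, abs_mul, hσ1, one_mul]
    obtain ⟨h1, h2⟩ := firstHit_smul hUinv hω hR hR0 hη0 (b η)
    have e1 : ω / |a η| = ω * σ * (a η)⁻¹ := by
      rw [habs]
      field_simp
      rw [sq, hσ]
    have hη : (η : U × L) = (b η, a η • Z) := Prod.ext (hb η) (ha η)
    rw [hη]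
    simp only [Submodule.coe_add, Submodule.coe_smul, hA, hB]
    refine Prod.ext ?_ ?_
    · rw [h1, e1]
      simp
    · refine ext_inner_right ℝ fun Y => ?_
      obtain ⟨V, hV⟩ := (hP Y).2
      rw [h2 Y (P Y) V (hP Y).1 hV, ← div_div, e1]
      simp only [Prod.snd_add, Prod.smul_snd, smul_zero, zero_add,
        inner_add_left, inner_smul_left, conj_trivial, hitQuad, hP', inner_nilBracketL]
      field_simp
  have hdir : ∀ H : U, ∃ h : domainSpace U Z, a h = 0 ∧ b h = H := by
    intro H
    refine ⟨⟨(H, 0), ⟨trivial, Submodule.zero_mem _⟩⟩, ?_, (hb _).symm⟩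
    have := ha ⟨(H, 0), ⟨trivial, Submodule.zero_mem _⟩⟩
    exact (smul_eq_zero.1 this.symm).resolve_right hZ
  have hc0 : ω * σ * (a ξ)⁻¹ ≠ 0 := mul_ne_zero (mul_ne_zero hω0 hσne) (inv_ne_zero haξ)
  have hd0 : ω * σ * ((a ξ)⁻¹ * (a ξ)⁻¹) ≠ 0 := mul_ne_zero (mul_ne_zero hω0 hσne)
    (mul_ne_zero (inv_ne_zero haξ) (inv_ne_zero haξ))
  obtain ⟨F', hF', hFs⟩ := exists_surjective_hasFDerivAt a b A B
    (hasFDerivAt_hitQuad Z R P' (b ξ)) (ω * σ) ((ω * σ) • B Z) haξ hdir (by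
      rintro ⟨⟨u, y⟩, hu, -⟩
      have hu : ⁅Z, u⁆ = 0 := hu
      set c := ω * σ * (a ξ)⁻¹
      set d := ω * σ * ((a ξ)⁻¹ * (a ξ)⁻¹)
      -- The system is triangular: `c⁻¹ u` in `ker j(Z)` gives the `U`-component, and a vector in
      -- the image of `j(Z)`, invisible there, corrects the central one.
      obtain ⟨x, hx⟩ := exists_hitQuadDeriv_eq hUinv hR hR' hP hP' hN
        (d⁻¹ • y - hitQuadDeriv Z R P' (b ξ) (c⁻¹ • u))
      have hk : kerComponent Z (c⁻¹ • u + ⁅Z, x⁆) = c⁻¹ • u := by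
        have : kerComponent Z (c⁻¹ • u + ⁅Z, x⁆) =
            kerComponent Z (c⁻¹ • u) + kerComponent Z ⁅Z, x⁆ := map_add _ _ _
        rw [this, kerComponent_lie hUinv, add_zero]
        exact kerComponent_eq_self (by rw [lie_smul, hu, smul_zero])
      refine ⟨c⁻¹ • u + ⁅Z, x⁆, Subtype.ext ?_⟩
      rw [map_add (hitQuadDeriv Z R P' (b ξ)), hx, add_sub_cancel]
      simp only [Submodule.coe_add, Submodule.coe_smul, hA, hB, hk]
      refine Prod.ext ?_ ?_
      · simp [hc0]
      · simp [hd0])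
  refine ⟨F', ?_, hFs⟩
  refine (((targetSpace U Z).subtypeL.hasFDerivAt).comp ξ hF').congr_of_eventuallyEq ?_
  have : ∀ᶠ η in nhds ξ, 0 < σ * a η :=
    (continuous_const.mul a.continuous).continuousAt.eventually (lt_mem_nhds hσ0)
  filter_upwards [this] with η h
  exact hfirst η h

end FirstHitMap

/-! ### Real and imaginary parts in the complexification -/

section Complexification

variable {M : Type*} [AddCommGroup M] [Module ℝ M]

/-- The vector `x + i y` of the complexification. -/
def cpx (x y : M) : ℂ ⊗[ℝ] M := (1 : ℂ) ⊗ₜ[ℝ] x + Complex.I ⊗ₜ[ℝ] y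

theorem tmul_eq_cpx (c : ℂ) (x : M) : c ⊗ₜ[ℝ] x = cpx (c.re • x) (c.im • x) := by
  rw [cpx, ← TensorProduct.smul_tmul, ← TensorProduct.smul_tmul, ← TensorProduct.add_tmul]
  congr 1
  apply Complex.ext <;> simp

theorem cpx_add (x y x' y' : M) : cpx x y + cpx x' y' = cpx (x + x') (y + y') := by
  simp only [cpx, TensorProduct.tmul_add]
  abel

theorem cpx_sub (x y x' y' : M) : cpx x y - cpx x' y' = cpx (x - x') (y - y') := by
  simp only [cpx, TensorProduct.tmul_sub]
  abel

theorem cpx_neg (x y : M) : -cpx x y = cpx (-x) (-y) := by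
  simp only [cpx, TensorProduct.tmul_neg]
  abel

theorem smul_cpx (c : ℂ) (x y : M) :
    c • cpx x y = cpx (c.re • x - c.im • y) (c.re • y + c.im • x) := by
  have h1 : c • cpx x y = c ⊗ₜ[ℝ] x + (c * Complex.I) ⊗ₜ[ℝ] y := by
    simp [cpx, TensorProduct.smul_tmul']
  rw [h1, tmul_eq_cpx, tmul_eq_cpx, cpx_add]
  simp [sub_eq_add_neg, add_comm]

theorem cpx_zero : cpx (0 : M) 0 = 0 := by simp [cpx]

theorem exists_eq_cpx (v : ℂ ⊗[ℝ] M) : ∃ x y : M, v = cpx x y := by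
  induction v using TensorProduct.induction_on with
  | zero => exact ⟨0, 0, cpx_zero.symm⟩
  | tmul c x => exact ⟨_, _, tmul_eq_cpx c x⟩
  | add v w hv hw =>
    obtain ⟨x, y, rfl⟩ := hv
    obtain ⟨x', y', rfl⟩ := hw
    exact ⟨_, _, cpx_add _ _ _ _⟩

theorem cpx_inj {x y x' y' : M} : cpx x y = cpx x' y' ↔ x = x' ∧ y = y' := by
  constructor
  · intro h
    have hre := congrArg (fun v => TensorProduct.lid ℝ M
      (LinearMap.rTensor M Complex.reLm v)) h
    have him := congrArg (fun v => TensorProduct.lid ℝ M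
      (LinearMap.rTensor M Complex.imLm v)) h
    simp [cpx] at hre him
    exact ⟨hre, him⟩
  · rintro ⟨rfl, rfl⟩
    rfl

theorem cpx_eq_zero {x y : M} : cpx x y = 0 ↔ x = 0 ∧ y = 0 := by
  rw [← cpx_zero, cpx_inj]

theorem one_tmul_eq_cpx (x : M) : (1 : ℂ) ⊗ₜ[ℝ] x = cpx x 0 := by simp [cpx]

theorem mem_baseChange_iff {W : Submodule ℝ M} {v : ℂ ⊗[ℝ] M} :
    v ∈ W.baseChange ℂ ↔ ∃ x ∈ W, ∃ y ∈ W, v = cpx x y := by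
  constructor
  · intro h
    rw [Submodule.baseChange_eq_span] at h
    induction h using Submodule.span_induction with
    | mem v hv =>
      obtain ⟨x, hx, rfl⟩ := hv
      exact ⟨x, hx, 0, W.zero_mem, one_tmul_eq_cpx x⟩
    | zero => exact ⟨0, W.zero_mem, 0, W.zero_mem, cpx_zero.symm⟩
    | add v w _ _ hv hw =>
      obtain ⟨x, hx, y, hy, rfl⟩ := hv
      obtain ⟨x', hx', y', hy', rfl⟩ := hw
      exact ⟨_, W.add_mem hx hx', _, W.add_mem hy hy', cpx_add _ _ _ _⟩
    | smul c v _ hv =>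
      obtain ⟨x, hx, y, hy, rfl⟩ := hv
      exact ⟨_, W.sub_mem (W.smul_mem _ hx) (W.smul_mem _ hy), _,
        W.add_mem (W.smul_mem _ hy) (W.smul_mem _ hx), smul_cpx _ _ _⟩
  · rintro ⟨x, hx, y, hy, rfl⟩
    exact Submodule.add_mem _ (Submodule.tmul_mem_baseChange_of_mem _ hx)
      (Submodule.tmul_mem_baseChange_of_mem _ hy)

variable {L : Type*} [LieRing L] [LieAlgebra ℝ L] [LieRingModule L M] [LieModule ℝ L M]

theorem toEnd_cpx (a b : L) (x y : M) :
    LieModule.toEnd ℂ (ℂ ⊗[ℝ] L) (ℂ ⊗[ℝ] M) (cpx a b) (cpx x y) =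
      cpx (⁅a, x⁆ - ⁅b, y⁆) (⁅a, y⁆ + ⁅b, x⁆) := by
  rw [LieModule.toEnd_apply_apply]
  simp only [cpx, add_lie, lie_add, LieAlgebra.ExtendScalars.bracket_tmul, one_mul, mul_one,
    Complex.I_mul_I, TensorProduct.neg_tmul, TensorProduct.tmul_sub, TensorProduct.tmul_add]
  abel

theorem lie_smul_complexification (e : ℂ ⊗[ℝ] L) (c : ℂ) (v : ℂ ⊗[ℝ] M) :
    ⁅e, c • v⁆ = c • ⁅e, v⁆ :=
  (LieModule.toEnd ℂ (ℂ ⊗[ℝ] L) (ℂ ⊗[ℝ] M) e).map_smul c v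

theorem lie_cpx (a b : L) (x y : M) :
    ⁅cpx a b, cpx x y⁆ = cpx (⁅a, x⁆ - ⁅b, y⁆) (⁅a, y⁆ + ⁅b, x⁆) := toEnd_cpx a b x y

theorem lie_cpx_self (a b : L) (x y : L) :
    ⁅cpx a b, cpx x y⁆ = cpx (⁅a, x⁆ - ⁅b, y⁆) (⁅a, y⁆ + ⁅b, x⁆) := toEnd_cpx a b x y

theorem smul_lie_complexification (c : ℂ) (e : ℂ ⊗[ℝ] L) (v : ℂ ⊗[ℝ] M) :
    ⁅c • e, v⁆ = c • ⁅e, v⁆ := by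
  obtain ⟨a, b, rfl⟩ := exists_eq_cpx e
  obtain ⟨x, y, rfl⟩ := exists_eq_cpx v
  rw [smul_cpx, lie_cpx, lie_cpx, smul_cpx, cpx_inj]
  simp only [add_lie, sub_lie, smul_lie, smul_add, smul_sub]
  constructor <;> abel

end Complexification

/-! ### Weight vectors of a module with an invariant form -/

section WeightVectors

variable {L : Type*} [LieRing L] [LieAlgebra ℝ L] (h₀ : LieSubalgebra ℝ L)
variable (M : Type*) [AddCommGroup M] [Module ℝ M] [LieRingModule L M] [LieModule ℝ L M]

variable {h₀} in
theorem exists_eq_toComplexCartan (H : complexCartan h₀) :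
    ∃ a b : h₀, H = toComplexCartan h₀ a + Complex.I • toComplexCartan h₀ b := by
  obtain ⟨a, ha, b, hb, h⟩ := mem_baseChange_iff.1 H.2
  refine ⟨⟨a, ha⟩, ⟨b, hb⟩, Subtype.ext ?_⟩
  rw [h]
  simp [cpx, toComplexCartan, TensorProduct.smul_tmul']

theorem coe_toComplexCartan (H : h₀) : (toComplexCartan h₀ H : ℂ ⊗[ℝ] L) = cpx (H : L) 0 := by
  simp [cpx, toComplexCartan]

theorem mem_weightSpace_iff {μ : CartanDual h₀} {v : ℂ ⊗[ℝ] M} :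
    v ∈ weightSpace h₀ M μ ↔ ∀ H : h₀,
      ⁅cpx (H : L) 0, v⁆ = μ (toComplexCartan h₀ H) • v := by
  rw [mem_weightSpace]
  constructor
  · intro h H
    have := h (toComplexCartan h₀ H)
    rwa [coe_toComplexCartan] at this
  · intro h H
    obtain ⟨a, b, rfl⟩ := exists_eq_toComplexCartan H
    rw [Submodule.coe_add, Submodule.coe_smul, coe_toComplexCartan, coe_toComplexCartan, map_add,
      map_smul, map_add, map_smul, LinearMap.add_apply, LinearMap.smul_apply,
      LieModule.toEnd_apply_apply, LieModule.toEnd_apply_apply, h, h, add_smul, smul_assoc]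

theorem cpx_mem_weightSpace {μ : CartanDual h₀} {x y : M} :
    cpx x y ∈ weightSpace h₀ M μ ↔ ∀ H : h₀,
      ⁅(H : L), x⁆ = (μ (toComplexCartan h₀ H)).re • x - (μ (toComplexCartan h₀ H)).im • y ∧
      ⁅(H : L), y⁆ = (μ (toComplexCartan h₀ H)).re • y + (μ (toComplexCartan h₀ H)).im • x := by
  rw [mem_weightSpace_iff]
  refine forall_congr' fun H => ?_
  rw [lie_cpx, smul_cpx, cpx_inj, zero_lie, zero_lie, sub_zero, add_zero]

/-- An inner product for which the elements of `h₀` act by skew symmetric maps. -/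
structure IsInvariantForm (B : LinearMap.BilinForm ℝ M) : Prop where
  symm : ∀ x y, B x y = B y x
  pos : ∀ x, x ≠ 0 → 0 < B x x
  inv : ∀ (H : h₀) (x y : M), B ⁅(H : L), x⁆ y = -B x ⁅(H : L), y⁆

variable {h₀ M}

theorem IsInvariantForm.eq_zero {B : LinearMap.BilinForm ℝ M} (hB : IsInvariantForm h₀ M B) {x : M}
    (h : B x x = 0) : x = 0 := by
  by_contra hx
  exact (hB.pos x hx).ne' h

theorem IsInvariantForm.nonneg {B : LinearMap.BilinForm ℝ M} (hB : IsInvariantForm h₀ M B)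
    (x : M) : 0 ≤ B x x := by
  by_cases h : x = 0
  · simp [h]
  · exact (hB.pos x h).le

/-- Weights take imaginary values on `h₀`. -/
theorem IsInvariantForm.re_eq_zero {B : LinearMap.BilinForm ℝ M} (hB : IsInvariantForm h₀ M B)
    {μ : CartanDual h₀} (hμ : IsWeight h₀ M μ) (H : h₀) : (μ (toComplexCartan h₀ H)).re = 0 := by
  obtain ⟨v, hv, hv0⟩ := Submodule.exists_mem_ne_zero_of_ne_bot hμ
  obtain ⟨x, y, rfl⟩ := exists_eq_cpx v
  obtain ⟨hx, hy⟩ := (cpx_mem_weightSpace h₀ M).1 hv H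
  have e1 : B ⁅(H : L), x⁆ x = 0 := by
    have h1 := hB.inv H x x
    have h2 := hB.symm ⁅(H : L), x⁆ x
    linarith
  have e2 : B ⁅(H : L), y⁆ y = 0 := by
    have h1 := hB.inv H y y
    have h2 := hB.symm ⁅(H : L), y⁆ y
    linarith
  rw [hx] at e1
  rw [hy] at e2
  simp only [map_sub, map_add, map_smul, LinearMap.sub_apply, LinearMap.add_apply,
    LinearMap.smul_apply, smul_eq_mul] at e1 e2
  have h3 := hB.symm x y
  have h4 : (μ (toComplexCartan h₀ H)).re * (B x x + B y y) = 0 := by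
    rw [h3] at e2
    linarith
  refine (mul_eq_zero.1 h4).resolve_right fun h5 => hv0 ?_
  have := hB.nonneg x
  have := hB.nonneg y
  rw [cpx_eq_zero]
  exact ⟨hB.eq_zero (by linarith), hB.eq_zero (by linarith)⟩

theorem IsWeight.exists_cpx {μ : CartanDual h₀} (hμ : IsWeight h₀ M μ) :
    ∃ x y : M, ¬(x = 0 ∧ y = 0) ∧ cpx x y ∈ weightSpace h₀ M μ := by
  obtain ⟨v, hv, hv0⟩ := Submodule.exists_mem_ne_zero_of_ne_bot hμ
  obtain ⟨x, y, rfl⟩ := exists_eq_cpx v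
  exact ⟨x, y, fun h => hv0 (cpx_eq_zero.2 h), hv⟩

theorem isWeight_of_mem {μ : CartanDual h₀} {v : ℂ ⊗[ℝ] M} (hv : v ∈ weightSpace h₀ M μ)
    (h0 : v ≠ 0) : IsWeight h₀ M μ := fun h => h0 (by rwa [h, Submodule.mem_bot] at hv)

theorem isWeight_of_cpx {μ : CartanDual h₀} {x y : M} (hv : cpx x y ∈ weightSpace h₀ M μ)
    (h0 : ¬(x = 0 ∧ y = 0)) : IsWeight h₀ M μ :=
  isWeight_of_mem hv (fun h => h0 (cpx_eq_zero.1 h))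

/-- Since weights are imaginary on `h₀`, each `H` rotates the pair of real and imaginary parts of a
weight vector. -/
theorem IsInvariantForm.lie_weightVector {B : LinearMap.BilinForm ℝ M}
    (hB : IsInvariantForm h₀ M B) {μ : CartanDual h₀} {x y : M}
    (hv : cpx x y ∈ weightSpace h₀ M μ) (H : h₀) :
    ⁅(H : L), x⁆ = -(μ (toComplexCartan h₀ H)).im • y ∧
      ⁅(H : L), y⁆ = (μ (toComplexCartan h₀ H)).im • x := by
  by_cases h0 : x = 0 ∧ y = 0
  · simp [h0.1, h0.2]
  have := (cpx_mem_weightSpace h₀ M).1 hv H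
  rw [hB.re_eq_zero (isWeight_of_cpx hv h0) H] at this
  simpa using this

theorem lie_lie_comm_of_isLieAbelian (hab : ∀ a b : h₀, ⁅(a : L), (b : L)⁆ = 0)
    (H H' : complexCartan h₀) (v : ℂ ⊗[ℝ] M) :
    ⁅(H : ℂ ⊗[ℝ] L), ⁅(H' : ℂ ⊗[ℝ] L), v⁆⁆ = ⁅(H' : ℂ ⊗[ℝ] L), ⁅(H : ℂ ⊗[ℝ] L), v⁆⁆ := by
  have h : ⁅(H : ℂ ⊗[ℝ] L), (H' : ℂ ⊗[ℝ] L)⁆ = 0 := by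
    obtain ⟨a, ha, b, hb, e⟩ := mem_baseChange_iff.1 H.2
    obtain ⟨a', ha', b', hb', e'⟩ := mem_baseChange_iff.1 H'.2
    rw [e, e', lie_cpx_self, hab ⟨a, ha⟩ ⟨a', ha'⟩, hab ⟨b, hb⟩ ⟨b', hb'⟩, hab ⟨a, ha⟩ ⟨b', hb'⟩,
      hab ⟨b, hb⟩ ⟨a', ha'⟩, sub_zero, add_zero, cpx_zero]
  rw [leibniz_lie, h, zero_lie, zero_add]

/-- A nonzero `h₀`-invariant subspace contains the real and imaginary parts of a weight vector. -/
theorem exists_weightVector [FiniteDimensional ℝ M] (hab : ∀ a b : h₀, ⁅(a : L), (b : L)⁆ = 0)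
    {W : Submodule ℝ M} (hW : W ≠ ⊥) (hinv : ∀ (H : h₀), ∀ x ∈ W, ⁅(H : L), x⁆ ∈ W) :
    ∃ (μ : CartanDual h₀) (x y : M), x ∈ W ∧ y ∈ W ∧ ¬(x = 0 ∧ y = 0) ∧
      cpx x y ∈ weightSpace h₀ M μ := by
  -- A minimal nonzero `h`-invariant subspace of the complexification of `W` is taken. An eigenspace
  -- of any `H` inside it is again invariant by commutativity, hence everything, so all of `h` acts
  -- by scalars.
  let S : Set (Submodule ℂ (ℂ ⊗[ℝ] M)) := {N | N ≠ ⊥ ∧ N ≤ W.baseChange ℂ ∧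
    ∀ H : complexCartan h₀, ∀ v ∈ N, ⁅(H : ℂ ⊗[ℝ] L), v⁆ ∈ N}
  have hS : S.Nonempty := by
    refine ⟨W.baseChange ℂ, ?_, le_rfl, ?_⟩
    · obtain ⟨x, hx, hx0⟩ := Submodule.exists_mem_ne_zero_of_ne_bot hW
      intro h
      have : cpx x 0 ∈ W.baseChange ℂ := mem_baseChange_iff.2 ⟨x, hx, 0, W.zero_mem, rfl⟩
      rw [h, Submodule.mem_bot, cpx_eq_zero] at this
      exact hx0 this.1
    · intro H v hv
      obtain ⟨a, ha, b, hb, e⟩ := mem_baseChange_iff.1 H.2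
      obtain ⟨x, hx, y, hy, rfl⟩ := mem_baseChange_iff.1 hv
      rw [e, lie_cpx]
      exact mem_baseChange_iff.2 ⟨_, W.sub_mem (hinv ⟨a, ha⟩ x hx) (hinv ⟨b, hb⟩ y hy), _,
        W.add_mem (hinv ⟨a, ha⟩ y hy) (hinv ⟨b, hb⟩ x hx), rfl⟩
  obtain ⟨N, ⟨hN0, hNW, hNinv⟩, hmin⟩ := wellFounded_lt.has_min S hS
  have hscalar : ∀ H : complexCartan h₀, ∃ c : ℂ, ∀ v ∈ N, ⁅(H : ℂ ⊗[ℝ] L), v⁆ = c • v := by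
    intro H
    have : Nontrivial N := Submodule.nontrivial_iff_ne_bot.2 hN0
    let f : Module.End ℂ N :=
      (LieModule.toEnd ℂ (ℂ ⊗[ℝ] L) (ℂ ⊗[ℝ] M) (H : ℂ ⊗[ℝ] L)).restrict (hNinv H)
    obtain ⟨c, hc⟩ := Module.End.exists_eigenvalue f
    obtain ⟨w, hw⟩ := hc.exists_hasEigenvector
    refine ⟨c, ?_⟩
    let N' : Submodule ℂ (ℂ ⊗[ℝ] M) := N ⊓
      Module.End.eigenspace (LieModule.toEnd ℂ (ℂ ⊗[ℝ] L) (ℂ ⊗[ℝ] M) (H : ℂ ⊗[ℝ] L)) c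
    have hN' : N' ∈ S := by
      refine ⟨?_, inf_le_left.trans hNW, ?_⟩
      · intro h
        have hw' : (w : ℂ ⊗[ℝ] M) ∈ N' := by
          refine ⟨w.2, Module.End.mem_eigenspace_iff.2 ?_⟩
          exact congrArg Subtype.val hw.apply_eq_smul
        rw [h, Submodule.mem_bot] at hw'
        exact hw.2 (Subtype.ext hw')
      · rintro H' v ⟨hv, hv'⟩
        refine ⟨hNinv H' v hv, Module.End.mem_eigenspace_iff.2 ?_⟩
        have hv' := Module.End.mem_eigenspace_iff.1 hv'
        rw [LieModule.toEnd_apply_apply] at hv' ⊢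
        rw [lie_lie_comm_of_isLieAbelian hab, hv', lie_smul_complexification]
    have hle : N ≤ N' := by
      have h1 := hmin N' hN'
      have h2 : N' ≤ N := inf_le_left
      by_contra h3
      exact h1 (lt_of_le_not_ge h2 h3)
    intro v hv
    exact Module.End.mem_eigenspace_iff.1 (hle hv).2
  choose c hc using hscalar
  obtain ⟨v, hv, hv0⟩ := Submodule.exists_mem_ne_zero_of_ne_bot hN0
  let μ : CartanDual h₀ :=
    { toFun := c
      map_add' := fun H H' => smul_left_injective ℂ hv0 (by
        change c (H + H') • v = (c H + c H') • v
        rw [← hc _ v hv, Submodule.coe_add, add_lie, hc _ v hv, hc _ v hv, add_smul])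
      map_smul' := fun z H => smul_left_injective ℂ hv0 (by
        change c (z • H) • v = (z * c H) • v
        rw [← hc _ v hv, Submodule.coe_smul, smul_lie, hc _ v hv, smul_smul]) }
  obtain ⟨x, hx, y, hy, rfl⟩ := mem_baseChange_iff.1 (hNW hv)
  refine ⟨μ, x, y, hx, hy, fun h => hv0 (cpx_eq_zero.2 h), ?_⟩
  rw [mem_weightSpace]
  intro H
  exact hc H _ hv

/-- The bracket of a root vector and a weight vector is a weight vector. -/
theorem lie_mem_weightSpace {α μ : CartanDual h₀} {e : ℂ ⊗[ℝ] L} {v : ℂ ⊗[ℝ] M}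
    (he : e ∈ weightSpace h₀ L α) (hv : v ∈ weightSpace h₀ M μ) :
    ⁅e, v⁆ ∈ weightSpace h₀ M (α + μ) := by
  rw [mem_weightSpace_iff] at he hv ⊢
  intro H
  have h1 : ⁅⁅cpx (H : L) 0, e⁆, v⁆ = ⁅α (toComplexCartan h₀ H) • e, v⁆ :=
    congrArg (fun z : ℂ ⊗[ℝ] L => ⁅z, v⁆) (he H)
  rw [leibniz_lie, hv, lie_smul_complexification, h1, smul_lie_complexification, LinearMap.add_apply, add_smul]

end WeightVectors

/-! ### Finite dimensional sl₂ theory -/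

section Sl2

variable {𝔤 V : Type*} [LieRing 𝔤] [LieAlgebra ℂ 𝔤] [AddCommGroup V] [Module ℂ V]
  [LieRingModule 𝔤 V] [LieModule ℂ 𝔤 V] [FiniteDimensional ℂ V] {h e f : 𝔤}

/-- The end of the string through an eigenvector is primitive. -/
theorem exists_primitive (t : IsSl2Triple h e f) {m : V} {c : ℂ} (hm : ⁅h, m⁆ = c • m)
    (h0 : m ≠ 0) : ∃ n : ℕ,
      t.HasPrimitiveVectorWith (((LieModule.toEnd ℂ 𝔤 V e) ^ n) m) (c + 2 * n) := by
  -- Otherwise the vectors `e^k m` would be eigenvectors of `h` for the infinitely many eigenvalues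
  -- `c + 2k`.
  have hz : ∃ k, ((LieModule.toEnd ℂ 𝔤 V e) ^ k) m = 0 := by
    by_contra! contra
    let evals (n : ℕ) : ℂ := c + 2 * (n : ℂ)
    have h_inj : Function.Injective evals := fun a b hab ↦ by
      simpa [evals] using hab
    have aux (μ : Set.range evals) : (LieModule.toEnd ℂ 𝔤 V h).HasEigenvector μ
        (((LieModule.toEnd ℂ 𝔤 V e) ^ μ.property.choose) m) := by
      have hμ : (μ : ℂ) = c + 2 * (μ.property.choose : ℂ) := μ.property.choose_spec.symm
      refine ⟨?_, contra _⟩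
      rw [Module.End.mem_eigenspace_iff, LieModule.toEnd_apply_apply]
      exact (t.lie_h_pow_toEnd_e hm _).trans (congrArg (fun z : ℂ => z • _) hμ.symm)
    have := ((LieModule.toEnd ℂ 𝔤 V h).eigenvectors_linearIndependent
      (Set.range evals) _ aux).finite
    exact (Set.infinite_range_of_injective h_inj) (Set.toFinite _)
  obtain ⟨n, hn, hn'⟩ := Nat.exists_not_and_succ_of_not_zero_of_exists
    (p := fun k => ((LieModule.toEnd ℂ 𝔤 V e) ^ k) m = 0) h0 hz
  exact ⟨n, hn, t.lie_h_pow_toEnd_e hm n, by rwa [IsSl2Triple.lie_e_pow_toEnd_e]⟩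

theorem exists_int_of_lie_eq_smul (t : IsSl2Triple h e f) {m : V} {c : ℂ} (hm : ⁅h, m⁆ = c • m)
    (h0 : m ≠ 0) : ∃ n : ℤ, c = n := by
  obtain ⟨n, hn⟩ := exists_primitive t hm h0
  obtain ⟨k, hk⟩ := hn.exists_nat
  exact ⟨k - 2 * n, by push_cast; rw [← hk]; ring⟩

/-- A vector of positive weight is not killed by the lowering operator. -/
theorem eq_zero_of_lie_f_eq_zero (t : IsSl2Triple h e f) {m : V} (hm : ⁅h, m⁆ = (2 : ℂ) • m)
    (hf : ⁅f, m⁆ = 0) : m = 0 := by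
  by_contra h0
  -- Exchanging `e` and `f` makes `m` primitive of weight `-2`, whereas weights of primitive vectors
  -- are natural numbers.
  have P : t.symm.HasPrimitiveVectorWith m (-2 : ℂ) := ⟨h0, by rw [neg_lie, hm, neg_smul], hf⟩
  obtain ⟨n, hn⟩ := P.exists_nat
  have h2 : ((n + 2 : ℕ) : ℂ) = 0 := by
    push_cast
    rw [← hn]
    ring
  exact absurd (Nat.cast_eq_zero.1 h2) (by omega)

end Sl2

/-! ### Root space decomposition of the compact form -/

section Cartan

variable {L : Type*} [LieRing L] [LieAlgebra ℝ L] [FiniteDimensional ℝ L]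
  {h₀ : LieSubalgebra ℝ L}

theorem IsMaximalAbelian.lie_eq_zero (h : IsMaximalAbelian h₀) (a b : h₀) :
    ⁅(a : L), (b : L)⁆ = 0 := by
  have : IsLieAbelian h₀ := h.prop
  have h1 : ⁅a, b⁆ = 0 := trivial_lie_zero _ _ a b
  rw [← LieSubalgebra.coe_bracket, h1]
  rfl

/-- A maximal abelian subalgebra is its own centralizer. -/
theorem IsMaximalAbelian.mem_of_lie_eq_zero (h : IsMaximalAbelian h₀) {x : L}
    (hx : ∀ H : h₀, ⁅(H : L), x⁆ = 0) : x ∈ h₀ := by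
  have hlie : ∀ y ∈ h₀.toSubmodule ⊔ Submodule.span ℝ {x},
      ∀ z ∈ h₀.toSubmodule ⊔ Submodule.span ℝ {x}, ⁅y, z⁆ = 0 := by
    intro y hy z hz
    obtain ⟨a, ha, _, hc, rfl⟩ := Submodule.mem_sup.1 hy
    obtain ⟨b, hb, _, hd, rfl⟩ := Submodule.mem_sup.1 hz
    obtain ⟨c, rfl⟩ := Submodule.mem_span_singleton.1 hc
    obtain ⟨d, rfl⟩ := Submodule.mem_span_singleton.1 hd
    have h1 : ⁅a, b⁆ = 0 := h.lie_eq_zero ⟨a, ha⟩ ⟨b, hb⟩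
    have h2 : ⁅a, x⁆ = 0 := hx ⟨a, ha⟩
    have h3 : ⁅x, b⁆ = 0 := by rw [← lie_skew, hx ⟨b, hb⟩, neg_zero]
    simp [h1, h2, h3]
  let h' : LieSubalgebra ℝ L :=
    { h₀.toSubmodule ⊔ Submodule.span ℝ {x} with
      lie_mem' := fun {y z} hy hz => by
        rw [hlie y hy z hz]
        exact Submodule.zero_mem _ }
  have hab : IsLieAbelian h' := ⟨fun y z => Subtype.ext (hlie y y.2 z z.2)⟩
  have hle : h₀ ≤ h' := fun y hy => Submodule.mem_sup_left hy
  exact h.le_of_ge hab hle (Submodule.mem_sup_right (Submodule.mem_span_singleton_self x))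

variable (h₀) in
theorem IsCompactSemisimple.isInvariantForm (hL : IsCompactSemisimple L) :
    IsInvariantForm h₀ L (-killingForm ℝ L) where
  symm x y := by
    simp only [LinearMap.neg_apply]
    rw [LieModule.traceForm_comm ℝ L L x y]
  pos x hx := by
    simpa using hL x hx
  inv H x y := by
    simp only [LinearMap.neg_apply]
    rw [killingForm_lie_left]

theorem killingForm_cpx (a b c d : L) :
    killingForm ℂ (ℂ ⊗[ℝ] L) (cpx a b) (cpx c d) =
      ((killingForm ℝ L a c - killingForm ℝ L b d : ℝ) : ℂ) +
        ((killingForm ℝ L a d + killingForm ℝ L b c : ℝ) : ℂ) * Complex.I := by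
  have h : killingForm ℂ (ℂ ⊗[ℝ] L) = (killingForm ℝ L).baseChange ℂ :=
    LieModule.traceForm_baseChange ℝ L L ℂ
  rw [h]
  apply Complex.ext <;>
    simp [cpx, LinearMap.BilinForm.baseChange_tmul, sub_eq_add_neg]

theorem killingForm_complex_lie_left (X Y Z : ℂ ⊗[ℝ] L) :
    killingForm ℂ (ℂ ⊗[ℝ] L) ⁅Z, X⁆ Y = -killingForm ℂ (ℂ ⊗[ℝ] L) X ⁅Z, Y⁆ := by
  have h : killingForm ℂ (ℂ ⊗[ℝ] L) ⁅X, Z⁆ Y = killingForm ℂ (ℂ ⊗[ℝ] L) X ⁅Z, Y⁆ :=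
    LieModule.traceForm_apply_lie_apply ℂ (ℂ ⊗[ℝ] L) (ℂ ⊗[ℝ] L) X Z Y
  rw [← lie_skew, map_neg, LinearMap.neg_apply, h]

/-- The real number `b` with `μ(H) = i b`. -/
def imPart (μ : CartanDual h₀) (H : h₀) : ℝ := (μ (toComplexCartan h₀ H)).im

theorem imPart_neg (μ : CartanDual h₀) (H : h₀) : imPart (-μ) H = -imPart μ H := by
  simp [imPart]

theorem ext_toComplexCartan {μ ν : CartanDual h₀}
    (h : ∀ H, μ (toComplexCartan h₀ H) = ν (toComplexCartan h₀ H)) : μ = ν := by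
  ext H
  obtain ⟨a, b, rfl⟩ := exists_eq_toComplexCartan H
  rw [map_add, map_add, map_smul, map_smul, h, h]

variable {M : Type*} [AddCommGroup M] [Module ℝ M] [LieRingModule L M] [LieModule ℝ L M]

theorem IsInvariantForm.apply_eq {B : LinearMap.BilinForm ℝ M} (hB : IsInvariantForm h₀ M B)
    {μ : CartanDual h₀} (hμ : IsWeight h₀ M μ) (H : h₀) :
    μ (toComplexCartan h₀ H) = imPart μ H * Complex.I := by
  apply Complex.ext
  · rw [hB.re_eq_zero hμ]
    simp
  · simp [imPart]

/-- Complex conjugation negates weights because they are imaginary on `h₀`. -/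
theorem IsInvariantForm.cpx_neg_mem {B : LinearMap.BilinForm ℝ M} (hB : IsInvariantForm h₀ M B)
    {μ : CartanDual h₀} {x y : M} (hv : cpx x y ∈ weightSpace h₀ M μ) :
    cpx x (-y) ∈ weightSpace h₀ M (-μ) := by
  by_cases h0 : x = 0 ∧ y = 0
  · rw [h0.1, h0.2, neg_zero, cpx_zero]
    exact Submodule.zero_mem _
  rw [cpx_mem_weightSpace]
  intro H
  have h1 := hB.lie_weightVector hv H
  have h2 : ((-μ) (toComplexCartan h₀ H)).re = 0 := by
    simp [hB.re_eq_zero (isWeight_of_cpx hv h0) H]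
  rw [h2, LinearMap.neg_apply, Complex.neg_im, lie_neg, h1.1, h1.2]
  simp

theorem IsInvariantForm.isWeight_neg {B : LinearMap.BilinForm ℝ M} (hB : IsInvariantForm h₀ M B)
    {μ : CartanDual h₀} (hμ : IsWeight h₀ M μ) : IsWeight h₀ M (-μ) := by
  obtain ⟨x, y, h0, hv⟩ := hμ.exists_cpx
  exact isWeight_of_cpx (hB.cpx_neg_mem hv) (by simpa using h0)

theorem IsRoot.isWeight {β : CartanDual h₀} (h : IsRoot h₀ β) : IsWeight h₀ L β := h.2

theorem IsRoot.neg (hL : IsCompactSemisimple L) {β : CartanDual h₀} (h : IsRoot h₀ β) :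
    IsRoot h₀ (-β) :=
  ⟨neg_ne_zero.2 h.1, (hL.isInvariantForm h₀).isWeight_neg h.2⟩

namespace CompactChevalleyBasis

variable (C : CompactChevalleyBasis h₀)

theorem X_eq {β : CartanDual h₀} (h : IsRoot h₀ β) :
    C.X β = cpx ((1 / 2 : ℝ) • C.A β) (-((1 / 2 : ℝ) • C.B β)) := by
  have hA := C.A_eq β h
  have hB := C.B_eq β h
  have h1 : C.X β = (1 / 2 : ℂ) • ((1 : ℂ) ⊗ₜ[ℝ] C.A β) -
      (Complex.I / 2) • ((1 : ℂ) ⊗ₜ[ℝ] C.B β) := by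
    rw [hA, hB, smul_smul, show Complex.I / 2 * Complex.I = -(1 / 2) by
      rw [div_mul_eq_mul_div, Complex.I_mul_I]; ring]
    module
  rw [h1, one_tmul_eq_cpx, one_tmul_eq_cpx, smul_cpx, smul_cpx, cpx_sub, cpx_inj]
  simp

theorem X_neg_eq {β : CartanDual h₀} (h : IsRoot h₀ β) :
    C.X (-β) = cpx (-((1 / 2 : ℝ) • C.A β)) (-((1 / 2 : ℝ) • C.B β)) := by
  have hA := C.A_eq β h
  have h1 : C.X (-β) = C.X β - (1 : ℂ) ⊗ₜ[ℝ] C.A β := by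
    rw [hA]
    abel
  rw [h1, C.X_eq h, one_tmul_eq_cpx, cpx_sub, cpx_inj]
  constructor
  · module
  · module

theorem lie_A (hL : IsCompactSemisimple L) {β : CartanDual h₀} (h : IsRoot h₀ β) (H : h₀) :
    ⁅(H : L), C.A β⁆ = imPart β H • C.B β ∧ ⁅(H : L), C.B β⁆ = -(imPart β H • C.A β) := by
  have hX := C.X_mem β h
  rw [C.X_eq h] at hX
  obtain ⟨h1, h2⟩ := (hL.isInvariantForm h₀).lie_weightVector hX H
  have hA : C.A β = (2 : ℝ) • ((1 / 2 : ℝ) • C.A β) := by module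
  have hB : C.B β = (-2 : ℝ) • (-((1 / 2 : ℝ) • C.B β)) := by module
  constructor
  · conv_lhs => rw [hA]
    rw [lie_smul, h1, imPart]
    module
  · conv_lhs => rw [hB]
    rw [lie_smul, h2, imPart]
    module

theorem τ_eq_cpx {β : CartanDual h₀} (h : IsRoot h₀ β) : C.τ β = cpx 0 (-C.T β) := by
  have hT := C.T_eq β h
  have h1 : C.τ β = (-Complex.I) • ((1 : ℂ) ⊗ₜ[ℝ] C.T β) := by
    rw [hT, smul_smul]
    simp
  rw [h1, one_tmul_eq_cpx, smul_cpx, cpx_inj]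
  simp

/-- The dual vector of `β` is purely imaginary: its real part is Killing-orthogonal to `h₀` and lies
in `h₀`, so it vanishes by definiteness. Its imaginary part is `Q`. -/
theorem exists_coroot (hL : IsCompactSemisimple L) {β : CartanDual h₀} (h : IsRoot h₀ β) :
    ∃ Q ∈ h₀, killingForm ℝ L Q Q ≠ 0 ∧ C.T β = (2 / killingForm ℝ L Q Q) • Q ∧
      ∀ H : h₀, killingForm ℝ L H Q = imPart β H := by
  obtain ⟨P, hP, Q, hQ, hPQ⟩ := mem_baseChange_iff.1 (C.Hvec β).2
  have hk : ∀ H : h₀, killingForm ℝ L H P = 0 ∧ killingForm ℝ L H Q = imPart β H := by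
    intro H
    have := C.killing_Hvec β h (toComplexCartan h₀ H)
    rw [coe_toComplexCartan, hPQ, killingForm_cpx,
      (hL.isInvariantForm h₀).apply_eq h.isWeight] at this
    have hre := congrArg Complex.re this
    have him := congrArg Complex.im this
    simp at hre him
    exact ⟨hre, him⟩
  have hP0 : P = 0 := hL.eq_zero (hk ⟨P, hP⟩).1
  have hQ0 : killingForm ℝ L Q Q ≠ 0 := by
    intro h0
    have hQ0 := hL.eq_zero h0
    refine h.1 (ext_toComplexCartan fun H => ?_)
    rw [(hL.isInvariantForm h₀).apply_eq h.isWeight, ← (hk H).2, hQ0]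
    simp
  refine ⟨Q, hQ, hQ0, ?_, fun H => (hk H).2⟩
  have hτ := C.τ_eq β h
  rw [C.τ_eq_cpx h, hPQ, hP0, killingForm_cpx] at hτ
  have hc : (2 : ℂ) / ((killingForm ℝ L 0 0 - killingForm ℝ L Q Q : ℝ) +
      ((killingForm ℝ L 0 Q + killingForm ℝ L Q 0 : ℝ) : ℂ) * Complex.I) =
      ((-2 / killingForm ℝ L Q Q : ℝ) : ℂ) := by
    simp only [map_zero, LinearMap.zero_apply, zero_sub, add_zero, Complex.ofReal_zero, zero_mul]
    push_cast
    rw [div_neg, neg_div]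
  rw [hc, smul_cpx, cpx_inj] at hτ
  have h2 := hτ.2
  simp only [Complex.ofReal_re, Complex.ofReal_im, zero_smul, add_zero] at h2
  rw [← neg_neg (C.T β), h2, neg_div, neg_smul, neg_neg]

theorem imPart_T (hL : IsCompactSemisimple L) {β : CartanDual h₀} (h : IsRoot h₀ β) :
    imPart β ⟨C.T β, C.T_mem β h⟩ = 2 := by
  obtain ⟨Q, hQ, hQ0, hT, hk⟩ := C.exists_coroot hL h
  rw [← hk]
  change killingForm ℝ L (C.T β) Q = 2
  rw [hT, map_smul, LinearMap.smul_apply, smul_eq_mul]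
  field_simp

theorem isSl2Triple (hL : IsCompactSemisimple L) {β : CartanDual h₀} (h : IsRoot h₀ β) :
    IsSl2Triple (C.τ β) (C.X β) (C.X (-β)) := by
  obtain ⟨h1, h2⟩ := C.lie_A hL h ⟨C.T β, C.T_mem β h⟩
  rw [C.imPart_T hL h] at h1 h2
  have h1 : ⁅C.T β, C.A β⁆ = (2 : ℝ) • C.B β := h1
  have h2 : ⁅C.T β, C.B β⁆ = -((2 : ℝ) • C.A β) := h2
  refine ⟨?_, C.lie_X_neg β h, ?_, ?_⟩
  · rw [C.τ_eq_cpx h]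
    intro h0
    have hT : C.T β = 0 := by simpa using (cpx_eq_zero.1 h0).2
    have h3 := C.imPart_T hL h
    have h4 : (⟨C.T β, C.T_mem β h⟩ : h₀) = 0 := Subtype.ext hT
    have h5 : toComplexCartan h₀ 0 = 0 := Subtype.ext (by simp [toComplexCartan])
    rw [h4, imPart, h5, map_zero] at h3
    norm_num at h3
  · rw [C.τ_eq_cpx h, C.X_eq h, lie_cpx_self, two_nsmul, cpx_add, cpx_inj]
    simp only [zero_lie, neg_lie, lie_neg, lie_smul, h1, h2]
    constructor <;> module
  · rw [C.τ_eq_cpx h, C.X_neg_eq h, lie_cpx_self, two_nsmul, cpx_add, cpx_neg, cpx_inj]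
    simp only [zero_lie, neg_lie, lie_neg, lie_smul, h1, h2]
    constructor <;> module

/-- Root spaces are one dimensional. -/
theorem mem_span_of_mem_weightSpace (hL : IsCompactSemisimple L) (hmax : IsMaximalAbelian h₀)
    {β : CartanDual h₀} (h : IsRoot h₀ β) {x y : L} (hv : cpx x y ∈ weightSpace h₀ L β) :
    x ∈ Submodule.span ℝ {C.A β, C.B β} ∧ y ∈ Submodule.span ℝ {C.A β, C.B β} := by
  have t := C.isSl2Triple hL h
  set e := C.X β with he
  set f := C.X (-β) with hf
  have hef : killingForm ℂ (ℂ ⊗[ℝ] L) e f ≠ 0 := by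
    rw [he, hf, C.X_eq h, C.X_neg_eq h, killingForm_cpx]
    intro h0
    have hre := congrArg Complex.re h0
    simp at hre
    have hA := (hL.isInvariantForm h₀).nonneg (C.A β)
    have hB := (hL.isInvariantForm h₀).nonneg (C.B β)
    simp only [LinearMap.neg_apply] at hA hB
    have hA0 : C.A β = 0 := hL.eq_zero (by linarith)
    have hB0 : C.B β = 0 := hL.eq_zero (by linarith)
    refine t.e_ne_zero ?_
    rw [he, C.X_eq h, hA0, hB0, smul_zero, neg_zero, cpx_zero]
  set v := cpx x y with hvdef
  set k := killingForm ℂ (ℂ ⊗[ℝ] L) v f / killingForm ℂ (ℂ ⊗[ℝ] L) e f with hk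
  -- The multiple of `e` is chosen so that `w` is Killing-orthogonal to `f`. The claim is that `w =
  -- 0`.
  set w := v - k • e with hw
  have hwmem : w ∈ weightSpace h₀ L β :=
    Submodule.sub_mem _ hv (Submodule.smul_mem _ _ (C.X_mem β h))
  have hwf : killingForm ℂ (ℂ ⊗[ℝ] L) w f = 0 := by
    rw [hw, map_sub, map_smul, LinearMap.sub_apply, LinearMap.smul_apply, hk, smul_eq_mul,
      div_mul_cancel₀ _ hef, sub_self]
  have hfmem := C.X_mem (-β) (h.neg hL)
  -- `[f, w]` has weight zero, so its real and imaginary parts lie in `h₀` by maximality. Invariance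
  -- turns its pairing with `H` into a multiple of the pairing of `w` with `f`, which is zero, and
  -- definiteness on `h₀` finishes.
  have hfw : ⁅f, w⁆ = 0 := by
    have hz : ⁅f, w⁆ ∈ weightSpace h₀ L (-β + β) := lie_mem_weightSpace hfmem hwmem
    rw [neg_add_cancel] at hz
    obtain ⟨p, q, hpq⟩ := exists_eq_cpx ⁅f, w⁆
    rw [hpq] at hz ⊢
    have hz' := (cpx_mem_weightSpace h₀ L).1 hz
    simp only [LinearMap.zero_apply, Complex.zero_re, Complex.zero_im, zero_smul, sub_zero,
      add_zero] at hz'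
    have hp : p ∈ h₀ := hmax.mem_of_lie_eq_zero fun H => (hz' H).1
    have hq : q ∈ h₀ := hmax.mem_of_lie_eq_zero fun H => (hz' H).2
    have hK : ∀ H : h₀, killingForm ℝ L p H = 0 ∧ killingForm ℝ L q H = 0 := by
      intro H
      have h1 : killingForm ℂ (ℂ ⊗[ℝ] L) (cpx p q) (cpx (H : L) 0) = 0 := by
        rw [← hpq, killingForm_complex_lie_left]
        have h2 : ⁅f, w⁆ = -⁅w, f⁆ := (lie_skew _ _).symm
        have h3 : killingForm ℂ (ℂ ⊗[ℝ] L) w ⁅f, cpx (H : L) 0⁆ = 0 := by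
          rw [← lie_skew, (mem_weightSpace_iff h₀ L).1 hfmem H, map_neg, map_smul, hwf, smul_zero,
            neg_zero]
        rw [h3, neg_zero]
      rw [killingForm_cpx] at h1
      have hre := congrArg Complex.re h1
      have him := congrArg Complex.im h1
      simp at hre him
      exact ⟨hre, him⟩
    rw [hL.eq_zero (hK ⟨p, hp⟩).1, hL.eq_zero (hK ⟨q, hq⟩).2, cpx_zero]
  have hhw : ⁅C.τ β, w⁆ = (2 : ℂ) • w := by
    have h1 := (mem_weightSpace_iff h₀ L).1 hwmem ⟨C.T β, C.T_mem β h⟩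
    rw [(hL.isInvariantForm h₀).apply_eq h.isWeight, C.imPart_T hL h] at h1
    have h2 : C.τ β = (-Complex.I) • cpx (C.T β) 0 := by
      rw [C.τ_eq_cpx h, smul_cpx, cpx_inj]
      simp
    have h1 : ⁅cpx (C.T β) 0, w⁆ = (((2 : ℝ) : ℂ) * Complex.I) • w := h1
    rw [h2, smul_lie_complexification, h1, smul_smul]
    congr 1
    rw [mul_comm, mul_assoc]
    simp
  have hw0 : w = 0 := eq_zero_of_lie_f_eq_zero t hhw hfw
  have hve : v = k • e := sub_eq_zero.1 hw0
  rw [hvdef, he, C.X_eq h, smul_cpx, cpx_inj] at hve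
  have hA : C.A β ∈ Submodule.span ℝ {C.A β, C.B β} := Submodule.subset_span (by simp)
  have hB : C.B β ∈ Submodule.span ℝ {C.A β, C.B β} := Submodule.subset_span (by simp)
  rw [hve.1, hve.2]
  constructor
  · exact Submodule.sub_mem _ (Submodule.smul_mem _ _ (Submodule.smul_mem _ _ hA))
      (Submodule.smul_mem _ _ (Submodule.neg_mem _ (Submodule.smul_mem _ _ hB)))
  · exact Submodule.add_mem _ (Submodule.smul_mem _ _
      (Submodule.neg_mem _ (Submodule.smul_mem _ _ hB)))
      (Submodule.smul_mem _ _ (Submodule.smul_mem _ _ hA))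

/-- The real span of the vectors `A_β`, `B_β`. -/
def rootSpan : Submodule ℝ L :=
  Submodule.span ℝ {c | ∃ β, IsRoot h₀ β ∧ (c = C.A β ∨ c = C.B β)}

theorem span_le_rootSpan {β : CartanDual h₀} (h : IsRoot h₀ β) :
    Submodule.span ℝ {C.A β, C.B β} ≤ C.rootSpan := by
  refine Submodule.span_mono ?_
  rintro c (rfl | rfl)
  · exact ⟨β, h, Or.inl rfl⟩
  · exact ⟨β, h, Or.inr rfl⟩

theorem lie_mem_rootSpan (hL : IsCompactSemisimple L) (H : h₀) {x : L} (hx : x ∈ C.rootSpan) :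
    ⁅(H : L), x⁆ ∈ C.rootSpan := by
  induction hx using Submodule.span_induction with
  | mem c hc =>
    obtain ⟨β, h, rfl | rfl⟩ := hc
    · rw [(C.lie_A hL h H).1]
      exact Submodule.smul_mem _ _ (Submodule.subset_span ⟨β, h, Or.inr rfl⟩)
    · rw [(C.lie_A hL h H).2]
      exact Submodule.neg_mem _ (Submodule.smul_mem _ _ (Submodule.subset_span ⟨β, h, Or.inl rfl⟩))
  | zero => simp
  | add x y _ _ hx hy => rw [lie_add]; exact Submodule.add_mem _ hx hy
  | smul c x _ hx => rw [lie_smul]; exact Submodule.smul_mem _ _ hx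

/-- The root space decomposition of the compact real form. -/
theorem sup_rootSpan (hL : IsCompactSemisimple L) (hmax : IsMaximalAbelian h₀) :
    h₀.toSubmodule ⊔ C.rootSpan = ⊤ := by
  set V := h₀.toSubmodule ⊔ C.rootSpan with hV
  have hVinv : ∀ (H : h₀), ∀ x ∈ V, ⁅(H : L), x⁆ ∈ V := by
    intro H x hx
    obtain ⟨a, ha, s, hs, rfl⟩ := Submodule.mem_sup.1 hx
    rw [lie_add, hmax.lie_eq_zero H ⟨a, ha⟩, zero_add]
    exact Submodule.mem_sup_right (C.lie_mem_rootSpan hL H hs)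
  have hrefl : (killingForm ℝ L).IsRefl := fun x y h => by
    rwa [LieModule.traceForm_comm ℝ L L] at h
  have hdisj : Disjoint V ((killingForm ℝ L).orthogonal V) := by
    rw [Submodule.disjoint_def]
    intro x hx hx'
    exact hL.eq_zero (hx' x hx)
  have hcompl := (LinearMap.BilinForm.isCompl_orthogonal_iff_disjoint hrefl).2 hdisj
  -- A nonzero Killing complement of `V` would contain the parts of a weight vector. These also lie
  -- in `V`: by maximality of `h₀` if the weight is zero, by one-dimensionality of root spaces
  -- otherwise.
  suffices hW : (killingForm ℝ L).orthogonal V = ⊥ by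
    have := hcompl.sup_eq_top
    rwa [hW, sup_bot_eq] at this
  by_contra hW
  obtain ⟨μ, x, y, hx, hy, h0, hv⟩ := exists_weightVector (M := L) hmax.lie_eq_zero hW (by
    intro H x hx n hn
    have h1 : killingForm ℝ L ⁅(H : L), n⁆ x = 0 := hx _ (hVinv H n hn)
    rw [killingForm_lie_left] at h1
    exact neg_eq_zero.1 h1)
  have hmem : x ∈ V ∧ y ∈ V := by
    by_cases hμ : μ = 0
    · have h1 := (cpx_mem_weightSpace h₀ L).1 hv
      simp only [hμ, LinearMap.zero_apply, Complex.zero_re, Complex.zero_im, zero_smul, sub_zero,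
        add_zero] at h1
      exact ⟨Submodule.mem_sup_left (hmax.mem_of_lie_eq_zero fun H => (h1 H).1),
        Submodule.mem_sup_left (hmax.mem_of_lie_eq_zero fun H => (h1 H).2)⟩
    · have hr : IsRoot h₀ μ := ⟨hμ, isWeight_of_cpx hv h0⟩
      have h1 := C.mem_span_of_mem_weightSpace hL hmax hr hv
      exact ⟨Submodule.mem_sup_right (C.span_le_rootSpan hr h1.1),
        Submodule.mem_sup_right (C.span_le_rootSpan hr h1.2)⟩
  exact h0 ⟨(Submodule.disjoint_def.1 hdisj) x hmem.1 hx,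
    (Submodule.disjoint_def.1 hdisj) y hmem.2 hy⟩

end CompactChevalleyBasis

end Cartan

/-! ### Frequencies and periods of a skew endomorphism -/

section SkewSpectrum

variable {U : Type*} [NormedAddCommGroup U] [InnerProductSpace ℝ U] [FiniteDimensional ℝ U]

/-- The square of a skew symmetric endomorphism is diagonalizable. -/
theorem IsSkew.eq_top {J : U →L[ℝ] U} (hJ : IsSkew J) {W : Submodule ℝ U}
    (hW : ∀ (c : ℝ) (u : U), J (J u) = -(c ^ 2) • u → u ∈ W) : W = ⊤ := by
  let S : U →ₗ[ℝ] U := J.toLinearMap ∘ₗ J.toLinearMap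
  have hS : S.IsSymmetric := by
    intro x y
    change ⟪J (J x), y⟫_ℝ = ⟪x, J (J y)⟫_ℝ
    rw [hJ, hJ, neg_neg]
  have htop := Submodule.orthogonal_eq_bot_iff.1 hS.orthogonalComplement_iSup_eigenspaces_eq_bot
  rw [eq_top_iff, ← htop, iSup_le_iff]
  intro c u hu
  have hu : J (J u) = c • u := Module.End.mem_eigenspace_iff.1 hu
  by_cases h0 : u = 0
  · rw [h0]
    exact W.zero_mem
  have hc : c ≤ 0 := by
    have h1 : c * ⟪u, u⟫_ℝ = -⟪J u, J u⟫_ℝ := by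
      rw [← real_inner_smul_left, ← hu, hJ]
    have h2 : 0 < ⟪u, u⟫_ℝ := real_inner_self_pos.2 h0
    have h3 : 0 ≤ ⟪J u, J u⟫_ℝ := real_inner_self_nonneg
    by_contra h
    have := mul_pos (not_le.1 h) h2
    linarith
  refine hW (Real.sqrt (-c)) u ?_
  rw [Real.sq_sqrt (by linarith), neg_neg, hu]

theorem IsSkew.apply_eq_zero_of_apply_apply {J : U →L[ℝ] U} (hJ : IsSkew J) {u : U}
    (h : J (J u) = 0) : J u = 0 := by
  refine inner_self_eq_zero (𝕜 := ℝ).1 ?_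
  rw [hJ, h, inner_zero_right, neg_zero]

/-- The eigenvectors of `J²` span, and on one of frequency `n` the exponential is a rotation by the
angle `2πn`. -/
theorem IsSkew.exp_two_pi_smul {J : U →L[ℝ] U} (hJ : IsSkew J)
    (h : ∀ (c : ℝ) (u : U), u ≠ 0 → J (J u) = -(c ^ 2) • u → ∃ n : ℤ, c = n) :
    NormedSpace.exp ((2 * Real.pi) • J) = 1 := by
  have htop := hJ.eq_top
    (W := LinearMap.eqLocus (NormedSpace.exp ((2 * Real.pi) • J)).toLinearMap LinearMap.id)
    (fun c u hu => by
      change NormedSpace.exp ((2 * Real.pi) • J) u = u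
      by_cases h0 : u = 0
      · simp [h0]
      obtain ⟨n, rfl⟩ := h c u h0 hu
      by_cases hn : (n : ℝ) = 0
      · refine exp_apply_of_apply_eq_zero (hJ.apply_eq_zero_of_apply_apply ?_) _
        rw [hu, hn]
        simp
      · rw [exp_smul_apply_of_sq hn hu, Real.cos_int_mul_two_pi]
        have : Real.sin (n * (2 * Real.pi)) = 0 := by
          have h1 := Real.sin_int_mul_pi (2 * n)
          rw [← h1]
          push_cast
          ring_nf
        rw [this]
        simp)
  ext u
  have : u ∈ LinearMap.eqLocus (NormedSpace.exp ((2 * Real.pi) • J)).toLinearMap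
      LinearMap.id := by rw [htop]; trivial
  exact this

theorem isClosed_exp_smul_eq_one (J : U →L[ℝ] U) :
    IsClosed {t : ℝ | NormedSpace.exp (t • J) = 1} :=
  isClosed_eq (continuous_iff_continuousAt.2
    fun t => (hasDerivAt_exp_smul_const (𝕂 := ℝ) J t).continuousAt) continuous_const

/-- A nonzero skew symmetric endomorphism with a period has a smallest positive one. -/
theorem IsSkew.exists_isLeast_period {J : U →L[ℝ] U} (hJ : IsSkew J) (h0 : J ≠ 0) {ω : ℝ}
    (hω : 0 < ω) (h : NormedSpace.exp (ω • J) = 1) :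
    ∃ ω : ℝ, IsLeast {t : ℝ | 0 < t ∧ NormedSpace.exp (t • J) = 1} ω := by
  obtain ⟨c, u, hc, hu0, hu⟩ : ∃ (c : ℝ) (u : U), c ≠ 0 ∧ u ≠ 0 ∧ J (J u) = -(c ^ 2) • u := by
    by_contra! hcon
    refine h0 (ContinuousLinearMap.ext fun u => ?_)
    have htop := hJ.eq_top (W := J.ker) (fun c u hu => by
      by_cases hu0 : u = 0
      · rw [hu0]
        exact Submodule.zero_mem _
      by_cases hc : c = 0
      · exact hJ.apply_eq_zero_of_apply_apply (by rw [hu, hc]; simp)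
      · exact absurd hu (hcon c u hc hu0))
    have : u ∈ J.ker := by rw [htop]; trivial
    exact this
  -- A vector of frequency `c ≠ 0` bounds all periods away from zero. The positive periods therefore
  -- form a closed set that is bounded below, and the infimum is attained.
  have hlow : ∀ t, 0 < t → NormedSpace.exp (t • J) = 1 → 2 * Real.pi / |c| ≤ t := by
    intro t ht h1
    have h2 := exp_smul_apply_of_sq hc hu t
    rw [h1, one_apply_eq_self] at h2
    have h3 := congrArg (fun x => ⟪x, u⟫_ℝ) h2
    simp only [inner_add_left, real_inner_smul_left, hJ.inner_self, mul_zero, add_zero] at h3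
    have h4 : Real.cos (c * t) = 1 := by
      have : ⟪u, u⟫_ℝ ≠ 0 := inner_self_ne_zero.2 hu0
      field_simp at h3
      exact h3.symm
    obtain ⟨n, hn⟩ := (Real.cos_eq_one_iff _).1 h4
    have hn0 : n ≠ 0 := by
      rintro rfl
      have : c * t = 0 := by rw [← hn]; simp
      rcases mul_eq_zero.1 this with h | h
      · exact hc h
      · exact ht.ne' h
    have hn1 : (1 : ℝ) ≤ |(n : ℝ)| := by
      rw [← Int.cast_abs]
      exact_mod_cast Int.one_le_abs hn0
    rw [div_le_iff₀ (abs_pos.2 hc)]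
    calc 2 * Real.pi ≤ |(n : ℝ)| * (2 * Real.pi) :=
          le_mul_of_one_le_left Real.two_pi_pos.le hn1
      _ = |(n : ℝ) * (2 * Real.pi)| := by rw [abs_mul, abs_of_pos Real.two_pi_pos]
      _ = t * |c| := by rw [hn, abs_mul, abs_of_pos ht, mul_comm]
  have hpos : 0 < 2 * Real.pi / |c| := div_pos Real.two_pi_pos (abs_pos.2 hc)
  have heq : {t : ℝ | 0 < t ∧ NormedSpace.exp (t • J) = 1} =
      Set.Ici (2 * Real.pi / |c|) ∩ {t : ℝ | NormedSpace.exp (t • J) = 1} := by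
    ext t
    exact ⟨fun ht => ⟨hlow t ht.1 ht.2, ht.2⟩, fun ht => ⟨hpos.trans_le ht.1, ht.2⟩⟩
  rw [heq]
  exact ⟨_, (isClosed_Ici.inter (isClosed_exp_smul_eq_one J)).isLeast_csInf
    ⟨ω, hlow ω hω h, h⟩ ⟨2 * Real.pi / |c|, fun t ht => ht.1⟩⟩

end SkewSpectrum

/-! ### Periodicity of elements of `h_ℚ` -/

section Periods

variable {L : Type*} [InnerLieAlgebra L] [FiniteDimensional ℝ L]
variable {U : Type*} [NormedAddCommGroup U] [InnerProductSpace ℝ U] [FiniteDimensional ℝ U]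
  [LieRingModule L U] [LieModule ℝ L U] {h₀ : LieSubalgebra ℝ L}

variable (h₀) in
theorem isInvariantForm_inner
    (hUinv : ∀ (Z : L) (x y : U), ⟪⁅Z, x⁆, y⟫_ℝ = -⟪x, ⁅Z, y⁆⟫_ℝ) :
    IsInvariantForm h₀ U (innerₗ U) where
  symm x y := by simp [real_inner_comm]
  pos x hx := real_inner_self_pos.2 hx
  inv H x y := hUinv H x y

/-- A nonzero frequency `c` of `j(T_α)` on `u` is an eigenvalue of the coroot `τ_α = -i T_α`, with
eigenvector `c⁻¹ T_α u + i u`. By sl₂ theory it is an integer. -/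
theorem CompactChevalleyBasis.exp_two_pi_T (C : CompactChevalleyBasis h₀)
    (hL : IsCompactSemisimple L)
    (hUinv : ∀ (Z : L) (x y : U), ⟪⁅Z, x⁆, y⟫_ℝ = -⟪x, ⁅Z, y⁆⟫_ℝ) {α : CartanDual h₀}
    (hα : IsRoot h₀ α) : NormedSpace.exp ((2 * Real.pi) • j U (C.T α)) = 1 := by
  refine IsSkew.exp_two_pi_smul (hUinv _) fun c u hu0 hu => ?_
  by_cases hc : c = 0
  · exact ⟨0, by simpa using hc⟩
  have hu : ⁅C.T α, ⁅C.T α, u⁆⁆ = -(c ^ 2) • u := hu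
  have hw : ⁅C.τ α, cpx (c⁻¹ • ⁅C.T α, u⁆) u⁆ = (c : ℂ) • cpx (c⁻¹ • ⁅C.T α, u⁆) u := by
    rw [C.τ_eq_cpx hα, lie_cpx, smul_cpx, cpx_inj]
    simp only [neg_lie, zero_lie, lie_smul, hu, Complex.ofReal_re, Complex.ofReal_im, smul_smul]
    constructor
    · rw [mul_inv_cancel₀ hc]
      module
    · rw [neg_smul, neg_neg, smul_smul, show c⁻¹ * c ^ 2 = c by field_simp]
      module
  obtain ⟨n, hn⟩ := exists_int_of_lie_eq_smul (C.isSl2Triple hL hα) hw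
    (fun h => hu0 (cpx_eq_zero.1 h).2)
  exact ⟨n, by exact_mod_cast hn⟩

theorem exp_natCast_smul_eq_one {A : U →L[ℝ] U} (h : NormedSpace.exp A = 1) (n : ℕ) :
    NormedSpace.exp ((n : ℝ) • A) = 1 := by
  let _ : NormedAlgebra ℚ (U →L[ℝ] U) := NormedAlgebra.restrictScalars ℚ ℝ _
  rw [Nat.cast_smul_eq_nsmul, NormedSpace.exp_nsmul, h, one_pow]

theorem exp_intCast_smul_eq_one {A : U →L[ℝ] U} (h : NormedSpace.exp A = 1) (n : ℤ) :
    NormedSpace.exp ((n : ℝ) • A) = 1 := by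
  obtain ⟨k, rfl | rfl⟩ := n.eq_nat_or_neg
  · exact_mod_cast exp_natCast_smul_eq_one h k
  · rw [Int.cast_neg, neg_smul, exp_neg_eq_one_iff]
    exact_mod_cast exp_natCast_smul_eq_one h k

theorem exp_add_eq_one {A B : U →L[ℝ] U} (hc : Commute A B) (hA : NormedSpace.exp A = 1)
    (hB : NormedSpace.exp B = 1) : NormedSpace.exp (A + B) = 1 := by
  let _ : NormedAlgebra ℚ (U →L[ℝ] U) := NormedAlgebra.restrictScalars ℚ ℝ _
  rw [NormedSpace.exp_add_of_commute hc, hA, hB, one_mul]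

/-- Denominators are cleared: a rational multiple `q T_α` has the period `2π` times the denominator
of `q`. The generators commute, so the product of the two integers serves a sum. -/
theorem CompactChevalleyBasis.exists_period (C : CompactChevalleyBasis h₀)
    (hL : IsCompactSemisimple L) (hmax : IsMaximalAbelian h₀)
    (hUinv : ∀ (Z : L) (x y : U), ⟪⁅Z, x⁆, y⟫_ℝ = -⟪x, ⁅Z, y⁆⟫_ℝ) {Z : L} (hZ : Z ∈ C.hQ) :
    Z ∈ h₀ ∧ ∃ N : ℕ, 0 < N ∧ NormedSpace.exp ((N : ℝ) • ((2 * Real.pi) • j U Z)) = 1 := by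
  induction hZ using AddSubgroup.closure_induction with
  | mem Z hZ =>
    obtain ⟨q, _, ⟨α, hα, rfl⟩, rfl⟩ := hZ
    have hr := C.isRoot_of_mem α hα
    refine ⟨h₀.smul_mem _ (C.T_mem α hr), q.den, q.den_pos, ?_⟩
    have h1 := exp_intCast_smul_eq_one (C.exp_two_pi_T hL hUinv hr) q.num
    rw [j_smul]
    rw [← h1]
    congr 1
    rw [smul_smul, smul_smul, smul_smul]
    congr 1
    have : (q : ℝ) * q.den = q.num := by exact_mod_cast Rat.mul_den_eq_num q
    rw [← this]
    ring
  | zero =>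
    refine ⟨h₀.zero_mem, 1, one_pos, ?_⟩
    have : j U (0 : L) = 0 := by ext; simp [j_apply]
    rw [this]
    simp
  | add Z Z' _ _ h h' =>
    obtain ⟨hm, N, hN, he⟩ := h
    obtain ⟨hm', N', hN', he'⟩ := h'
    refine ⟨h₀.add_mem hm hm', N * N', Nat.mul_pos hN hN', ?_⟩
    have hc : Commute (j U Z) (j U Z') := by
      ext u
      change ⁅Z, ⁅Z', u⁆⁆ = ⁅Z', ⁅Z, u⁆⁆
      have h0 : ⁅Z, Z'⁆ = 0 := hmax.lie_eq_zero ⟨Z, hm⟩ ⟨Z', hm'⟩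
      rw [leibniz_lie, h0, zero_lie, zero_add]
    have e1 := exp_natCast_smul_eq_one he N'
    have e2 := exp_natCast_smul_eq_one he' N
    rw [smul_smul, smul_smul] at e1 e2
    have e3 := exp_add_eq_one ((hc.smul_left _).smul_right _) e1 e2
    rw [← e3, j_add, smul_smul, smul_add]
    congr 2
    · push_cast; congr 1; ring
    · push_cast; congr 1
  | neg Z _ h =>
    obtain ⟨hm, N, hN, he⟩ := h
    refine ⟨h₀.neg_mem hm, N, hN, ?_⟩
    have : j U (-Z) = -j U Z := by ext; simp [j_apply]
    rw [this, smul_neg, smul_neg, exp_neg_eq_one_iff, he]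

end Periods

/-! ### Super regular elements and nondegeneracy -/

section SuperRegular

variable {L : Type*} [InnerLieAlgebra L] [FiniteDimensional ℝ L]
variable {U : Type*} [NormedAddCommGroup U] [InnerProductSpace ℝ U] [FiniteDimensional ℝ U]
  [LieRingModule L U] [LieModule ℝ L U] {h₀ : LieSubalgebra ℝ L}

variable (U) in
/-- Super regularity in terms of the imaginary parts of the weights. -/
structure SuperRegularElement (Z : h₀) : Prop where
  imPart_ne_zero : ∀ μ : CartanDual h₀, IsWeight h₀ U μ → μ ≠ 0 → imPart μ Z ≠ 0
  eq_or_eq_neg : ∀ μ ν : CartanDual h₀, IsWeight h₀ U μ → IsWeight h₀ U ν →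
    imPart μ Z ^ 2 = imPart ν Z ^ 2 → ν = μ ∨ ν = -μ

theorem isSuperRegularIn_iff
    (hUinv : ∀ (Z : L) (x y : U), ⟪⁅Z, x⁆, y⟫_ℝ = -⟪x, ⁅Z, y⁆⟫_ℝ) {Z : L} :
    IsSuperRegularIn h₀ U Z ↔ ∃ hZ : Z ∈ h₀, SuperRegularElement U (⟨Z, hZ⟩ : h₀) := by
  have hB := isInvariantForm_inner h₀ hUinv
  have hsq : ∀ (a b : ℝ), ((a : ℂ) * Complex.I) ^ 2 = ((b : ℂ) * Complex.I) ^ 2 ↔ a ^ 2 = b ^ 2 := by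
    intro a b
    rw [mul_pow, mul_pow, Complex.I_sq, mul_neg_one, mul_neg_one, neg_inj]
    exact_mod_cast Iff.rfl
  constructor
  · rintro ⟨hZ, h1, h2⟩
    refine ⟨hZ, fun μ hμ h0 h => h1 μ hμ h0 ?_, fun μ ν hμ hν h => h2 μ ν hμ hν ?_⟩
    · rw [hB.apply_eq hμ, h]
      simp
    · rw [hB.apply_eq hμ, hB.apply_eq hν, hsq, h]
  · rintro ⟨hZ, h⟩
    refine ⟨hZ, fun μ hμ h0 h' => h.imPart_ne_zero μ hμ h0 ?_,
      fun μ ν hμ hν h' => h.eq_or_eq_neg μ ν hμ hν ?_⟩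
    · rw [hB.apply_eq hμ] at h'
      simpa using h'
    · rwa [hB.apply_eq hμ, hB.apply_eq hν, hsq] at h'

/-- The kernel of a super regular element is the zero weight space. -/
theorem SuperRegularElement.lie_eq_zero {Z : h₀} (hZ : SuperRegularElement U Z)
    (hmax : IsMaximalAbelian h₀)
    (hUinv : ∀ (Z : L) (x y : U), ⟪⁅Z, x⁆, y⟫_ℝ = -⟪x, ⁅Z, y⁆⟫_ℝ) {u : U}
    (hu : ⁅(Z : L), u⁆ = 0) (H : h₀) : ⁅(H : L), u⁆ = 0 := by
  have hB := isInvariantForm_inner h₀ hUinv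
  have hcomm : ∀ (H H' : h₀) (x : U), ⁅(H : L), ⁅(H' : L), x⁆⁆ = ⁅(H' : L), ⁅(H : L), x⁆⁆ := by
    intro H H' x
    rw [leibniz_lie, hmax.lie_eq_zero, zero_lie, zero_add]
  let K : Submodule ℝ U := ⨅ H : h₀, (j U (H : L)).ker
  have hK : ∀ x, x ∈ K ↔ ∀ H : h₀, ⁅(H : L), x⁆ = 0 := fun x => by
    simp only [K, Submodule.mem_iInf]
    rfl
  -- If `W` were nonzero it would contain a weight vector. Its weight vanishes at `Z`, hence is zero
  -- by super regularity, which puts the vector in `K` as well as in its orthogonal complement.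
  let W : Submodule ℝ U := (j U (Z : L)).ker ⊓ Kᗮ
  have hW : W = ⊥ := by
    by_contra hW
    obtain ⟨μ, x, y, hx, hy, h0, hv⟩ := exists_weightVector hmax.lie_eq_zero hW (by
      rintro H x ⟨hx, hx'⟩
      have hx : ⁅(Z : L), x⁆ = 0 := hx
      refine ⟨?_, ?_⟩
      · change ⁅(Z : L), ⁅(H : L), x⁆⁆ = 0
        rw [hcomm, hx, lie_zero]
      · rw [SetLike.mem_coe, Submodule.mem_orthogonal]
        intro k hk
        have := hUinv (H : L) k x
        rw [(hK k).1 hk H, inner_zero_left] at this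
        linarith)
    have h1 := hB.lie_weightVector hv Z
    have hx1 : ⁅(Z : L), x⁆ = 0 := hx.1
    have hy1 : ⁅(Z : L), y⁆ = 0 := hy.1
    rw [hx1, hy1] at h1
    have hμ : μ = 0 := by
      by_contra hμ
      have hne := hZ.imPart_ne_zero μ (isWeight_of_cpx hv h0) hμ
      exact h0 ⟨(smul_eq_zero.1 h1.2.symm).resolve_left hne,
        (smul_eq_zero.1 h1.1.symm).resolve_left (neg_ne_zero.2 hne)⟩
    have h2 : ∀ H : h₀, ⁅(H : L), x⁆ = 0 ∧ ⁅(H : L), y⁆ = 0 := by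
      intro H
      have := hB.lie_weightVector hv H
      simpa [hμ] using this
    have hxx := Submodule.inner_right_of_mem_orthogonal ((hK x).2 fun H => (h2 H).1) hx.2
    have hyy := Submodule.inner_right_of_mem_orthogonal ((hK y).2 fun H => (h2 H).2) hy.2
    exact h0 ⟨inner_self_eq_zero.1 hxx, inner_self_eq_zero.1 hyy⟩
  have hp : K.starProjection u ∈ K := Submodule.starProjection_apply_mem K u
  have hmem : u - K.starProjection u ∈ W := by
    refine ⟨?_, Submodule.sub_starProjection_mem_orthogonal u⟩
    change ⁅(Z : L), u - K.starProjection u⁆ = 0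
    rw [lie_sub, hu, (hK _).1 hp Z, sub_zero]
  rw [hW, Submodule.mem_bot, sub_eq_zero] at hmem
  rw [hmem]
  exact (hK _).1 hp H

/-! ### The real weight spaces -/

theorem mem_realWeightSpace {μ : CartanDual h₀} {x : U} :
    x ∈ realWeightSpace h₀ U μ ↔ cpx x 0 ∈ weightSpace h₀ U μ ⊔ weightSpace h₀ U (-μ) := by
  rw [← one_tmul_eq_cpx]
  rfl

theorem realWeightSpace_neg (μ : CartanDual h₀) :
    realWeightSpace h₀ U (-μ) = realWeightSpace h₀ U μ := by
  ext x
  rw [mem_realWeightSpace, mem_realWeightSpace, neg_neg, sup_comm]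

/-- The partner `y` is the vector into which the torus rotates `x`. If `x` is the sum of `a + ib` of
weight `μ` and `c + id` of weight `-μ`, it is `d - b`. -/
theorem exists_conjugate_of_mem_realWeightSpace
    (hUinv : ∀ (Z : L) (x y : U), ⟪⁅Z, x⁆, y⟫_ℝ = -⟪x, ⁅Z, y⁆⟫_ℝ) {μ : CartanDual h₀} {x : U}
    (hx : x ∈ realWeightSpace h₀ U μ) :
    ∃ y : U, ∀ H : h₀, ⁅(H : L), x⁆ = imPart μ H • y ∧ ⁅(H : L), y⁆ = -(imPart μ H • x) := by
  have hB := isInvariantForm_inner h₀ hUinv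
  obtain ⟨v, hv, w, hw, hvw⟩ := Submodule.mem_sup.1 (mem_realWeightSpace.1 hx)
  obtain ⟨a, b, rfl⟩ := exists_eq_cpx v
  obtain ⟨c, d, rfl⟩ := exists_eq_cpx w
  rw [cpx_add, cpx_inj] at hvw
  refine ⟨d - b, fun H => ?_⟩
  have h1 := hB.lie_weightVector hv H
  have h2 := hB.lie_weightVector hw H
  change _ = -imPart μ H • b ∧ _ = imPart μ H • a at h1
  change _ = -imPart (-μ) H • d ∧ _ = imPart (-μ) H • c at h2
  rw [imPart_neg] at h2
  rw [← hvw.1, lie_add, lie_sub, h1.1, h1.2, h2.1, h2.2]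
  constructor <;> module

theorem lie_add_complexification (e : ℂ ⊗[ℝ] L) (v w : ℂ ⊗[ℝ] U) :
    ⁅e, v + w⁆ = ⁅e, v⁆ + ⁅e, w⁆ :=
  (LieModule.toEnd ℂ (ℂ ⊗[ℝ] L) (ℂ ⊗[ℝ] U) e).map_add v w

theorem lie_mem_realWeightSpace {μ : CartanDual h₀} {x : U}
    (hx : x ∈ realWeightSpace h₀ U μ) (H : h₀) : ⁅(H : L), x⁆ ∈ realWeightSpace h₀ U μ := by
  obtain ⟨v, hv, w, hw, hvw⟩ := Submodule.mem_sup.1 (mem_realWeightSpace.1 hx)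
  rw [mem_realWeightSpace]
  have h1 : cpx ⁅(H : L), x⁆ 0 = ⁅cpx (H : L) 0, cpx x 0⁆ := by
    rw [lie_cpx]
    simp
  rw [h1, ← hvw, lie_add_complexification, (mem_weightSpace_iff h₀ U).1 hv,
    (mem_weightSpace_iff h₀ U).1 hw]
  exact Submodule.add_mem _ (Submodule.mem_sup_left (Submodule.smul_mem _ _ hv))
    (Submodule.mem_sup_right (Submodule.smul_mem _ _ hw))

theorem mem_realWeightSpace_of_cpx_mem
    (hUinv : ∀ (Z : L) (x y : U), ⟪⁅Z, x⁆, y⟫_ℝ = -⟪x, ⁅Z, y⁆⟫_ℝ) {μ : CartanDual h₀} {x y : U}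
    (hv : cpx x y ∈ weightSpace h₀ U μ) :
    x ∈ realWeightSpace h₀ U μ ∧ y ∈ realWeightSpace h₀ U μ := by
  have hw := (isInvariantForm_inner h₀ hUinv).cpx_neg_mem hv
  constructor
  · rw [mem_realWeightSpace]
    have h1 : cpx x 0 = (1 / 2 : ℂ) • cpx x y + (1 / 2 : ℂ) • cpx x (-y) := by
      rw [smul_cpx, smul_cpx, cpx_add, cpx_inj]
      norm_num
      module
    rw [h1]
    exact Submodule.add_mem _ (Submodule.mem_sup_left (Submodule.smul_mem _ _ hv))
      (Submodule.mem_sup_right (Submodule.smul_mem _ _ hw))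
  · rw [mem_realWeightSpace]
    have h1 : cpx y 0 = (-Complex.I / 2 : ℂ) • cpx x y + (Complex.I / 2 : ℂ) • cpx x (-y) := by
      rw [smul_cpx, smul_cpx, cpx_add, cpx_inj]
      norm_num
      module
    rw [h1]
    exact Submodule.add_mem _ (Submodule.mem_sup_left (Submodule.smul_mem _ _ hv))
      (Submodule.mem_sup_right (Submodule.smul_mem _ _ hw))

theorem lie_lie_of_mem_realWeightSpace
    (hUinv : ∀ (Z : L) (x y : U), ⟪⁅Z, x⁆, y⟫_ℝ = -⟪x, ⁅Z, y⁆⟫_ℝ) {μ : CartanDual h₀} {x : U}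
    (hx : x ∈ realWeightSpace h₀ U μ) (H : h₀) :
    ⁅(H : L), ⁅(H : L), x⁆⁆ = -((imPart μ H) ^ 2 • x) := by
  obtain ⟨y, hy⟩ := exists_conjugate_of_mem_realWeightSpace hUinv hx
  rw [(hy H).1, lie_smul, (hy H).2]
  module

/-- `j(Z)²` is symmetric. For super regular `Z` this makes real weight spaces with weights different
up to sign orthogonal. -/
theorem inner_eq_zero_of_sq_ne
    (hUinv : ∀ (Z : L) (x y : U), ⟪⁅Z, x⁆, y⟫_ℝ = -⟪x, ⁅Z, y⁆⟫_ℝ) {Z : L} {x y : U} {a b : ℝ}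
    (hx : ⁅Z, ⁅Z, x⁆⁆ = -(a • x)) (hy : ⁅Z, ⁅Z, y⁆⁆ = -(b • y)) (hab : a ≠ b) : ⟪x, y⟫_ℝ = 0 := by
  have h1 : ⟪⁅Z, ⁅Z, x⁆⁆, y⟫_ℝ = ⟪x, ⁅Z, ⁅Z, y⁆⁆⟫_ℝ := by rw [hUinv, hUinv, neg_neg]
  rw [hx, hy, inner_neg_left, inner_neg_right, real_inner_smul_left, real_inner_smul_right] at h1
  have h2 : (a - b) * ⟪x, y⟫_ℝ = 0 := by linarith
  exact (mul_eq_zero.1 h2).resolve_left (sub_ne_zero.2 hab)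

theorem isWeight_of_finrank {β : CartanDual h₀}
    (h : 2 ≤ Module.finrank ℂ (weightSpace h₀ U β)) : IsWeight h₀ U β := by
  intro h0
  rw [h0, finrank_bot] at h
  omega

namespace CompactChevalleyBasis

variable (C : CompactChevalleyBasis h₀)

theorem A_neg (hL : IsCompactSemisimple L) {β : CartanDual h₀} (h : IsRoot h₀ β) :
    C.A (-β) = -C.A β ∧ C.B (-β) = C.B β := by
  have h1 := C.X_eq (h.neg hL)
  rw [C.X_neg_eq h, cpx_inj] at h1
  constructor
  · have h2 : C.A (-β) = (2 : ℝ) • ((1 / 2 : ℝ) • C.A (-β)) := by module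
    rw [h2, ← h1.1]
    module
  · have h2 : C.B (-β) = (-2 : ℝ) • (-((1 / 2 : ℝ) • C.B (-β))) := by module
    rw [h2, ← h1.2]
    module

theorem lie_mem_realWeightSpace
    (hUinv : ∀ (Z : L) (x y : U), ⟪⁅Z, x⁆, y⟫_ℝ = -⟪x, ⁅Z, y⁆⟫_ℝ) {β : CartanDual h₀}
    (h : IsRoot h₀ β) {x : U} (hx : ∀ H : h₀, ⁅(H : L), x⁆ = 0) :
    ⁅C.A β, x⁆ ∈ realWeightSpace h₀ U β ∧ ⁅C.B β, x⁆ ∈ realWeightSpace h₀ U β := by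
  have h0 : cpx x 0 ∈ weightSpace h₀ U (0 : CartanDual h₀) := by
    rw [cpx_mem_weightSpace]
    intro H
    simp [hx H]
  have h1 := lie_mem_weightSpace (C.X_mem β h) h0
  rw [add_zero, C.X_eq h, lie_cpx] at h1
  obtain ⟨h2, h3⟩ := mem_realWeightSpace_of_cpx_mem hUinv h1
  simp only [lie_zero, sub_zero, zero_add, neg_lie, smul_lie] at h2 h3
  constructor
  · have := Submodule.smul_mem _ (2 : ℝ) h2
    rwa [smul_smul, show (2 : ℝ) * (1 / 2) = 1 by norm_num, one_smul] at this
  · have := Submodule.smul_mem _ (-2 : ℝ) h3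
    rwa [smul_neg, neg_smul, neg_neg, smul_smul, show (2 : ℝ) * (1 / 2) = 1 by norm_num,
      one_smul] at this

theorem lie_lie_A (hL : IsCompactSemisimple L) {β : CartanDual h₀} (h : IsRoot h₀ β) {Z : h₀}
    {x : U} (hx : ⁅(Z : L), x⁆ = 0) :
    ⁅(Z : L), ⁅C.A β, x⁆⁆ = imPart β Z • ⁅C.B β, x⁆ ∧
      ⁅(Z : L), ⁅C.B β, x⁆⁆ = -(imPart β Z • ⁅C.A β, x⁆) := by
  obtain ⟨h1, h2⟩ := C.lie_A hL h Z
  constructor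
  · rw [leibniz_lie, h1, hx, lie_zero, add_zero, smul_lie]
  · rw [leibniz_lie, h2, hx, lie_zero, add_zero, neg_lie, smul_lie]

/-- The skew map `j(Z)` rotates `A_β x` and `B_β x` into each other with nonzero speed, so they are
orthogonal and vanish together. -/
theorem linearIndependent_lie (hL : IsCompactSemisimple L)
    (hUinv : ∀ (Z : L) (x y : U), ⟪⁅Z, x⁆, y⟫_ℝ = -⟪x, ⁅Z, y⁆⟫_ℝ) {β : CartanDual h₀}
    (h : IsRoot h₀ β) {Z : h₀} (hb : imPart β Z ≠ 0) {x : U} (hx : ⁅(Z : L), x⁆ = 0) :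
    LinearIndependent ℝ ![⁅C.A β, x⁆, ⁅C.B β, x⁆] ↔ ⁅C.A β, x⁆ ≠ 0 := by
  obtain ⟨h1, h2⟩ := C.lie_lie_A hL h hx
  constructor
  · intro hli
    exact hli.ne_zero 0
  · intro hA
    have hB : ⁅C.B β, x⁆ ≠ 0 := by
      intro h0
      rw [h0, lie_zero] at h2
      exact (smul_ne_zero hb hA) (neg_eq_zero.1 h2.symm)
    have horth : ⟪⁅C.A β, x⁆, ⁅C.B β, x⁆⟫_ℝ = 0 := by
      have h3 := IsSkew.inner_self (A := j U (Z : L)) (hUinv _) ⁅C.A β, x⁆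
      rw [j_apply, h1, real_inner_smul_left] at h3
      rw [real_inner_comm]
      exact (mul_eq_zero.1 h3).resolve_left hb
    rw [LinearIndependent.pair_iff]
    intro s t hst
    have h4 := congrArg (fun z => ⟪⁅C.A β, x⁆, z⟫_ℝ) hst
    simp only [inner_add_right, real_inner_smul_right, horth, mul_zero, add_zero,
      inner_zero_right] at h4
    have hs : s = 0 := (mul_eq_zero.1 h4).resolve_right (inner_self_ne_zero.2 hA)
    rw [hs, zero_smul, zero_add] at hst
    exact ⟨hs, (smul_eq_zero.1 hst).resolve_right hB⟩

theorem exists_lie_eq_of_mem_rootSpan (hL : IsCompactSemisimple L) {Z : h₀}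
    (hZ : ∀ β, IsRoot h₀ β → imPart β Z ≠ 0) {S : L} (hS : S ∈ C.rootSpan) :
    ∃ W : L, S = ⁅(Z : L), W⁆ := by
  have hle : C.rootSpan ≤ ((LieAlgebra.ad ℝ L (Z : L) : L →ₗ[ℝ] L)).range := by
    refine Submodule.span_le.2 ?_
    rintro c ⟨β, h, hc⟩
    obtain ⟨h1, h2⟩ := C.lie_A hL h Z
    have hb := hZ β h
    rcases hc with rfl | rfl
    · refine ⟨-((imPart β Z)⁻¹ • C.B β), ?_⟩
      change ⁅(Z : L), -((imPart β Z)⁻¹ • C.B β)⁆ = C.A β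
      rw [lie_neg, lie_smul, h2, smul_neg, neg_neg, smul_smul, inv_mul_cancel₀ hb, one_smul]
    · refine ⟨(imPart β Z)⁻¹ • C.A β, ?_⟩
      change ⁅(Z : L), (imPart β Z)⁻¹ • C.A β⁆ = C.B β
      rw [lie_smul, h1, smul_smul, inv_mul_cancel₀ hb, one_smul]
  obtain ⟨W, hW⟩ := hle hS
  exact ⟨W, hW.symm⟩

/-- By the root space decomposition such an `H` is central, so `ad H = 0` and the Killing form
vanishes on it. -/
theorem eq_zero_of_imPart_eq_zero (C : CompactChevalleyBasis h₀) (hL : IsCompactSemisimple L) (hmax : IsMaximalAbelian h₀)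
    {H : h₀} (hH : ∀ β, IsRoot h₀ β → imPart β H = 0) : (H : L) = 0 := by
  have had : ∀ x : L, ⁅(H : L), x⁆ = 0 := by
    intro x
    have hx : x ∈ h₀.toSubmodule ⊔ C.rootSpan := by
      rw [C.sup_rootSpan hL hmax]
      trivial
    have hle : h₀.toSubmodule ⊔ C.rootSpan ≤ (LieAlgebra.ad ℝ L (H : L) : L →ₗ[ℝ] L).ker := by
      refine sup_le (fun a ha => hmax.lie_eq_zero H ⟨a, ha⟩) (Submodule.span_le.2 ?_)
      rintro c ⟨β, h, hc⟩
      obtain ⟨h1, h2⟩ := C.lie_A hL h H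
      rw [hH β h, zero_smul] at h1 h2
      rcases hc with rfl | rfl
      · exact h1
      · exact h2.trans neg_zero
    exact hle hx
  refine hL.eq_zero ?_
  have h0 : (LieAlgebra.ad ℝ L (H : L) : L →ₗ[ℝ] L) = 0 := LinearMap.ext had
  rw [killingForm_apply_apply, h0]
  simp

/-- The condition in the definition of `starSet`, for a single root. -/
def StarAt (Z : L) (β : CartanDual h₀) (X : U) : Prop :=
  ⁅C.A β, kerComponent Z X⁆ ≠ 0 ∧ (realWeightSpace h₀ U β).starProjection X ∉
    Submodule.span ℝ {⁅C.A β, kerComponent Z X⁆, ⁅C.B β, kerComponent Z X⁆}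

/-- The algebraic core. The two halves of the star condition play separate roles: `X_β` outside the
span removes the Cartan part of `Y`, and `A_β X₀ ≠ 0` removes the root part. -/
theorem nondegenerateAt_of_starAt (hL : IsCompactSemisimple L) (hmax : IsMaximalAbelian h₀)
    (hUinv : ∀ (Z : L) (x y : U), ⟪⁅Z, x⁆, y⟫_ℝ = -⟪x, ⁅Z, y⁆⟫_ℝ)
    (hmult : ∀ β : CartanDual h₀, IsRoot h₀ β → IsWeight h₀ U β) {Z : h₀}
    (hZ : SuperRegularElement U Z) {X : U} (hX : ∀ β, IsRoot h₀ β → C.StarAt (Z : L) β X) :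
    NondegenerateAt (Z : L) X := by
  have hb : ∀ β, IsRoot h₀ β → imPart β Z ≠ 0 := fun β h =>
    hZ.imPart_ne_zero β (hmult β h) h.1
  set X₀ := kerComponent (Z : L) X with hX₀
  have hZX₀ : ⁅(Z : L), X₀⁆ = 0 := lie_kerComponent _ _
  have hHX₀ : ∀ H : h₀, ⁅(H : L), X₀⁆ = 0 := hZ.lie_eq_zero hmax hUinv hZX₀
  intro Y Y' W hY' hYW hYX
  -- decompose `Y`
  have hYtop : Y ∈ h₀.toSubmodule ⊔ C.rootSpan := by
    rw [C.sup_rootSpan hL hmax]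
    trivial
  obtain ⟨H, hH, S, hS, hHS⟩ := Submodule.mem_sup.1 hYtop
  obtain ⟨V, hV⟩ := C.exists_lie_eq_of_mem_rootSpan hL hb hS
  have hZH : ⁅(Z : L), H⁆ = 0 := hmax.lie_eq_zero Z ⟨H, hH⟩
  -- Both `Y'` and `H` are components of `Y` in the centralizer of `Z` along the image of `ad Z`,
  -- and these two subspaces meet trivially.
  have hY'H : Y' = H := by
    have h1 : Y' - H = ⁅(Z : L), V - W⁆ := by
      rw [lie_sub, ← hV]
      have : Y' = H + S - ⁅(Z : L), W⁆ := by rw [hHS, hYW, add_sub_cancel_right]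
      rw [this]
      abel
    have h2 : ⁅(Z : L), V - W⁆ = 0 := by
      refine hL.eq_zero_of_lie_lie ?_
      rw [← h1, lie_sub, hY', hZH, sub_zero]
    rw [h2] at h1
    exact sub_eq_zero.1 h1
  rw [hY'H, ← hHS, add_lie, hHX₀ ⟨H, hH⟩, zero_add] at hYX
  -- the Cartan component vanishes
  have hH0 : ∀ β, IsRoot h₀ β → imPart β (⟨H, hH⟩ : h₀) = 0 := by
    intro β h
    by_contra hbH
    set π := (realWeightSpace h₀ U β).starProjection with hπ
    set D := Submodule.span ℝ {⁅C.A β, X₀⁆, ⁅C.B β, X₀⁆} with hD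
    have hAD : ⁅C.A β, X₀⁆ ∈ D := Submodule.subset_span (by simp)
    have hBD : ⁅C.B β, X₀⁆ ∈ D := Submodule.subset_span (by simp)
    have hπself : ∀ x ∈ realWeightSpace h₀ U β, π x = x := fun x hx =>
      Submodule.starProjection_eq_self_iff.2 hx
    have hother : ∀ γ, IsRoot h₀ γ → γ ≠ β → γ ≠ -β → ∀ y ∈ realWeightSpace h₀ U γ, π y = 0 := by
      intro γ hγ hne hne' y hy
      have : y ∈ (realWeightSpace h₀ U β)ᗮ := by
        rw [Submodule.mem_orthogonal]
        intro x hx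
        refine inner_eq_zero_of_sq_ne hUinv (Z := (Z : L))
          (lie_lie_of_mem_realWeightSpace hUinv hx Z)
          (lie_lie_of_mem_realWeightSpace hUinv hy Z) fun heq => ?_
        rcases hZ.eq_or_eq_neg β γ (hmult β h) (hmult γ hγ) heq with h' | h'
        · exact hne h'
        · exact hne' h'
      rw [hπ, Submodule.starProjection_apply, Submodule.coe_eq_zero]
      exact Submodule.orthogonalProjectionOnto_eq_zero_iff.2 this
    -- A root vector for `γ` moves `X₀` into `U_γ`, which is orthogonal to `U_β` unless `γ = ±β`.
    -- Only multiples of `A_β X₀` and `B_β X₀` survive the projection.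
    have hπS : π ⁅S, X₀⁆ ∈ D := by
      have hle : C.rootSpan ≤ D.comap (π.toLinearMap ∘ₗ evalAt L X₀) := by
        refine Submodule.span_le.2 ?_
        rintro c ⟨γ, hγ, hc⟩
        change π ⁅c, X₀⁆ ∈ D
        obtain ⟨hA, hB⟩ := C.lie_mem_realWeightSpace hUinv hγ hHX₀
        by_cases h1 : γ = β
        · subst h1
          rcases hc with rfl | rfl
          · rwa [hπself _ hA]
          · rwa [hπself _ hB]
        by_cases h2 : γ = -β
        · subst h2
          rw [realWeightSpace_neg] at hA hB
          rcases hc with rfl | rfl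
          · rw [hπself _ hA, (C.A_neg hL h).1, neg_lie]
            exact Submodule.neg_mem _ hAD
          · rwa [hπself _ hB, (C.A_neg hL h).2]
        · rcases hc with rfl | rfl
          · rw [hother γ hγ h1 h2 _ hA]
            exact Submodule.zero_mem _
          · rw [hother γ hγ h1 h2 _ hB]
            exact Submodule.zero_mem _
      exact hle hS
    have hcomm : ∀ (H : h₀) (x : U), π ⁅(H : L), x⁆ = ⁅(H : L), π x⁆ := fun H x =>
      IsSkew.starProjection_comm (T := j U (H : L)) (hUinv _) _
        (fun x hx => FirstHit.lie_mem_realWeightSpace hx H) x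
    have hπX : π X ∈ realWeightSpace h₀ U β := Submodule.starProjection_apply_mem _ _
    have hZinj : ∀ x ∈ realWeightSpace h₀ U β, ⁅(Z : L), x⁆ = 0 → x = 0 := by
      intro x hx h0
      have h1 := lie_lie_of_mem_realWeightSpace hUinv hx Z
      rw [h0, lie_zero] at h1
      exact (smul_eq_zero.1 (neg_eq_zero.1 h1.symm)).resolve_left (pow_ne_zero 2 (hb β h))
    have h1 : π ⁅S, X₀⁆ = ⁅H, π X⁆ := by
      have h2 := congrArg π hYX
      rw [hcomm Z, map_sub, map_zero, hcomm ⟨H, hH⟩] at h2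
      refine sub_eq_zero.1 (hZinj _ ?_ h2)
      exact Submodule.sub_mem _ (Submodule.starProjection_apply_mem _ _)
        (FirstHit.lie_mem_realWeightSpace hπX ⟨H, hH⟩)
    obtain ⟨y, hy⟩ := exists_conjugate_of_mem_realWeightSpace hUinv hπX
    -- `H` rotates `π X` to a nonzero multiple of its partner `y`, which is therefore in `D`.
    -- Applying `Z`, which preserves `D`, rotates `y` back to a multiple of `π X`.
    have hyD : y ∈ D := by
      have h3 := (hy ⟨H, hH⟩).1
      have h4 : y = (imPart β (⟨H, hH⟩ : h₀))⁻¹ • ⁅H, π X⁆ := by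
        rw [show ⁅H, π X⁆ = _ from h3, smul_smul, inv_mul_cancel₀ hbH, one_smul]
      rw [h4, ← h1]
      exact Submodule.smul_mem _ _ hπS
    have hZD : ∀ x ∈ D, ⁅(Z : L), x⁆ ∈ D := by
      intro x hx
      obtain ⟨s, t, rfl⟩ := Submodule.mem_span_pair.1 hx
      obtain ⟨h5, h6⟩ := C.lie_lie_A hL h hZX₀
      rw [lie_add, lie_smul, lie_smul, h5, h6]
      exact Submodule.add_mem _ (Submodule.smul_mem _ _ (Submodule.smul_mem _ _ hBD))
        (Submodule.smul_mem _ _ (Submodule.neg_mem _ (Submodule.smul_mem _ _ hAD)))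
    refine (hX β h).2 ?_
    have h7 : π X = -((imPart β Z)⁻¹ • ⁅(Z : L), y⁆) := by
      rw [(hy Z).2, smul_neg, neg_neg, smul_smul, inv_mul_cancel₀ (hb β h), one_smul]
    change π X ∈ D
    rw [h7]
    exact Submodule.neg_mem _ (Submodule.smul_mem _ _ (hZD y hyD))
  have hHz : H = 0 := C.eq_zero_of_imPart_eq_zero hL hmax hH0
  rw [hHz, zero_lie, sub_zero] at hYX
  -- the root component vanishes
  have hSX : ⁅S, X₀⁆ = 0 := by
    -- `S X₀` is a sum of vectors of nonzero weight, orthogonal to `ker j(Z)`, while `hYX` places it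
    -- in that kernel.
    have horth : ∀ w : U, ⁅(Z : L), w⁆ = 0 → ⟪w, ⁅S, X₀⁆⟫_ℝ = 0 := by
      intro w hw
      have hle : C.rootSpan ≤ (innerₗ U w ∘ₗ evalAt L X₀).ker := by
        refine Submodule.span_le.2 ?_
        rintro c ⟨γ, hγ, hc⟩
        change ⟪w, ⁅c, X₀⁆⟫_ℝ = 0
        obtain ⟨hA, hB⟩ := C.lie_mem_realWeightSpace hUinv hγ hHX₀
        have h1 : ∀ y ∈ realWeightSpace h₀ U γ, ⟪w, y⟫_ℝ = 0 := by
          intro y hy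
          refine inner_eq_zero_of_sq_ne hUinv (Z := (Z : L)) (a := 0) (by simp [hw])
            (lie_lie_of_mem_realWeightSpace hUinv hy Z) (pow_ne_zero 2 (hb γ hγ)).symm
        rcases hc with rfl | rfl
        · exact h1 _ hA
        · exact h1 _ hB
      exact hle hS
    exact inner_self_eq_zero.1 (horth _ hYX)
  -- The annihilator of `X₀` among root parts is `h₀`-invariant, since `h₀` kills `X₀`. It is
  -- therefore enough to exclude weight vectors, which live in a single plane spanned by `A_γ` and
  -- `B_γ`.
  let N : Submodule ℝ L := C.rootSpan ⊓ (evalAt L X₀).ker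
  have hN : N = ⊥ := by
    by_contra hN
    obtain ⟨γ, x, y, hx, hy, h0, hv⟩ := exists_weightVector (M := L) hmax.lie_eq_zero hN (by
      rintro H x ⟨hx, hx'⟩
      refine ⟨C.lie_mem_rootSpan hL H hx, ?_⟩
      have hx' : ⁅x, X₀⁆ = 0 := hx'
      change ⁅⁅(H : L), x⁆, X₀⁆ = 0
      rw [lie_lie, hx', lie_zero, hHX₀, lie_zero, sub_zero])
    by_cases hγ : γ = 0
    · have h1 := (hL.isInvariantForm h₀).lie_weightVector hv Z
      simp only [hγ, LinearMap.zero_apply, Complex.zero_im, neg_zero, zero_smul] at h1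
      obtain ⟨V₁, hV₁⟩ := C.exists_lie_eq_of_mem_rootSpan hL hb hx.1
      obtain ⟨V₂, hV₂⟩ := C.exists_lie_eq_of_mem_rootSpan hL hb hy.1
      refine h0 ⟨?_, ?_⟩
      · rw [hV₁]
        exact hL.eq_zero_of_lie_lie (by rw [← hV₁]; exact h1.1)
      · rw [hV₂]
        exact hL.eq_zero_of_lie_lie (by rw [← hV₂]; exact h1.2)
    · have hr : IsRoot h₀ γ := ⟨hγ, isWeight_of_cpx hv h0⟩
      obtain ⟨h1, h2⟩ := C.mem_span_of_mem_weightSpace hL hmax hr hv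
      have hli := (C.linearIndependent_lie hL hUinv hr (hb γ hr) hZX₀).2 (hX γ hr).1
      rw [LinearIndependent.pair_iff] at hli
      have hz : ∀ x ∈ Submodule.span ℝ {C.A γ, C.B γ}, ⁅x, X₀⁆ = 0 → x = 0 := by
        intro x hx hx0
        obtain ⟨s, t, rfl⟩ := Submodule.mem_span_pair.1 hx
        rw [add_lie, smul_lie, smul_lie] at hx0
        obtain ⟨rfl, rfl⟩ := hli s t hx0
        simp
      exact h0 ⟨hz x h1 hx.2, hz y h2 hy.2⟩
  have hSN : S ∈ N := ⟨hS, hSX⟩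
  rw [hN, Submodule.mem_bot] at hSN
  rw [← hHS, hHz, hSN, add_zero]

end CompactChevalleyBasis

end SuperRegular

/-! ### Openness and density of the star condition -/

section DenseOpen

variable {L : Type*} [InnerLieAlgebra L] [FiniteDimensional ℝ L]
variable {U : Type*} [NormedAddCommGroup U] [InnerProductSpace ℝ U] [FiniteDimensional ℝ U]
  [LieRingModule L U] [LieModule ℝ L U] {h₀ : LieSubalgebra ℝ L}

theorem pow_toEnd_mem_weightSpace {α μ : CartanDual h₀} {e : ℂ ⊗[ℝ] L} {v : ℂ ⊗[ℝ] U}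
    (he : e ∈ weightSpace h₀ L α) (hv : v ∈ weightSpace h₀ U μ) (k : ℕ) :
    ((LieModule.toEnd ℂ (ℂ ⊗[ℝ] L) (ℂ ⊗[ℝ] U) e) ^ k) v ∈ weightSpace h₀ U (k • α + μ) := by
  induction k with
  | zero => simpa using hv
  | succ k ih =>
    rw [pow_succ', Module.End.mul_apply, succ_nsmul', add_assoc]
    exact lie_mem_weightSpace he ih

theorem imPart_injOn {Z : h₀} (hZ : SuperRegularElement U Z) {μ ν : CartanDual h₀}
    (hμ : IsWeight h₀ U μ) (hν : IsWeight h₀ U ν) (h : imPart μ Z = imPart ν Z) : μ = ν := by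
  rcases hZ.eq_or_eq_neg μ ν hμ hν (by rw [h]) with h' | h'
  · exact h'.symm
  · by_cases h0 : μ = 0
    · rw [h', h0, neg_zero]
    · rw [h', imPart_neg] at h
      exact absurd (by linarith) (hZ.imPart_ne_zero μ hμ h0)

/-- Evaluation at a super regular `Z` is injective on weights and takes values in the eigenvalues of
one endomorphism. -/
theorem SuperRegularElement.finite_setOf_isWeight {Z : h₀} (hZ : SuperRegularElement U Z) :
    {μ : CartanDual h₀ | IsWeight h₀ U μ}.Finite := by
  let f : Module.End ℂ (ℂ ⊗[ℝ] U) :=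
    LieModule.toEnd ℂ (ℂ ⊗[ℝ] L) (ℂ ⊗[ℝ] U) (toComplexCartan h₀ Z : ℂ ⊗[ℝ] L)
  have hfin : {c : ℂ | f.HasEigenvalue c}.Finite := Module.End.finite_hasEigenvalue f
  refine Set.Finite.of_finite_image (f := fun μ : CartanDual h₀ => μ (toComplexCartan h₀ Z))
    (hfin.subset ?_) ?_
  · rintro _ ⟨μ, hμ, rfl⟩
    obtain ⟨v, hv, hv0⟩ := Submodule.exists_mem_ne_zero_of_ne_bot hμ
    exact Module.End.hasEigenvalue_of_hasEigenvector
      ⟨Module.End.mem_eigenspace_iff.2 ((mem_weightSpace h₀ U μ v).1 hv _), hv0⟩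
  · intro μ hμ ν hν h
    exact imPart_injOn hZ hμ hν (congrArg Complex.im h)

/-- Taking real parts is real linear from `V` to `W`, and the second assumption makes it injective.
Applied to `V_β` and `U_β`, this gives `dim_ℝ U_β ≥ 4`. -/
theorem finrank_complexification_le {V : Submodule ℂ (ℂ ⊗[ℝ] U)} {W : Submodule ℝ U}
    (h1 : ∀ x y, cpx x y ∈ V → x ∈ W) (h2 : ∀ y, cpx 0 y ∈ V → y = 0) :
    2 * Module.finrank ℂ V ≤ Module.finrank ℝ W := by
  let r : ℂ ⊗[ℝ] U →ₗ[ℝ] U :=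
    (TensorProduct.lid ℝ U).toLinearMap ∘ₗ LinearMap.rTensor U Complex.reLm
  have hr : ∀ x y : U, r (cpx x y) = x := fun x y => by simp [r, cpx]
  let φ : V →ₗ[ℝ] W :=
    { toFun := fun v => ⟨r v, by
        obtain ⟨x, y, hv⟩ := exists_eq_cpx (v : ℂ ⊗[ℝ] U)
        rw [hv, hr]
        exact h1 x y (hv ▸ v.2)⟩
      map_add' := fun v w => Subtype.ext (map_add r _ _)
      map_smul' := fun c v => Subtype.ext (map_smul r c _) }
  have h3 := Module.finrank_mul_finrank ℝ ℂ V
  rw [Complex.finrank_real_complex] at h3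
  rw [h3]
  refine LinearMap.finrank_le_finrank_of_injective (f := φ) ?_
  rw [← LinearMap.ker_eq_bot, LinearMap.ker_eq_bot']
  intro v hv
  obtain ⟨x, y, hxy⟩ := exists_eq_cpx (v : ℂ ⊗[ℝ] U)
  have hx : r v = 0 := congrArg Subtype.val hv
  rw [hxy, hr] at hx
  subst hx
  have hy := h2 y (hxy ▸ v.2)
  exact Subtype.ext (by rw [hxy, hy, cpx_zero]; rfl)

/-- A dense open condition on the `U`-component is a dense open condition on `domainSet`. -/
theorem isDenseOpenIn_domainSet {Z : L} {O : Set U} (ho : IsOpen O) (hd : Dense O) :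
    IsDenseOpenIn {ξ : U × L | ξ ∈ domainSet U Z ∧ ξ.1 ∈ O} (domainSet U Z) := by
  refine ⟨fun ξ hξ => hξ.1, ?_, ?_⟩
  · have h1 : ((↑) ⁻¹' {ξ : U × L | ξ ∈ domainSet U Z ∧ ξ.1 ∈ O} : Set (domainSet U Z)) =
        (fun ξ : domainSet U Z => (ξ : U × L).1) ⁻¹' O := by
      ext ξ
      exact ⟨fun h => h.2, fun h => ⟨ξ.2, h⟩⟩
    rw [h1]
    exact ho.preimage (continuous_fst.comp continuous_subtype_val)
  · rw [Subtype.dense_iff, Subtype.image_preimage_coe]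
    rintro ⟨X, Y⟩ ⟨hX, hY⟩
    have hop : IsOpen {X : U | kerComponent Z X ≠ 0} :=
      isOpen_ne_fun (j U Z).ker.starProjection.continuous continuous_const
    have h2 : X ∈ closure ({X : U | kerComponent Z X ≠ 0} ∩ O) :=
      hd.open_subset_closure_inter hop hX
    refine map_mem_closure (f := fun X : U => (X, Y)) (by fun_prop) h2 ?_
    rintro X' ⟨h3, h4⟩
    exact ⟨⟨h3, hY⟩, ⟨h3, hY⟩, h4⟩

theorem dense_compl_of_ne_top {W : Submodule ℝ U} (h : W ≠ ⊤) : Dense ((W : Set U)ᶜ) := by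
  rw [← interior_eq_empty_iff_dense_compl]
  by_contra hne
  exact h (W.eq_top_of_nonempty_interior' (Set.nonempty_iff_ne_empty.2 hne))

namespace CompactChevalleyBasis

variable (C : CompactChevalleyBasis h₀)

/-- The root string through a vector of weight `β` passes through weight zero and continues below
it. Thus `X_{-β}` does not kill the zero weight space, and hence neither does `A_β`, since `A_β` and
`B_β` vanish on it together. -/
theorem exists_lie_A_ne_zero (hL : IsCompactSemisimple L)
    {β : CartanDual h₀} (h : IsRoot h₀ β)
    (hUinv : ∀ (Z : L) (x y : U), ⟪⁅Z, x⁆, y⟫_ℝ = -⟪x, ⁅Z, y⁆⟫_ℝ)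
    (hβ : IsWeight h₀ U β) {Z : h₀} (hb : imPart β Z ≠ 0) :
    ∃ u : U, ⁅(Z : L), u⁆ = 0 ∧ ⁅C.A β, u⁆ ≠ 0 := by
  by_contra! hcon
  have hconB : ∀ u : U, ⁅(Z : L), u⁆ = 0 → ⁅C.B β, u⁆ = 0 := by
    intro u hu
    have h1 := (C.lie_lie_A hL h hu).1
    rw [hcon u hu, lie_zero] at h1
    exact (smul_eq_zero.1 h1.symm).resolve_left hb
  have hB := isInvariantForm_inner h₀ hUinv
  obtain ⟨v, hv, hv0⟩ := Submodule.exists_mem_ne_zero_of_ne_bot hβ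
  have hτ : ⁅C.τ β, v⁆ = (2 : ℂ) • v := by
    have h1 := (mem_weightSpace_iff h₀ U).1 hv ⟨C.T β, C.T_mem β h⟩
    rw [hB.apply_eq hβ, C.imPart_T hL h] at h1
    have h2 : C.τ β = (-Complex.I) • cpx (C.T β) 0 := by
      rw [C.τ_eq_cpx h, smul_cpx, cpx_inj]
      simp
    have h1 : ⁅cpx (C.T β) 0, v⁆ = (((2 : ℝ) : ℂ) * Complex.I) • v := h1
    rw [h2, smul_lie_complexification, h1, smul_smul]
    congr 1
    push_cast
    linear_combination (-2) * Complex.I_mul_I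
  obtain ⟨n, P⟩ := exists_primitive (C.isSl2Triple hL h) hτ hv0
  have hp := pow_toEnd_mem_weightSpace (C.X_mem β h) hv n
  set p := ((LieModule.toEnd ℂ (ℂ ⊗[ℝ] L) (ℂ ⊗[ℝ] U) (C.X β)) ^ n) v with hpdef
  have hw := pow_toEnd_mem_weightSpace (C.X_mem (-β) (h.neg hL)) hp (n + 1)
  -- The top `p` of the string has `τ_β`-eigenvalue `2 + 2n`. After `n + 1` lowerings the weight is
  -- zero, and one further lowering is still nonzero because `n + 2 ≤ 2 + 2n`.
  have hne := P.pow_toEnd_f_ne_zero_of_eq_nat (n := 2 + 2 * n) (by push_cast; ring)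
    (i := n + 1 + 1) (by omega)
  rw [pow_succ', Module.End.mul_apply] at hne
  set w := ((LieModule.toEnd ℂ (ℂ ⊗[ℝ] L) (ℂ ⊗[ℝ] U) (C.X (-β))) ^ (n + 1)) p with hwdef
  have h0 : (n + 1) • (-β) + (n • β + β) = 0 := by rw [← succ_nsmul, smul_neg, neg_add_cancel]
  rw [h0] at hw
  obtain ⟨x, y, hxy⟩ := exists_eq_cpx w
  rw [hxy] at hw
  have h1 := hB.lie_weightVector hw Z
  simp only [LinearMap.zero_apply, Complex.zero_im, neg_zero, zero_smul] at h1
  refine hne ?_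
  change ⁅C.X (-β), w⁆ = 0
  rw [hxy, C.X_neg_eq h, lie_cpx]
  simp [hcon _ h1.1, hcon _ h1.2, hconB _ h1.1, hconB _ h1.2, cpx_zero]

/-- Recasts the star condition as linear independence of three vectors depending continuously on
`X`, from which openness is immediate. -/
theorem starAt_iff (hL : IsCompactSemisimple L)
    (hUinv : ∀ (Z : L) (x y : U), ⟪⁅Z, x⁆, y⟫_ℝ = -⟪x, ⁅Z, y⁆⟫_ℝ) {β : CartanDual h₀}
    (h : IsRoot h₀ β) {Z : h₀} (hb : imPart β Z ≠ 0) (X : U) :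
    C.StarAt (Z : L) β X ↔ LinearIndependent ℝ ![(realWeightSpace h₀ U β).starProjection X,
      ⁅C.A β, kerComponent (Z : L) X⁆, ⁅C.B β, kerComponent (Z : L) X⁆] := by
  have h1 := linearIndependent_finCons (K := ℝ)
    (x := (realWeightSpace h₀ U β).starProjection X)
    (v := ![⁅C.A β, kerComponent (Z : L) X⁆, ⁅C.B β, kerComponent (Z : L) X⁆])
  refine Iff.trans ?_ h1.symm
  rw [C.linearIndependent_lie hL hUinv h hb (lie_kerComponent _ _), StarAt]
  simp [Matrix.range_cons, Set.pair_comm]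

theorem isOpen_starAt (hL : IsCompactSemisimple L)
    (hUinv : ∀ (Z : L) (x y : U), ⟪⁅Z, x⁆, y⟫_ℝ = -⟪x, ⁅Z, y⁆⟫_ℝ) {β : CartanDual h₀}
    (h : IsRoot h₀ β) {Z : h₀} (hb : imPart β Z ≠ 0) :
    IsOpen {X : U | C.StarAt (Z : L) β X} := by
  have hc : Continuous fun X : U => ![(realWeightSpace h₀ U β).starProjection X,
      ⁅C.A β, kerComponent (Z : L) X⁆, ⁅C.B β, kerComponent (Z : L) X⁆] := by
    refine continuous_pi fun i => ?_
    have hk : Continuous fun X : U => kerComponent (Z : L) X :=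
      (j U (Z : L)).ker.starProjection.continuous
    fin_cases i
    · exact (realWeightSpace h₀ U β).starProjection.continuous
    · exact (j U (C.A β)).continuous.comp hk
    · exact (j U (C.B β)).continuous.comp hk
  have h1 := (isOpen_setOfPred_linearIndependent (𝕜 := ℝ) (E := U) (ι := Fin 3)).preimage hc
  convert h1 using 1
  ext X
  exact C.starAt_iff hL hUinv h hb X

theorem dense_starAt (hL : IsCompactSemisimple L)
    (hUinv : ∀ (Z : L) (x y : U), ⟪⁅Z, x⁆, y⟫_ℝ = -⟪x, ⁅Z, y⁆⟫_ℝ) {β : CartanDual h₀}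
    (h : IsRoot h₀ β) (hmult : 2 ≤ Module.finrank ℂ (weightSpace h₀ U β)) {Z : h₀}
    (hb : imPart β Z ≠ 0) : Dense {X : U | C.StarAt (Z : L) β X} := by
  set π := (realWeightSpace h₀ U β).starProjection with hπ
  obtain ⟨u, hu, hAu⟩ := C.exists_lie_A_ne_zero hL h hUinv (isWeight_of_finrank hmult) hb
  let W : Submodule ℝ U := ((j U (C.A β)).comp (j U (Z : L)).ker.starProjection).ker
  have hW : W ≠ ⊤ := by
    intro hW
    have h1 : u ∈ W := by rw [hW]; trivial
    have h2 : ⁅C.A β, kerComponent (Z : L) u⁆ = 0 := h1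
    rw [kerComponent_eq_self hu] at h2
    exact hAu h2
  -- Density in two stages: vectors with `A_β X₀ ≠ 0` are dense, and each of them is a limit of
  -- vectors satisfying the whole condition.
  refine Dense.of_closure ((dense_compl_of_ne_top hW).mono ?_)
  intro X hX
  have hX : ⁅C.A β, kerComponent (Z : L) X⁆ ≠ 0 := hX
  set D := Submodule.span ℝ {⁅C.A β, kerComponent (Z : L) X⁆, ⁅C.B β, kerComponent (Z : L) X⁆}
    with hD
  by_cases hXD : π X ∈ D
  swap
  · exact subset_closure ⟨hX, hXD⟩
  obtain ⟨v, hv, hvD⟩ : ∃ v ∈ realWeightSpace h₀ U β, v ∉ D := by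
    by_contra! hcon
    have h1 : realWeightSpace h₀ U β ≤ D := hcon
    have h2 : Module.finrank ℝ D ≤ 2 := by
      have := finrank_range_le_card (R := ℝ)
        (b := ![⁅C.A β, kerComponent (Z : L) X⁆, ⁅C.B β, kerComponent (Z : L) X⁆])
      have hr : Set.range ![⁅C.A β, kerComponent (Z : L) X⁆, ⁅C.B β, kerComponent (Z : L) X⁆] =
          {⁅C.A β, kerComponent (Z : L) X⁆, ⁅C.B β, kerComponent (Z : L) X⁆} := by
        simp [Matrix.range_cons, Set.pair_comm]
      rwa [hr] at this
    have h3 := Submodule.finrank_mono h1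
    have h4 : 2 * Module.finrank ℂ (weightSpace h₀ U β) ≤
        Module.finrank ℝ (realWeightSpace h₀ U β) :=
      finrank_complexification_le (fun x y hxy => (mem_realWeightSpace_of_cpx_mem hUinv hxy).1)
        (fun y hy => by
          have h5 := ((isInvariantForm_inner h₀ hUinv).lie_weightVector hy Z).1
          rw [lie_zero] at h5
          exact (smul_eq_zero.1 h5.symm).resolve_left (neg_ne_zero.2 hb))
    omega
  -- `U_β` lies in the image of `j(Z)`, so moving `X` along `v` changes `X_β` but neither `X₀` nor
  -- the plane `D`.
  have hv0 : kerComponent (Z : L) v = 0 := by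
    have h1 : v = ⁅(Z : L), -((imPart β Z ^ 2)⁻¹ • ⁅(Z : L), v⁆)⁆ := by
      rw [lie_neg, lie_smul, lie_lie_of_mem_realWeightSpace hUinv hv, smul_neg, neg_neg,
        smul_smul, inv_mul_cancel₀ (pow_ne_zero 2 hb), one_smul]
    rw [h1]
    exact kerComponent_lie hUinv _ _
  have hk : ∀ t : ℝ, kerComponent (Z : L) (X + t • v) = kerComponent (Z : L) X := by
    intro t
    have : kerComponent (Z : L) (X + t • v) =
        kerComponent (Z : L) X + t • kerComponent (Z : L) v := by
      simp [kerComponent]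
    rw [this, hv0, smul_zero, add_zero]
  have hlim : Filter.Tendsto (fun t : ℝ => X + t • v) (nhdsWithin 0 {0}ᶜ) (nhds X) := by
    have hc : Continuous fun t : ℝ => X + t • v := by fun_prop
    have := hc.tendsto 0
    rw [zero_smul, add_zero] at this
    exact this.mono_left nhdsWithin_le_nhds
  refine mem_closure_of_tendsto hlim ?_
  filter_upwards [self_mem_nhdsWithin] with t ht
  have ht : t ≠ 0 := ht
  refine ⟨by rwa [hk], ?_⟩
  rw [hk, ← hπ, ← hD, map_add, map_smul, hπ, Submodule.starProjection_eq_self_iff.2 hv, ← hπ]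
  intro hmem
  have h1 : t • v ∈ D := by
    have := Submodule.sub_mem _ hmem hXD
    rwa [add_sub_cancel_left] at this
  refine hvD ?_
  have := Submodule.smul_mem _ t⁻¹ h1
  rwa [smul_smul, inv_mul_cancel₀ ht, one_smul] at this

theorem isOpen_dense_forall_starAt (hL : IsCompactSemisimple L)
    (hUinv : ∀ (Z : L) (x y : U), ⟪⁅Z, x⁆, y⟫_ℝ = -⟪x, ⁅Z, y⁆⟫_ℝ)
    (hmult : ∀ β : CartanDual h₀, IsRoot h₀ β → 2 ≤ Module.finrank ℂ (weightSpace h₀ U β))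
    {Z : h₀} (hZ : SuperRegularElement U Z) :
    IsOpen {X : U | ∀ β, IsRoot h₀ β → C.StarAt (Z : L) β X} ∧
      Dense {X : U | ∀ β, IsRoot h₀ β → C.StarAt (Z : L) β X} := by
  have hw : ∀ β, IsRoot h₀ β → IsWeight h₀ U β := fun β h => isWeight_of_finrank (hmult β h)
  have hb : ∀ β, IsRoot h₀ β → imPart β Z ≠ 0 := fun β h => hZ.imPart_ne_zero β (hw β h) h.1
  have hfin : {β : CartanDual h₀ | IsRoot h₀ β}.Finite := hZ.finite_setOf_isWeight.subset hw
  have heq : {X : U | ∀ β, IsRoot h₀ β → C.StarAt (Z : L) β X} =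
      ⋂ β ∈ {β : CartanDual h₀ | IsRoot h₀ β}, {X : U | C.StarAt (Z : L) β X} := by
    ext X
    simp
  rw [heq]
  refine ⟨hfin.isOpen_biInter fun β h => C.isOpen_starAt hL hUinv h (hb β h), ?_⟩
  exact dense_biInter_of_isOpen (fun β h => C.isOpen_starAt hL hUinv h (hb β h)) hfin.countable
    (fun β h => C.dense_starAt hL hUinv h (hmult β h) (hb β h))

end CompactChevalleyBasis

end DenseOpen

/-! ### Equivariance under the group action -/

section Equivariance

variable {L : Type*} [InnerLieAlgebra L] [FiniteDimensional ℝ L]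
variable {U : Type*} [NormedAddCommGroup U] [InnerProductSpace ℝ U] [FiniteDimensional ℝ U]
  [LieRingModule L U] [LieModule ℝ L U] {h₀ : LieSubalgebra ℝ L}

/-- The bracket of the two flows solves, by the Leibniz rule, the same linear equation as the flow
of the bracket. -/
theorem exp_j_lie (Y W : L) (u : U) :
    NormedSpace.exp (j U Y) ⁅W, u⁆ = ⁅NormedSpace.exp (j L Y) W, NormedSpace.exp (j U Y) u⁆ := by
  let b : L →L[ℝ] U →L[ℝ] U :=
    LinearMap.toContinuousBilinearMap (LinearMap.mk₂ ℝ (fun (W : L) (u : U) => ⁅W, u⁆)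
      add_lie smul_lie lie_add (fun c W u => lie_smul c W u))
  have hb : ∀ W u, b W u = ⁅W, u⁆ := fun _ _ => rfl
  have h := eq_exp_smul_apply (A := j U Y)
    (y := fun t : ℝ => b (NormedSpace.exp (t • j L Y) W) (NormedSpace.exp (t • j U Y) u))
    (fun t => by
      have h1 := (b.hasFDerivAt (x := NormedSpace.exp (t • j L Y) W)).comp_hasDerivAt t
        (hasDerivAt_exp_smul_apply (j L Y) W t)
      refine (h1.clm_apply (hasDerivAt_exp_smul_apply (j U Y) u t)).congr_deriv ?_
      simp only [Function.comp_apply, hb, j_apply]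
      rw [← leibniz_lie Y]) 1
  simp only [one_smul, zero_smul, NormedSpace.exp_zero, hb] at h
  exact h.symm

theorem lie_groupAction {g : (U →L[ℝ] U) × (L →L[ℝ] L)} (hg : g ∈ groupAction L U) (Y : L)
    (u : U) : g.1 ⁅Y, u⁆ = ⁅g.2 Y, g.1 u⁆ := by
  induction hg using Submonoid.closure_induction generalizing Y u with
  | mem g hg =>
    obtain ⟨V, rfl⟩ := hg
    exact exp_j_lie V Y u
  | one => rfl
  | mul g g' _ _ h h' =>
    change g.1 (g'.1 _) = ⁅g.2 (g'.2 Y), g.1 (g'.1 u)⁆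
    rw [h', h]

theorem lie_groupAction_self {g : (U →L[ℝ] U) × (L →L[ℝ] L)} (hg : g ∈ groupAction L U)
    (Y W : L) : g.2 ⁅Y, W⁆ = ⁅g.2 Y, g.2 W⁆ := by
  induction hg using Submonoid.closure_induction generalizing Y W with
  | mem g hg =>
    obtain ⟨V, rfl⟩ := hg
    exact exp_j_lie V Y W
  | one => rfl
  | mul g g' _ _ h h' =>
    change g.2 (g'.2 _) = ⁅g.2 (g'.2 Y), g.2 (g'.2 W)⁆
    rw [h', h]

theorem inner_groupAction (hUinv : ∀ (Z : L) (x y : U), ⟪⁅Z, x⁆, y⟫_ℝ = -⟪x, ⁅Z, y⁆⟫_ℝ)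
    {g : (U →L[ℝ] U) × (L →L[ℝ] L)} (hg : g ∈ groupAction L U) (x y : U) :
    ⟪g.1 x, g.1 y⟫_ℝ = ⟪x, y⟫_ℝ := by
  induction hg using Submonoid.closure_induction generalizing x y with
  | mem g hg =>
    obtain ⟨V, rfl⟩ := hg
    have := IsSkew.inner_exp (A := j U V) (hUinv V) 1 x y
    rwa [one_smul] at this
  | one => rfl
  | mul g g' _ _ h h' =>
    change ⟪g.1 (g'.1 x), g.1 (g'.1 y)⟫_ℝ = _
    rw [h, h']

theorem j_neg (Z : L) : j U (-Z) = -j U Z := by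
  ext x
  simp [j_apply]

theorem exists_inverse_groupAction {g : (U →L[ℝ] U) × (L →L[ℝ] L)} (hg : g ∈ groupAction L U) :
    ∃ g' ∈ groupAction L U, g * g' = 1 ∧ g' * g = 1 := by
  induction hg using Submonoid.closure_induction with
  | mem g hg =>
    obtain ⟨V, rfl⟩ := hg
    refine ⟨_, Submonoid.subset_closure ⟨-V, rfl⟩, ?_, ?_⟩
    · simp only [j_neg]
      exact Prod.ext (exp_mul_exp_neg _) (exp_mul_exp_neg _)
    · simp only [j_neg]
      exact Prod.ext (exp_neg_mul_exp _) (exp_neg_mul_exp _)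
  | one => exact ⟨1, Submonoid.one_mem _, one_mul 1, one_mul 1⟩
  | mul g k _ _ h h' =>
    obtain ⟨g', hg', h1, h2⟩ := h
    obtain ⟨k', hk', h3, h4⟩ := h'
    refine ⟨k' * g', Submonoid.mul_mem _ hk' hg', ?_, ?_⟩
    · rw [mul_assoc, ← mul_assoc k, h3, one_mul, h1]
    · rw [mul_assoc, ← mul_assoc g', h2, one_mul, h4]

theorem apply_of_mul_eq_one {g g' : (U →L[ℝ] U) × (L →L[ℝ] L)} (h : g * g' = 1) :
    (∀ x, g.1 (g'.1 x) = x) ∧ ∀ Y, g.2 (g'.2 Y) = Y :=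
  ⟨fun x => congrArg (fun k : (U →L[ℝ] U) × (L →L[ℝ] L) => k.1 x) h,
    fun Y => congrArg (fun k : (U →L[ℝ] U) × (L →L[ℝ] L) => k.2 Y) h⟩

theorem injective_groupAction {g : (U →L[ℝ] U) × (L →L[ℝ] L)} (hg : g ∈ groupAction L U) :
    Function.Injective g.1 ∧ Function.Injective g.2 := by
  obtain ⟨g', -, -, h⟩ := exists_inverse_groupAction hg
  obtain ⟨h1, h2⟩ := apply_of_mul_eq_one h
  exact ⟨Function.LeftInverse.injective h1, Function.LeftInverse.injective h2⟩

/-- `ρ(g)` is orthogonal and carries `ker j(Z)` onto `ker j(Ad(g) Z)`, so it commutes with the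
orthogonal projections. -/
theorem kerComponent_groupAction
    (hUinv : ∀ (Z : L) (x y : U), ⟪⁅Z, x⁆, y⟫_ℝ = -⟪x, ⁅Z, y⁆⟫_ℝ)
    {g : (U →L[ℝ] U) × (L →L[ℝ] L)} (hg : g ∈ groupAction L U) (Z : L) (X : U) :
    kerComponent (g.2 Z) (g.1 X) = g.1 (kerComponent Z X) := by
  obtain ⟨g', hg', h1, h2⟩ := exists_inverse_groupAction hg
  refine Submodule.eq_starProjection_of_mem_of_inner_eq_zero ?_ ?_
  · change ⁅g.2 Z, g.1 (kerComponent Z X)⁆ = 0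
    rw [← lie_groupAction hg, lie_kerComponent, map_zero]
  · intro w hw
    have hw : ⁅g.2 Z, w⁆ = 0 := hw
    have hw' : ⁅Z, g'.1 w⁆ = 0 := by
      have := lie_groupAction hg' (g.2 Z) w
      rw [hw, map_zero, (apply_of_mul_eq_one h2).2] at this
      exact this.symm
    rw [← (apply_of_mul_eq_one h1).1 w, ← map_sub, inner_groupAction hUinv hg]
    exact Submodule.starProjection_inner_eq_zero (K := (j U Z).ker) X _ hw'

/-- Nondegeneracy is purely algebraic, so transporting it makes it unnecessary to compare the first
hit maps of `Z` and `Ad(g) Z` themselves. -/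
theorem NondegenerateAt.of_groupAction
    (hUinv : ∀ (Z : L) (x y : U), ⟪⁅Z, x⁆, y⟫_ℝ = -⟪x, ⁅Z, y⁆⟫_ℝ)
    {g : (U →L[ℝ] U) × (L →L[ℝ] L)} (hg : g ∈ groupAction L U) {Z : L} {X : U}
    (h : NondegenerateAt (g.2 Z) (g.1 X)) : NondegenerateAt Z X := by
  intro Y Y' W hY' hY hX
  refine (injective_groupAction hg).2 ?_
  rw [map_zero]
  refine h (g.2 Y) (g.2 Y') (g.2 W) ?_ ?_ ?_
  · rw [← lie_groupAction_self hg, hY', map_zero]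
  · rw [← lie_groupAction_self hg, ← map_add, ← hY]
  · rw [kerComponent_groupAction hUinv hg, ← lie_groupAction hg, ← lie_groupAction hg, ← map_sub,
      ← lie_groupAction hg, hX, map_zero]

theorem exp_eq_one_of_groupAction {g : (U →L[ℝ] U) × (L →L[ℝ] L)} (hg : g ∈ groupAction L U)
    {Z : L} {t : ℝ} (h : NormedSpace.exp (t • j U (g.2 Z)) = 1) :
    NormedSpace.exp (t • j U Z) = 1 := by
  refine ContinuousLinearMap.ext fun x => (injective_groupAction hg).1 ?_
  rw [map_exp_of_intertwine (B := j U (g.2 Z)) g.1 (fun x => lie_groupAction hg Z x), h]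
  rfl

end Equivariance

/-! ### Super regularity is invariant under conjugation -/

section Invariance

variable {L : Type*} [InnerLieAlgebra L] [FiniteDimensional ℝ L]
variable {U : Type*} [NormedAddCommGroup U] [InnerProductSpace ℝ U] [FiniteDimensional ℝ U]
  [LieRingModule L U] [LieModule ℝ L U] {h₀ : LieSubalgebra ℝ L}

/-- Describes the values `-μ(Z)²` through the spectrum of `j(Z)²`, which is unchanged by conjugation
even though individual weights are not tracked. -/
theorem exists_weight_sq_eq_iff (hmax : IsMaximalAbelian h₀)
    (hUinv : ∀ (Z : L) (x y : U), ⟪⁅Z, x⁆, y⟫_ℝ = -⟪x, ⁅Z, y⁆⟫_ℝ) (Z : h₀) (s : ℝ) :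
    (∃ μ : CartanDual h₀, IsWeight h₀ U μ ∧ imPart μ Z ^ 2 = s) ↔
      ∃ u : U, u ≠ 0 ∧ ⁅(Z : L), ⁅(Z : L), u⁆⁆ = -(s • u) := by
  constructor
  · rintro ⟨μ, hμ, rfl⟩
    obtain ⟨x, y, h0, hv⟩ := hμ.exists_cpx
    obtain ⟨hx, hy⟩ := mem_realWeightSpace_of_cpx_mem hUinv hv
    by_cases hx0 : x = 0
    · exact ⟨y, fun hy0 => h0 ⟨hx0, hy0⟩, lie_lie_of_mem_realWeightSpace hUinv hy Z⟩
    · exact ⟨x, hx0, lie_lie_of_mem_realWeightSpace hUinv hx Z⟩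
  · rintro ⟨u, hu0, hu⟩
    let W : Submodule ℝ U := ((j U (Z : L)).comp (j U (Z : L)) + s • ContinuousLinearMap.id ℝ U).ker
    have hW : ∀ x, x ∈ W ↔ ⁅(Z : L), ⁅(Z : L), x⁆⁆ = -(s • x) := fun x => by
      rw [← add_eq_zero_iff_eq_neg]
      rfl
    have hcomm : ∀ (H : h₀) (x : U), ⁅(Z : L), ⁅(H : L), x⁆⁆ = ⁅(H : L), ⁅(Z : L), x⁆⁆ := by
      intro H x
      rw [leibniz_lie, hmax.lie_eq_zero, zero_lie, zero_add]
    obtain ⟨μ, x, y, hx, hy, h0, hv⟩ := exists_weightVector (W := W) hmax.lie_eq_zero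
      (fun h => hu0 (by rw [← Submodule.mem_bot ℝ, ← h, hW, hu])) (by
        intro H x hx
        rw [hW] at hx ⊢
        rw [hcomm H x, hcomm, hx, lie_neg, lie_smul])
    refine ⟨μ, isWeight_of_cpx hv h0, ?_⟩
    obtain ⟨hx', hy'⟩ := mem_realWeightSpace_of_cpx_mem hUinv hv
    have key : ∀ z ∈ W, z ∈ realWeightSpace h₀ U μ → z ≠ 0 → imPart μ Z ^ 2 = s := by
      intro z hz hz' hz0
      rw [hW, lie_lie_of_mem_realWeightSpace hUinv hz' Z, neg_inj] at hz
      exact smul_left_injective ℝ hz0 hz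
    by_cases hx0 : x = 0
    · exact key y hy hy' fun hy0 => h0 ⟨hx0, hy0⟩
    · exact key x hx hx' hx0

/-- A counting argument, which avoids the Weyl group. The finite set of squared weight values is the
same for `Z` and `Z'`. Sending the value of `μ` at `Z` to its value at `Z'` is well defined by super
regularity of `Z`, and it is surjective, hence injective. Injectivity is the separation property for
`Z'`. -/
theorem SuperRegularElement.of_groupAction (hmax : IsMaximalAbelian h₀)
    (hUinv : ∀ (Z : L) (x y : U), ⟪⁅Z, x⁆, y⟫_ℝ = -⟪x, ⁅Z, y⁆⟫_ℝ)
    {g : (U →L[ℝ] U) × (L →L[ℝ] L)} (hg : g ∈ groupAction L U) {Z Z' : h₀}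
    (hZ : SuperRegularElement U Z) (h : g.2 Z = Z') : SuperRegularElement U Z' := by
  have hE : ∀ s : ℝ, (∃ μ : CartanDual h₀, IsWeight h₀ U μ ∧ imPart μ Z ^ 2 = s) ↔
      ∃ μ : CartanDual h₀, IsWeight h₀ U μ ∧ imPart μ Z' ^ 2 = s := by
    intro s
    rw [exists_weight_sq_eq_iff hmax hUinv, exists_weight_sq_eq_iff hmax hUinv]
    obtain ⟨g', hg', h1, h2⟩ := exists_inverse_groupAction hg
    have h' : g'.2 Z' = Z := by rw [← h, (apply_of_mul_eq_one h2).2]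
    constructor
    · rintro ⟨u, hu0, hu⟩
      refine ⟨g.1 u, fun h0 => hu0 ((injective_groupAction hg).1 (by rw [h0, map_zero])), ?_⟩
      rw [← h, ← lie_groupAction hg, ← lie_groupAction hg, hu, map_neg, map_smul]
    · rintro ⟨u, hu0, hu⟩
      refine ⟨g'.1 u, fun h0 => hu0 ((injective_groupAction hg').1 (by rw [h0, map_zero])), ?_⟩
      rw [← h', ← lie_groupAction hg', ← lie_groupAction hg', hu, map_neg, map_smul]
  let E := {s : ℝ // ∃ μ : CartanDual h₀, IsWeight h₀ U μ ∧ imPart μ Z ^ 2 = s}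
  have : Finite E := by
    refine Set.Finite.subset (hZ.finite_setOf_isWeight.image fun μ => imPart μ Z ^ 2) ?_
    rintro s ⟨μ, hμ, rfl⟩
    exact ⟨μ, hμ, rfl⟩
  let φ : E → E := fun s => ⟨imPart s.2.choose Z' ^ 2,
    (hE _).2 ⟨s.2.choose, s.2.choose_spec.1, rfl⟩⟩
  have hφ : ∀ (s : E) (μ : CartanDual h₀), IsWeight h₀ U μ → imPart μ Z ^ 2 = s →
      (φ s : ℝ) = imPart μ Z' ^ 2 := by
    intro s μ hμ hs
    change imPart s.2.choose Z' ^ 2 = _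
    rcases hZ.eq_or_eq_neg _ _ hμ s.2.choose_spec.1 (hs.trans s.2.choose_spec.2.symm) with h' | h'
    · rw [h']
    · rw [h', imPart_neg, neg_sq]
  have hsurj : Function.Surjective φ := by
    rintro ⟨s, hs⟩
    obtain ⟨μ, hμ, rfl⟩ := (hE s).1 hs
    exact ⟨⟨imPart μ Z ^ 2, μ, hμ, rfl⟩, Subtype.ext (hφ _ μ hμ rfl)⟩
  have hinj := Finite.injective_iff_surjective.2 hsurj
  have h2 : ∀ μ ν : CartanDual h₀, IsWeight h₀ U μ → IsWeight h₀ U ν →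
      imPart μ Z' ^ 2 = imPart ν Z' ^ 2 → ν = μ ∨ ν = -μ := by
    intro μ ν hμ hν hμν
    have h3 : φ ⟨imPart μ Z ^ 2, μ, hμ, rfl⟩ = φ ⟨imPart ν Z ^ 2, ν, hν, rfl⟩ :=
      Subtype.ext (by rw [hφ _ μ hμ rfl, hφ _ ν hν rfl, hμν])
    exact hZ.eq_or_eq_neg μ ν hμ hν (congrArg Subtype.val (hinj h3))
  refine ⟨fun μ hμ h0 hμ0 => ?_, h2⟩
  -- If `μ` vanishes at `Z'`, then `0` is also a value at `Z`, so the zero functional is a weight.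
  -- The separation property for `Z'` then identifies `μ` with it.
  obtain ⟨ν, hν, hν0⟩ := (hE 0).2 ⟨μ, hμ, by rw [hμ0]; norm_num⟩
  have hν' : ν = 0 := by
    by_contra hne
    exact hZ.imPart_ne_zero ν hν hne (pow_eq_zero_iff two_ne_zero |>.1 hν0)
  subst hν'
  have h00 : imPart (0 : CartanDual h₀) Z' = 0 := by simp [imPart]
  rcases h2 0 μ hν hμ (by rw [hμ0, h00]) with h3 | h3
  · exact h0 h3
  · exact h0 (by rw [h3, neg_zero])

end Invariance

/-! ### Rational spans -/

section RatSpan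

theorem smul_mem_ratSpan {E : Type*} [AddCommGroup E] [Module ℝ E] {S : Set E} {v : E}
    (hv : v ∈ ratSpan S) (q : ℚ) : (q : ℝ) • v ∈ ratSpan S := by
  induction hv using AddSubgroup.closure_induction with
  | mem v hv =>
    obtain ⟨r, s, hs, rfl⟩ := hv
    exact AddSubgroup.subset_closure ⟨q * r, s, hs, by rw [smul_smul]; push_cast; rfl⟩
  | zero =>
    rw [smul_zero]
    exact AddSubgroup.zero_mem _
  | add v w _ _ hv hw =>
    rw [smul_add]
    exact AddSubgroup.add_mem _ hv hw
  | neg v _ hv =>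
    rw [smul_neg]
    exact AddSubgroup.neg_mem _ hv

/-- An injective linear map preserving the rational span of a finite set is onto on it. -/
theorem exists_mem_ratSpan_of_injective {E : Type*} [AddCommGroup E] [Module ℝ E] {S : Set E}
    (hS : S.Finite) {f : E →ₗ[ℝ] E} (hf : Function.Injective f)
    (hfS : ∀ v ∈ ratSpan S, f v ∈ ratSpan S) {v : E} (hv : v ∈ ratSpan S) :
    ∃ w ∈ ratSpan S, f w = v := by
  let _ : Module ℚ E := Module.compHom E (algebraMap ℚ ℝ)
  have hsmul : ∀ (q : ℚ) (x : E), q • x = (q : ℝ) • x := fun q x => by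
    change algebraMap ℚ ℝ q • x = _
    rw [eq_ratCast]
  let R : Submodule ℚ E :=
    { ratSpan S with
      smul_mem' := fun q x hx => by
        rw [hsmul]
        exact smul_mem_ratSpan hx q }
  have hR : R ≤ Submodule.span ℚ S := by
    intro x hx
    have hx : x ∈ ratSpan S := hx
    have hle : ratSpan S ≤ (Submodule.span ℚ S).toAddSubgroup := by
      refine (AddSubgroup.closure_le _).2 ?_
      rintro _ ⟨q, s, hs, rfl⟩
      rw [← hsmul]
      exact Submodule.smul_mem _ _ (Submodule.subset_span hs)
    exact hle hx
  have : FiniteDimensional ℚ (Submodule.span ℚ S) := FiniteDimensional.span_of_finite ℚ hS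
  have : FiniteDimensional ℚ R := Submodule.finiteDimensional_of_le hR
  let F : R →ₗ[ℚ] R :=
    { toFun := fun x => ⟨f x, hfS x x.2⟩
      map_add' := fun x y => Subtype.ext (map_add f _ _)
      map_smul' := fun q x => Subtype.ext (by
        change f (q • (x : E)) = q • f x
        rw [hsmul, hsmul, map_smul]) }
  have hF : Function.Injective F := fun x y hxy =>
    Subtype.ext (hf (congrArg Subtype.val hxy))
  obtain ⟨w, hw⟩ := LinearMap.injective_iff_surjective.1 hF ⟨v, hv⟩
  exact ⟨w, w.2, congrArg Subtype.val hw⟩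

end RatSpan

/-! ### Conjugation into the Cartan subalgebra and conclusion -/

section Assembly

variable {L : Type*} [InnerLieAlgebra L] [FiniteDimensional ℝ L]
variable {U : Type*} [NormedAddCommGroup U] [InnerProductSpace ℝ U] [FiniteDimensional ℝ U]
  [LieRingModule L U] [LieModule ℝ L U] {h₀ : LieSubalgebra ℝ L}

/-- Only inclusion of the rational span is required of `ρ(g)`. It is automatically onto that finite
dimensional rational space, being injective, so the inverse preserves the span as well. -/
theorem exists_inverse_rationalGroup {ι : Type*} {ℬ : Module.Basis ι ℝ U}
    {g : (U →L[ℝ] U) × (L →L[ℝ] L)} (hg : g ∈ rationalGroup L ℬ) :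
    ∃ g' ∈ rationalGroup L ℬ, g * g' = 1 ∧ g' * g = 1 := by
  obtain ⟨g', hg', h1, h2⟩ := exists_inverse_groupAction hg.1
  refine ⟨g', ⟨hg', fun v hv => ?_⟩, h1, h2⟩
  have : Finite ι := Module.Finite.finite_basis ℬ
  obtain ⟨w, hw, hwv⟩ := exists_mem_ratSpan_of_injective (f := g.1.toLinearMap)
    (Set.finite_range ℬ) (injective_groupAction hg.1).1 hg.2 hv
  have hwv : g.1 w = v := hwv
  rwa [← hwv, (apply_of_mul_eq_one h2).1]

namespace CompactChevalleyBasis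

variable (C : CompactChevalleyBasis h₀)

theorem exists_isRoot (C : CompactChevalleyBasis h₀) (hL : IsCompactSemisimple L) (hmax : IsMaximalAbelian h₀) {Y : L}
    (hY : Y ≠ 0) : ∃ β, IsRoot h₀ β := by
  by_contra! hcon
  have h1 : C.rootSpan = ⊥ := by
    rw [rootSpan, Submodule.span_eq_bot]
    rintro c ⟨β, h, -⟩
    exact absurd h (hcon β)
  have h2 : Y ∈ h₀.toSubmodule ⊔ C.rootSpan := by
    rw [C.sup_rootSpan hL hmax]
    trivial
  rw [h1, sup_bot_eq] at h2
  exact hY (C.eq_zero_of_imPart_eq_zero (H := ⟨Y, h2⟩) hL hmax fun β h => absurd h (hcon β))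

/-- Needed because `j(Z) = 0` would make every positive number a period, with no least one. If `U ≠
0`, then `L ≠ 0` by the absence of a common kernel, so there is a root; being a nonzero weight of
`U`, it does not vanish at `Z`. -/
theorem j_ne_zero (C : CompactChevalleyBasis h₀) (hL : IsCompactSemisimple L) (hmax : IsMaximalAbelian h₀)
    (hUinv : ∀ (Z : L) (x y : U), ⟪⁅Z, x⁆, y⟫_ℝ = -⟪x, ⁅Z, y⁆⟫_ℝ)
    (hker : ∀ u : U, (∀ Z : L, ⁅Z, u⁆ = 0) → u = 0)
    (hw : ∀ β : CartanDual h₀, IsRoot h₀ β → IsWeight h₀ U β) {Z : h₀}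
    (hZ : SuperRegularElement U Z) {u : U} (hu : u ≠ 0) : j U (Z : L) ≠ 0 := by
  intro h0
  obtain ⟨Y, hY⟩ : ∃ Y : L, Y ≠ 0 := by
    by_contra! hcon
    exact hu (hker u fun Z => by rw [hcon Z, zero_lie])
  obtain ⟨β, h⟩ := C.exists_isRoot hL hmax hY
  obtain ⟨x, hx0, hx⟩ := (exists_weight_sq_eq_iff hmax hUinv Z (imPart β Z ^ 2)).1
    ⟨β, hw β h, rfl⟩
  have h1 : ⁅(Z : L), ⁅(Z : L), x⁆⁆ = 0 := congrArg (fun f : U →L[ℝ] U => f ⁅(Z : L), x⁆) h0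
  rw [h1] at hx
  exact smul_ne_zero (pow_ne_zero 2 (hZ.imPart_ne_zero β (hw β h) h.1)) hx0
    (neg_eq_zero.1 hx.symm)

/-- Covers both parts of the theorem, the first being the case `g = 1`. The weights are used only at
`Ad(g) Z`, and the conclusions are pulled back to `Z`. -/
theorem firstHit_conjugate (hL : IsCompactSemisimple L) (hmax : IsMaximalAbelian h₀)
    (hUinv : ∀ (Z : L) (x y : U), ⟪⁅Z, x⁆, y⟫_ℝ = -⟪x, ⁅Z, y⁆⟫_ℝ)
    (hker : ∀ u : U, (∀ Z : L, ⁅Z, u⁆ = 0) → u = 0)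
    (hmult : ∀ β : CartanDual h₀, IsRoot h₀ β → 2 ≤ Module.finrank ℂ (weightSpace h₀ U β))
    {g : (U →L[ℝ] U) × (L →L[ℝ] L)} (hg : g ∈ groupAction L U) {Z : L} (hQ : g.2 Z ∈ C.hQ)
    (hs : IsSuperRegularIn h₀ U (g.2 Z)) :
    FirstHitWellDefined U Z ∧ IsDenseOpenIn (starSetAt C g Z) (domainSet U Z) ∧
      FirstHitMaximalRankOn Z (starSetAt C g Z) := by
  obtain ⟨hH, hZ⟩ := (isSuperRegularIn_iff hUinv).1 hs
  have hw : ∀ β, IsRoot h₀ β → IsWeight h₀ U β := fun β h => isWeight_of_finrank (hmult β h)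
  have hj : ∀ ξ ∈ domainSet U Z, j U Z ≠ 0 := by
    rintro ξ ⟨hξ, -⟩ h0
    refine C.j_ne_zero hL hmax hUinv hker hw hZ hξ (ContinuousLinearMap.ext fun x => ?_)
    obtain ⟨g', -, h1, -⟩ := exists_inverse_groupAction hg
    change ⁅g.2 Z, x⁆ = 0
    rw [← (apply_of_mul_eq_one h1).1 x, ← lie_groupAction hg, ← j_apply, h0]
    exact map_zero g.1
  have hω : ∀ ξ ∈ domainSet U Z, ∃ ω, IsLeast (periods U Z) ω := by
    intro ξ hξ
    obtain ⟨-, N, hN, hexp⟩ := C.exists_period hL hmax hUinv hQ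
    rw [smul_smul] at hexp
    have hN : (0 : ℝ) < N := by exact_mod_cast hN
    exact IsSkew.exists_isLeast_period (J := j U Z) (hUinv Z) (hj ξ hξ)
      (ω := N * (2 * Real.pi)) (by positivity) (exp_eq_one_of_groupAction hg hexp)
  refine ⟨fun ξ hξ => ?_, ?_, ?_⟩
  · obtain ⟨ω, h⟩ := hω ξ hξ
    exact firstHitWellDefined hUinv h ξ hξ
  · obtain ⟨ho, hd⟩ := C.isOpen_dense_forall_starAt hL hUinv hmult hZ
    obtain ⟨g', -, h1, h2⟩ := exists_inverse_groupAction hg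
    let e : U ≃L[ℝ] U := ContinuousLinearEquiv.equivOfInverse g.1 g'.1
      (apply_of_mul_eq_one h2).1 (apply_of_mul_eq_one h1).1
    have h3 := isDenseOpenIn_domainSet (Z := Z) (ho.preimage e.continuous)
      (hd.preimage e.toHomeomorph.isOpenMap)
    -- That `dI_g ξ` lies in the domain for `Ad(g) Z` is automatic by equivariance, so only an open
    -- dense condition on the `U`-component remains.
    have h4 : starSetAt C g Z = {ξ : U × L | ξ ∈ domainSet U Z ∧
        ξ.1 ∈ e ⁻¹' {X : U | ∀ β, IsRoot h₀ β → C.StarAt (g.2 Z) β X}} := by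
      ext ξ
      constructor
      · rintro ⟨h5, -, h6⟩
        exact ⟨h5, h6⟩
      · rintro ⟨h5, h6⟩
        refine ⟨h5, ⟨?_, ?_⟩, h6⟩
        · change kerComponent (g.2 Z) (g.1 ξ.1) ≠ 0
          rw [kerComponent_groupAction hUinv hg]
          intro h0
          exact h5.1 ((injective_groupAction hg).1 (by rw [h0, map_zero]))
        · obtain ⟨α, hα, h7⟩ := h5.2
          exact ⟨α, hα, by rw [dI, h7, map_smul]⟩
    rw [h4]
    exact h3
  · rintro ξ ⟨hξ, -, hξ'⟩
    obtain ⟨ω, h⟩ := hω ξ hξ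
    have hZ0 : Z ≠ 0 := by
      intro h0
      refine hj ξ hξ (ContinuousLinearMap.ext fun x => ?_)
      rw [j_apply, h0, zero_lie]
      rfl
    obtain ⟨α, hα, h7⟩ := hξ.2
    refine firstHit_hasMaximalRankAt hL hUinv hZ0 h ξ ?_
      (NondegenerateAt.of_groupAction hUinv hg ?_)
    · rw [h7]
      exact smul_ne_zero hα hZ0
    · exact C.nondegenerateAt_of_starAt hL hmax hUinv hw hZ hξ'

theorem starSetAt_one (Z : L) : starSetAt C 1 Z = starSet U C Z := by
  ext ξ
  exact ⟨fun h => h.2, fun h => ⟨h.1, h⟩⟩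

end CompactChevalleyBasis

/-- If `k` witnesses super regularity, then `g k⁻¹` conjugates one element of `h₀` into the other,
and super regularity is carried along. -/
theorem isSuperRegularIn_of_isSuperRegular (hmax : IsMaximalAbelian h₀)
    (hUinv : ∀ (Z : L) (x y : U), ⟪⁅Z, x⁆, y⟫_ℝ = -⟪x, ⁅Z, y⁆⟫_ℝ) {Z : L}
    (hZ : IsSuperRegular U h₀ Z) {g : (U →L[ℝ] U) × (L →L[ℝ] L)} (hg : g ∈ groupAction L U)
    (hgZ : g.2 Z ∈ h₀) : IsSuperRegularIn h₀ U (g.2 Z) := by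
  obtain ⟨k, hk, hkZ⟩ := hZ
  obtain ⟨hk0, hkZ⟩ := (isSuperRegularIn_iff hUinv).1 hkZ
  obtain ⟨k', hk', -, h2⟩ := exists_inverse_groupAction hk
  refine (isSuperRegularIn_iff hUinv).2 ⟨hgZ, hkZ.of_groupAction hmax hUinv
    (Submonoid.mul_mem _ hg hk') (Z' := ⟨g.2 Z, hgZ⟩) ?_⟩
  change g.2 (k'.2 (k.2 Z)) = g.2 Z
  rw [(apply_of_mul_eq_one h2).2]

end Assembly

end

end FirstHit

theorem mainTheorem2
    {L : Type*} [InnerLieAlgebra L] [FiniteDimensional ℝ L]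
    {U : Type*} [NormedAddCommGroup U] [InnerProductSpace ℝ U] [FiniteDimensional ℝ U]
    [LieRingModule L U] [LieModule ℝ L U]
    -- `L` is compact semisimple
    (hL : IsCompactSemisimple L)
    -- the elements of `L` act on `U` by skew symmetric maps, without common kernel
    (hUinv : ∀ (Z : L) (x y : U), ⟪⁅Z, x⁆, y⟫_ℝ = -⟪x, ⁅Z, y⁆⟫_ℝ)
    (hker : ∀ u : U, (∀ Z : L, ⁅Z, u⁆ = 0) → u = 0)
    -- a maximal abelian subalgebra and a compact Chevalley basis
    (h₀ : LieSubalgebra ℝ L) (hh₀ : IsMaximalAbelian h₀) (C : CompactChevalleyBasis h₀)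
    -- a basis of `U` whose rational span is invariant under the compact Chevalley basis
    {ι : Type*} (ℬ : Module.Basis ι ℝ U)
    (hℬ : ∀ c ∈ C.toSet, ∀ v ∈ ratSpan (Set.range ℬ), ⁅c, v⁆ ∈ ratSpan (Set.range ℬ))
    -- all roots are weights of `ℂ ⊗ U` of multiplicity at least two
    (hmult : ∀ β : CartanDual h₀, IsRoot h₀ β →
      2 ≤ Module.finrank ℂ (weightSpace h₀ U β)) :
    (∀ Z ∈ C.hQ, IsSuperRegularIn h₀ U Z →
      FirstHitWellDefined U Z ∧
      IsDenseOpenIn (starSet U C Z) (domainSet U Z) ∧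
      FirstHitMaximalRankOn Z (starSet U C Z)) ∧
    (∀ Z ∈ gQ C ℬ, IsSuperRegular U h₀ Z →
      FirstHitWellDefined U Z ∧
      (∃ g ∈ rationalGroup L ℬ, g.2 Z ∈ C.hQ) ∧
      ∀ g ∈ rationalGroup L ℬ, g.2 Z ∈ C.hQ →
        IsDenseOpenIn (starSetAt C g Z) (domainSet U Z) ∧
        FirstHitMaximalRankOn Z (starSetAt C g Z)) := by
  refine ⟨fun Z hZ hs => ?_, fun Z hZ hs => ?_⟩
  · have h := C.firstHit_conjugate hL hh₀ hUinv hker hmult (Submonoid.one_mem (groupAction L U))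
      (Z := Z) hZ hs
    rwa [C.starSetAt_one] at h
  · have key : ∀ g ∈ rationalGroup L ℬ, g.2 Z ∈ C.hQ →
        FirstHitWellDefined U Z ∧ IsDenseOpenIn (starSetAt C g Z) (domainSet U Z) ∧
          FirstHitMaximalRankOn Z (starSetAt C g Z) := fun g hg hgZ =>
      C.firstHit_conjugate hL hh₀ hUinv hker hmult hg.1 hgZ
        (isSuperRegularIn_of_isSuperRegular hh₀ hUinv hs hg.1
          (C.exists_period hL hh₀ hUinv hgZ).1)
    obtain ⟨g, hg, H, hH, rfl⟩ := hZ
    -- With `Z = Ad(g) H`, the inverse of `g` brings `Z` back into `h_ℚ`.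
    obtain ⟨g', hg', -, h⟩ := exists_inverse_rationalGroup hg
    have hgH : g'.2 (g.2 H) ∈ C.hQ := by rwa [(apply_of_mul_eq_one h).2]
    exact ⟨(key g' hg' hgH).1, ⟨g', hg', hgH⟩, fun k hk hkZ => (key k hk hkZ).2⟩
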